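/- Conventions. All matroids are finite. For a matroid $M$ on a ground set $E$ with $|E|=n$ and a base $B$, let $P_B$ be the poset on $E$ whose only strict relations are $e<e'$ for $e\in B$, $e'\in E\setminus B$ such that $(B\setminus\{e\})\cup\{e'\}$ is a base. Label $E$ injectively by positive integers so that $x<_{P_B}y$ implies that the label of $x$ is larger than the label of $y$, and put $$F(M)=\sum_{B}F(P_B),\qquad F(P_B)=\sum_{\pi}L_{C(\pi)},$$ where $B$ runs over the bases of $M$, $\pi$ runs over the linear extensions of $P_B$ written as words in the labels, $C(\pi)$ is the composition of $n$ formed by the lengths of the successive increasing runs of $\pi$, and $L_\alpha$ is the fundamental quasisymmetric function of a composition $\alpha$; that is, $L_\alpha=\sum_{\beta}\sum_{i_1<\dots<i_k}x_{i_1}^{\beta_1}\cdots x_{i_k}^{\beta_k}$, where $\beta=(\beta_1,\dots,\beta_k)$ runs over the compositions refining $\alpha$. The function $F(M)$ does not depend on the labelings and depends only on the isomorphism class of $M$. Let $\mathrm{QSym}$ be the algebra of quasisymmetric functions over $\mathbb{Q}$, let $\mathfrak m=\bigoplus_{d\ge 1}\mathrm{QSym}_d$, and write $\overline{f}$ for the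 image of $f$ in $\mathrm{QSym}/\mathfrak m^2$. For a partition $\tau\vdash n$ with at least two parts, $[M_\tau]$ denotes the isomorphism class of loopless matroids of rank two on $n$ elements whose parallelism classes have as cardinalities the parts of $\tau$. For a matroid $M$ whose ground set is the standard basis $\{e_1,\dots,e_n\}$ of $\mathbb{R}^n$, let $Q(M)=\operatorname{conv}\{\sum_{e_i\in B}e_i : B \text{ a base of } M\}$. A matroid base polytope decomposition of $Q(M)$ is an equality $Q(M)=\bigcup_{i}Q(M_i)$ with finitely many pairwise distinct matroids $M_i$ on the same ground set such that for all $i\ne j$ the common bases of $M_i$ and $M_j$ are the bases of a matroid $M_i\cap M_j$, and $Q(M_i)\cap Q(M_j)=Q(M_i\cap M_j)$ is a face of both $Q(M_i)$ and $Q(M_j)$. **Theorem.** Let $\lambda\vdash n$ with $\ell(\lambda)\ge 3$, and let $J$ be a finite multiset of partitions of $n$, all of length at least three, such that $$\overline{F([M_\lambda])}=\sum_{\mu\in J}\overline{F([M_\mu])}\quad\text{in } \mathrm{QSym}/\mathfrak m^2 .$$ Then, taking the set of standard basis vectors of $\mathbb{R}^n$ as the common ground set, there are representative matroids $M_\lambda\in[M_\lambda]$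 and $M_\mu\in[M_\mu]$, one for each $\mu\in J$ counted with multiplicity, that form a matroid base polytope decomposition $$Q(M_\lambda)=\bigcup_{\mu\in J}Q(M_\mu).$$ -/

import Mathlib

noncomputable section

open scoped Classical

/-! ### Quasisymmetric functions over `ℚ` -/

/-- The algebra of quasisymmetric functions in the linearly ordered variables `x₀, x₁, x₂, …`:
power series `f` of bounded degree such that, for all `i₁ < ⋯ < i_k` and `j₁ < ⋯ < j_k` and all
exponents `a₁, …, a_k`, the coefficients of `x_{i₁}^{a₁} ⋯ x_{i_k}^{a_k}` and of
`x_{j₁}^{a₁} ⋯ x_{j_k}^{a_k}` in `f` agree. -/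
def QSym : Subalgebra ℚ (MvPowerSeries ℕ ℚ) where
  carrier := {f |
    (∃ N : ℕ, ∀ d : ℕ →₀ ℕ, MvPowerSeries.coeff d f ≠ 0 → d.degree ≤ N) ∧
    ∀ (k : ℕ) (i j : Fin k ↪o ℕ) (a : Fin k →₀ ℕ),
      MvPowerSeries.coeff (a.embDomain i.toEmbedding) f =
        MvPowerSeries.coeff (a.embDomain j.toEmbedding) f}
  mul_mem' := by
    rintro f g ⟨⟨N, hN⟩, hf⟩ ⟨⟨N', hN'⟩, hg⟩
    refine ⟨⟨N + N', fun d hd => ?_⟩, fun k i j a => ?_⟩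
    · rw [MvPowerSeries.coeff_mul] at hd
      obtain ⟨p, hp, hne⟩ := Finset.exists_ne_zero_of_sum_ne_zero hd
      rw [← Finset.HasAntidiagonal.mem_antidiagonal.1 hp, map_add]
      exact add_le_add (hN _ (left_ne_zero_of_mul hne)) (hN' _ (right_ne_zero_of_mul hne))
    · have hf' : MvPowerSeries.killCompl i.toEmbedding f =
          MvPowerSeries.killCompl j.toEmbedding f := by
        ext b
        simpa only [MvPowerSeries.coeff_killCompl] using hf k i j b
      have hg' : MvPowerSeries.killCompl i.toEmbedding g =
          MvPowerSeries.killCompl j.toEmbedding g := by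
        ext b
        simpa only [MvPowerSeries.coeff_killCompl] using hg k i j b
      rw [← MvPowerSeries.coeff_killCompl, ← MvPowerSeries.coeff_killCompl,
        map_mul (MvPowerSeries.killCompl i.toEmbedding),
        map_mul (MvPowerSeries.killCompl j.toEmbedding), hf', hg']
  add_mem' := by
    rintro f g ⟨⟨N, hN⟩, hf⟩ ⟨⟨N', hN'⟩, hg⟩
    refine ⟨⟨max N N', fun d hd => ?_⟩, fun k i j a => ?_⟩
    · by_cases h : MvPowerSeries.coeff d f = 0
      · refine (hN' d fun h' => hd ?_).trans (le_max_right _ _)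
        rw [map_add, h, h', add_zero]
      · exact (hN d h).trans (le_max_left _ _)
    · rw [map_add, map_add, hf k i j a, hg k i j a]
  algebraMap_mem' := by
    intro r
    refine ⟨⟨0, fun d hd => ?_⟩, fun k i j a => ?_⟩
    · rw [MvPowerSeries.algebraMap_apply, MvPowerSeries.coeff_C] at hd
      by_cases h : d = 0
      · simp [h]
      · simp [h] at hd
    · rw [← MvPowerSeries.coeff_killCompl, ← MvPowerSeries.coeff_killCompl,
        AlgHom.commutes, AlgHom.commutes]

/-- The ideal `𝔪 = ⨁_{d ≥ 1} QSym_d` of quasisymmetric functions without constant term. -/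
def QSym.maxIdeal : Ideal QSym :=
  RingHom.ker ((MvPowerSeries.constantCoeff (σ := ℕ) (R := ℚ)).comp QSym.val.toRingHom)

/-- The monomial quasisymmetric function
`x^α = ∑_{i₁ < ⋯ < i_k} x_{i₁}^{α₁} ⋯ x_{i_k}^{α_k}` as a power series. -/
def monomialSeries {n : ℕ} (α : Composition n) : MvPowerSeries ℕ ℚ := fun d =>
  if ∃ i : Fin α.length ↪o ℕ, d = ∑ l, Finsupp.single (i l) (α.blocksFun l) then 1 else 0

lemma monomialSeries_mem {n : ℕ} (α : Composition n) : monomialSeries α ∈ QSym := by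
  refine ⟨⟨n, fun d hd => ?_⟩, fun k i j a => ?_⟩
  · change (if ∃ i : Fin α.length ↪o ℕ, d = ∑ l, Finsupp.single (i l) (α.blocksFun l)
      then (1 : ℚ) else 0) ≠ 0 at hd
    by_cases h : ∃ i : Fin α.length ↪o ℕ, d = ∑ l, Finsupp.single (i l) (α.blocksFun l)
    · obtain ⟨i, rfl⟩ := h
      rw [map_sum]
      simp [α.sum_blocksFun]
    · simp [h] at hd
  · have key : ∀ i j : Fin k ↪o ℕ,
        (∃ e : Fin α.length ↪o ℕ,
          a.embDomain i.toEmbedding = ∑ l, Finsupp.single (e l) (α.blocksFun l)) →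
        (∃ e : Fin α.length ↪o ℕ,
          a.embDomain j.toEmbedding = ∑ l, Finsupp.single (e l) (α.blocksFun l)) := by
      rintro i j ⟨e, he⟩
      have hmem : ∀ l, ∃ m, i m = e l := by
        intro l
        by_contra hl
        push Not at hl
        have h0 : a.embDomain i.toEmbedding (e l) = 0 :=
          Finsupp.embDomain_of_notMem_range _ _ _ (by rintro ⟨m, hm⟩; exact hl m hm)
        rw [he, Finsupp.finsetSum_apply] at h0
        have h1 := (Finset.sum_eq_zero_iff.1 h0) l (Finset.mem_univ l)
        rw [Finsupp.single_eq_same] at h1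
        have := α.one_le_blocksFun l
        omega
      choose g hg using hmem
      have hgm : StrictMono g := by
        intro l l' hl
        rw [← i.lt_iff_lt, hg, hg]
        exact e.strictMono hl
      have ha : a = ∑ l, Finsupp.single (g l) (α.blocksFun l) := by
        apply Finsupp.embDomain_injective i.toEmbedding
        rw [he, ← Finsupp.embDomain.addMonoidHom_apply, map_sum]
        refine Finset.sum_congr rfl fun l _ => ?_
        rw [Finsupp.embDomain.addMonoidHom_apply, Finsupp.embDomain_single]
        simp [hg]
      refine ⟨(OrderEmbedding.ofStrictMono g hgm).trans j, ?_⟩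
      rw [ha, ← Finsupp.embDomain.addMonoidHom_apply, map_sum]
      refine Finset.sum_congr rfl fun l _ => ?_
      rw [Finsupp.embDomain.addMonoidHom_apply, Finsupp.embDomain_single]
      rfl
    change (if _ then (1 : ℚ) else 0) = (if _ then (1 : ℚ) else 0)
    exact if_congr ⟨key i j, key j i⟩ rfl rfl

/-- The monomial quasisymmetric function of a composition. -/
def monomialQSym {n : ℕ} (α : Composition n) : QSym := ⟨monomialSeries α, monomialSeries_mem α⟩

/-- The fundamental quasisymmetric function `L_α = ∑_{β refines α} x^β`, where a composition of `n`
is given by its set of partial sums (together with `0` and `n`), so that refinement is inclusion. -/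
def fundamentalQSym {n : ℕ} (α : CompositionAsSet n) : QSym :=
  ∑ β : CompositionAsSet n with α.boundaries ⊆ β.boundaries, monomialQSym β.toComposition

/-- The composition `C(w)` of `n` whose parts are the lengths of the successive increasing runs of
the sequence `w₀, …, w_{n-1}` of distinct numbers: its partial sums are `0`, `n` and the positions
`p` with `w_{p-1} > w_p`. -/
def runComposition {n : ℕ} (w : Fin n → ℕ) : CompositionAsSet n where
  boundaries := Finset.univ.filter fun p : Fin (n + 1) =>
    p = 0 ∨ p = Fin.last n ∨ ∃ i j : Fin n, (i : ℕ) + 1 = j ∧ (j : ℕ) = p ∧ w j < w i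
  zero_mem := by simp
  getLast_mem := by simp

/-- The quasisymmetric function `∑_π L_{C(π)}` of the poset on `Fin n` with strict order `lt`,
labeled by `γ`. The sum is over the linear extensions `π`, where `π p` is the element in position
`p`; such a linear extension is read as the sequence of labels `γ (π 0), …, γ (π (n-1))`. -/
def posetQSym {n : ℕ} (lt : Fin n → Fin n → Prop) (γ : Fin n → ℕ) : QSym :=
  ∑ π : Equiv.Perm (Fin n) with ∀ p q, lt (π p) (π q) → p < q,
    fundamentalQSym (runComposition fun p => γ (π p))

/-! ### The quasisymmetric function of a matroid on `Fin n` -/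

/-- The strict order of the base poset `P_B`: `e < e'` iff `e ∈ B`, `e' ∉ B` and `B - e + e'`
is a base. -/
def baseLT {n : ℕ} (M : Matroid (Fin n)) (B : Finset (Fin n)) (e e' : Fin n) : Prop :=
  e ∈ B ∧ e' ∉ B ∧ M.IsBase (insert e' ((B : Set (Fin n)) \ {e}))

/-- A strict labeling of the base poset of `B`: all labels on `B` exceed all labels off `B`. -/
def baseLabel {n : ℕ} (B : Finset (Fin n)) (e : Fin n) : ℕ := if e ∈ B then n + e + 1 else e + 1

lemma baseLabel_injective {n : ℕ} (B : Finset (Fin n)) : Function.Injective (baseLabel B) := by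
  intro x y h
  unfold baseLabel at h
  ext
  split_ifs at h <;> omega

lemma baseLabel_strict {n : ℕ} (M : Matroid (Fin n)) (B : Finset (Fin n)) (e e' : Fin n)
    (h : baseLT M B e e') : baseLabel B e' < baseLabel B e := by
  unfold baseLabel
  rw [if_pos h.1, if_neg h.2.1]
  omega

/-- `F(M) = ∑_B F(P_B)`, the sum over the bases of a matroid `M` with ground set `Fin n`. -/
def matroidQSym {n : ℕ} (M : Matroid (Fin n)) : QSym :=
  ∑ B ∈ Finset.univ.filter (fun B : Finset (Fin n) => M.IsBase (B : Set (Fin n))),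
    posetQSym (baseLT M B) (baseLabel B)

/-! ### Loopless matroids of rank two -/

/-- The parallelism class of `e` in a loopless matroid. -/
def parallelClass {n : ℕ} (M : Matroid (Fin n)) (e : Fin n) : Finset (Fin n) :=
  Finset.univ.filter fun f => f = e ∨ M.IsCircuit {e, f}

/-- `M` belongs to the isomorphism class `[M_τ]`, i.e. `M` is a loopless matroid of rank two on the
ground set `Fin n` and the multiset of the sizes of its parallelism classes is `τ`. -/
structure IsRankTwoOfType {n : ℕ} (τ : n.Partition) (M : Matroid (Fin n)) : Prop where
  ground : M.E = Set.univ
  loopless : M.Loopless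
  rank : M.eRank = 2
  parts : (Finset.univ.image (parallelClass M)).val.map Finset.card = τ.parts

/-- The composition listing the parts of `τ` in weakly decreasing order. -/
def partitionComposition {n : ℕ} (τ : n.Partition) : Composition n where
  blocks := τ.parts.sort (· ≥ ·)
  blocks_pos := fun {i} hi => τ.parts_pos ((Multiset.mem_sort _).1 hi)
  blocks_sum := by
    rw [← Multiset.sum_coe, Multiset.sort_eq, τ.parts_sum]

/-- The block of `e` when `Fin n` is cut into consecutive blocks of sizes `τ₁ ≥ τ₂ ≥ ⋯`. -/
def blockOf {n : ℕ} (τ : n.Partition) (e : Fin n) : Fin (partitionComposition τ).length :=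
  (partitionComposition τ).index e

/-- The standard representative `M_τ`: `Fin n` is cut into consecutive blocks of sizes
`τ₁ ≥ τ₂ ≥ ⋯`, and the independent sets are the sets of at most two elements that meet each block
at most once. -/
def rankTwoMatroid {n : ℕ} (τ : n.Partition) : Matroid (Fin n) :=
  (IndepMatroid.ofFinite (E := Set.univ) Set.finite_univ
    (fun I => I.ncard ≤ 2 ∧ Set.InjOn (blockOf τ) I)
    (by simp)
    (fun I J hJ hIJ => ⟨(Set.ncard_le_ncard hIJ (Set.toFinite J)).trans hJ.1, hJ.2.mono hIJ⟩)
    (by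
      rintro I J ⟨_, hI⟩ ⟨hJ2, hJ⟩ hlt
      have hcard : (blockOf τ '' I).ncard < (blockOf τ '' J).ncard := by
        rwa [hI.ncard_image, hJ.ncard_image]
      obtain ⟨_, ⟨e, he, rfl⟩, hne⟩ := Set.exists_mem_notMem_of_ncard_lt_ncard hcard
      have heI : e ∉ I := fun h => hne ⟨e, h, rfl⟩
      refine ⟨e, he, heI, ?_, (Set.injOn_insert heI).2 ⟨hI, hne⟩⟩
      rw [Set.ncard_insert_of_notMem heI]
      omega)
    (fun I _ => Set.subset_univ I)).matroid

lemma rankTwoMatroid_indep_iff {n : ℕ} (τ : n.Partition) (I : Set (Fin n)) :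
    (rankTwoMatroid τ).Indep I ↔ I.ncard ≤ 2 ∧ Set.InjOn (blockOf τ) I := Iff.rfl

lemma rankTwoMatroid_isRankTwoOfType {n : ℕ} (τ : n.Partition) (h : 2 ≤ τ.parts.card) :
    IsRankTwoOfType τ (rankTwoMatroid τ) := by
  have hcard : 2 ≤ (partitionComposition τ).length := by
    simpa [partitionComposition, Composition.length] using h
  have hfib : ∀ l, (Finset.univ.filter fun f => blockOf τ f = l).card =
      (partitionComposition τ).blocksFun l := by
    intro l
    have : (Finset.univ.filter fun f => blockOf τ f = l) =
        Finset.univ.map ((partitionComposition τ).embedding l).toEmbedding := by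
      ext f
      simp only [Finset.mem_filter, Finset.mem_univ, true_and, Finset.mem_map]
      have := (partitionComposition τ).mem_range_embedding_iff' (j := f) (i := l)
      simp only [Set.mem_range] at this
      exact ⟨fun hf => this.2 hf.symm, fun hf => (this.1 hf).symm⟩
    rw [this, Finset.card_map, Finset.card_univ, Fintype.card_fin]
  have hsurj : Function.Surjective (blockOf τ) := fun l =>
    ⟨(partitionComposition τ).embedding l ⟨0, (partitionComposition τ).one_le_blocksFun l⟩,
      (partitionComposition τ).index_embedding _ _⟩
  have hpair : ∀ e f : Fin n, e ≠ f →
      ((rankTwoMatroid τ).Indep {e, f} ↔ blockOf τ e ≠ blockOf τ f) := by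
    intro e f hef
    rw [rankTwoMatroid_indep_iff, Set.ncard_pair hef]
    simp [hef]
  have hsing : ∀ e : Fin n, (rankTwoMatroid τ).Indep {e} := by
    intro e
    rw [rankTwoMatroid_indep_iff]
    simp
  have hclass : ∀ e, parallelClass (rankTwoMatroid τ) e =
      Finset.univ.filter fun f => blockOf τ f = blockOf τ e := by
    intro e
    ext f
    simp only [parallelClass, Finset.mem_filter, Finset.mem_univ, true_and]
    by_cases hef : e = f
    · simp [hef]
    · constructor
      · rintro (hf | hf)
        · exact absurd hf.symm hef
        · by_contra hne
          exact hf.not_indep ((hpair e f hef).2 fun h' => hne h'.symm)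
      · intro hf
        right
        rw [Matroid.isCircuit_iff_forall_ssubset]
        refine ⟨⟨fun hi => (hpair e f hef).1 hi hf.symm, Set.subset_univ _⟩, ?_⟩
        intro I hI
        rw [Set.ssubset_iff_exists] at hI
        obtain ⟨hsub, x, hx, hxI⟩ := hI
        rcases hx with rfl | rfl
        · refine (hsing f).subset fun y hy => ?_
          rcases hsub hy with rfl | rfl
          · exact absurd hy hxI
          · rfl
        · refine (hsing e).subset fun y hy => ?_
          rcases hsub hy with rfl | rfl
          · rfl
          · exact absurd hy hxI
  refine ⟨rfl, ?_, ?_, ?_⟩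
  · rw [Matroid.loopless_iff_forall_isNonloop]
    exact fun e _ => Matroid.indep_singleton.1 (hsing e)
  · obtain ⟨e, he⟩ := hsurj ⟨0, by omega⟩
    obtain ⟨f, hf⟩ := hsurj ⟨1, by omega⟩
    have hne : blockOf τ e ≠ blockOf τ f := by
      rw [he, hf]
      simp
    have hef : e ≠ f := fun h' => hne (congrArg _ h')
    apply le_antisymm
    · rw [Matroid.eRank]
      refine iSup_le fun B => ?_
      have := ((rankTwoMatroid_indep_iff τ B.1).1 B.2.indep).1
      rw [← (Set.toFinite B.1).cast_ncard_eq]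
      exact_mod_cast this
    · have := ((hpair e f hef).2 hne).encard_le_eRank
      rwa [Set.encard_pair hef] at this
  · have himg : Finset.univ.image (parallelClass (rankTwoMatroid τ)) =
        Finset.univ.image (fun l => Finset.univ.filter fun f => blockOf τ f = l) := by
      ext S
      simp only [Finset.mem_image, Finset.mem_univ, true_and, hclass]
      constructor
      · rintro ⟨e, rfl⟩
        exact ⟨_, rfl⟩
      · rintro ⟨l, rfl⟩
        obtain ⟨e, rfl⟩ := hsurj l
        exact ⟨e, rfl⟩
    have hinj : Function.Injective
        (fun l => Finset.univ.filter fun f => blockOf τ f = l) := by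
      intro l l' hl
      obtain ⟨e, rfl⟩ := hsurj l
      have : e ∈ Finset.univ.filter fun f => blockOf τ f = l' := by
        have hl' := Finset.ext_iff.1 hl e
        exact hl'.1 (by simp)
      simpa using this
    rw [himg, Finset.image_val_of_injOn hinj.injOn, Multiset.map_map]
    have h2 : (Finset.card ∘ fun l => Finset.univ.filter fun f => blockOf τ f = l) =
        (partitionComposition τ).blocksFun := funext hfib
    rw [h2]
    have h3 : τ.parts = ((partitionComposition τ).blocks : Multiset ℕ) := by
      simp [partitionComposition]
    rw [h3, ← (partitionComposition τ).ofFn_blocksFun]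
    simp [Fin.univ_def, List.ofFn_eq_map]

/-- The image of `F([M_τ])` in `QSym/𝔪²`. -/
def rankTwoBar {n : ℕ} (τ : n.Partition) : QSym ⧸ QSym.maxIdeal ^ 2 :=
  Ideal.Quotient.mk (QSym.maxIdeal ^ 2) (matroidQSym (rankTwoMatroid τ))

/-! ### Matroid base polytopes -/

/-- The matroid base polytope `Q(M) = conv {∑_{i ∈ B} e_i : B a base of M}` in `ℝⁿ`. -/
def basePolytope {n : ℕ} (M : Matroid (Fin n)) : Set (Fin n → ℝ) :=
  convexHull ℝ {x | ∃ B : Set (Fin n), M.IsBase B ∧ x = B.indicator 1}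

/-- The matroids `N i` (pairwise distinct) form a matroid base polytope decomposition
`Q(M) = ⋃ i, Q(N i)`: for `i ≠ j`, the common bases of `N i` and `N j` are the bases of a matroid
`N i ∩ N j`, and `Q(N i) ∩ Q(N j) = Q(N i ∩ N j)` is a face of both `Q(N i)` and `Q(N j)`. -/
structure IsBasePolytopeDecomposition {n : ℕ} {ι : Type*} (M : Matroid (Fin n))
    (N : ι → Matroid (Fin n)) : Prop where
  ground : M.E = Set.univ ∧ ∀ i, (N i).E = Set.univ
  union : basePolytope M = ⋃ i, basePolytope (N i)
  distinct : Function.Injective N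
  inter : ∀ i j, i ≠ j → ∃ K : Matroid (Fin n), K.E = Set.univ ∧
    (∀ B, K.IsBase B ↔ (N i).IsBase B ∧ (N j).IsBase B) ∧
    basePolytope (N i) ∩ basePolytope (N j) = basePolytope K ∧
    IsExposed ℝ (basePolytope (N i)) (basePolytope K) ∧
    IsExposed ℝ (basePolytope (N j)) (basePolytope K)

end

noncomputable section

open scoped Classical

/-! ### Coefficients of poset quasisymmetric functions -/

/-! The hypothesis is an identity modulo `𝔪²`, so it is tested by functionals that kill `𝔪²`. In the
convolution algebra dual to `QSym`, let `ζ_y` be the character that evaluates at the single letter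
`y`. Its logarithmic derivative `infChar y = ζ_y' * ζ_y⁻¹` is an infinitesimal character, and the
commutator of `infChar s` and `infChar t` again kills `𝔪²` (`commutatorChar_eq_zero`).

By the theory of strict P-partitions (`coeff_posetQSym`), the function of `P_B` counts strict maps,
and for a base of a rank two matroid these can be summed explicitly. If the classes of the two
elements of `B` have sizes `a` and `a'`, then `infChar s * infChar t` takes the value `(-s)^(a-1)
(-t)^(n-a-1) + (-s)^(a'-1) (-t)^(n-a'-1)`. Summing over bases and putting `s = -x`, `t = -1`, the
commutator of `F(M_τ)` is `∑ a (n - a) (x^(a-1) - x^(n-a-1))` over the parts `a` of `τ`. Hence the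
excess, the number of parts `a` minus the number of parts `n - a`, is the same for `λ` as for the
union of `J` (`excess_eq_of_rankTwoBar_eq`).

The rest is combinatorial (`exists_gluing`). Let `a` be the least number occurring more often in the
union of `J` than in `λ`. Equal excess gives some `μ ∈ J` with a part `n - a`; its other parts sum
to `a`, are smaller than `a`, and by minimality occur among the parts of `λ`. Let `U` be a union of
classes of `M_λ` of these sizes. The hyperplane `x(U) = 1` cuts off a piece of type `μ`; on the
other side `U` has become a single class, the excess condition persists for `J` without `μ`, and
induction applies. If no such `a` exists, comparing sums gives `J = {λ}`.

Geometrically, `Q(M)` is cut out by `x ≥ 0`, `∑ x = 2` and `x(A) ≤ 1` for every class `A`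
(`basePolytope_part`). Two different pieces have classes `S` and `T` covering the ground set, which
forces `x(S) = x(T) = 1` on the intersection and makes it a common face (`exists_inter_matroid`). -/

/-- The exponent of the monomial `∏ e, x_{w e}`. -/
def content {n : ℕ} (w : Fin n → ℕ) : ℕ →₀ ℕ := ∑ e, Finsupp.single (w e) 1

lemma toMultiset_content {n : ℕ} (w : Fin n → ℕ) :
    Finsupp.toMultiset (content w) = (List.ofFn w : Multiset ℕ) := by
  rw [content, map_sum]
  simp only [Finsupp.toMultiset_single, one_smul]
  rw [← Fin.univ_val_map, ← Multiset.sum_map_singleton (Multiset.map w _), Multiset.map_map]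
  rfl

lemma content_comp_perm {n : ℕ} (w : Fin n → ℕ) (σ : Equiv.Perm (Fin n)) :
    content (w ∘ σ) = content w :=
  Equiv.sum_comp σ fun e => Finsupp.single (w e) 1

/-- Lets an exponent of degree `n` be handled as the unique weakly increasing word with that
content. -/
lemma eq_of_monotone_of_content_eq {n : ℕ} {v w : Fin n → ℕ} (hv : Monotone v) (hw : Monotone w)
    (h : content v = content w) : v = w := by
  have h1 := congrArg Finsupp.toMultiset h
  rw [toMultiset_content, toMultiset_content, Multiset.coe_eq_coe] at h1
  exact List.ofFn_injective (h1.eq_of_pairwise' hv.sortedLE_ofFn.pairwise hw.sortedLE_ofFn.pairwise)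

/-- The composition whose partial sums are the positions where `v` increases strictly. -/
def ascentComposition {n : ℕ} (v : Fin n → ℕ) : CompositionAsSet n where
  boundaries := Finset.univ.filter fun p : Fin (n + 1) =>
    p = 0 ∨ p = Fin.last n ∨ ∃ i j : Fin n, (i : ℕ) + 1 = j ∧ (j : ℕ) = p ∧ v i < v j
  zero_mem := by simp
  getLast_mem := by simp

/-- Both ends belong to every composition, so only the descents of `w` impose a condition. -/
lemma runComposition_subset_iff {n : ℕ} (w v : Fin n → ℕ) :
    (runComposition w).boundaries ⊆ (ascentComposition v).boundaries ↔
      ∀ i j : Fin n, (i : ℕ) + 1 = j → w j < w i → v i < v j := by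
  constructor
  · intro h i j hij hw
    have hmem : (⟨j, by omega⟩ : Fin (n + 1)) ∈ (runComposition w).boundaries := by
      simp only [runComposition, Finset.mem_filter, Finset.mem_univ, true_and]
      exact Or.inr (Or.inr ⟨i, j, hij, rfl, hw⟩)
    have := h hmem
    simp only [ascentComposition, Finset.mem_filter, Finset.mem_univ, true_and, Fin.ext_iff] at this
    rcases this with h0 | h0 | ⟨i', j', hij', hj', hv⟩
    · simp at h0; omega
    · simp at h0; omega
    · have h1 : j' = j := Fin.ext hj'
      have h2 : i' = i := Fin.ext (by subst h1; omega)
      rwa [h1, h2] at hv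
  · intro h p hp
    simp only [runComposition, ascentComposition, Finset.mem_filter, Finset.mem_univ,
      true_and] at hp ⊢
    rcases hp with hp | hp | ⟨i, j, hij, hj, hw⟩
    · exact Or.inl hp
    · exact Or.inr (Or.inl hp)
    · exact Or.inr (Or.inr ⟨i, j, hij, hj, h i j hij hw⟩)

lemma content_comp_index {n : ℕ} (c : Composition n) (i : Fin c.length → ℕ) :
    content (i ∘ c.index) = ∑ l, Finsupp.single (i l) (c.blocksFun l) := by
  rw [content, ← Equiv.sum_comp c.blocksFinEquiv, Fintype.sum_sigma]
  refine Finset.sum_congr rfl fun l _ => ?_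
  simp [Composition.blocksFinEquiv, Finsupp.smul_single]

lemma sizeUpTo_le_of_lt {n : ℕ} (c : Composition n) {a b : ℕ} (h : a < b) :
    c.sizeUpTo (a + 1) ≤ c.sizeUpTo b :=
  c.monotone_sizeUpTo h

lemma index_le_iff {n : ℕ} (c : Composition n) (e : Fin n) (l : Fin c.length) :
    c.index e ≤ l ↔ (e : ℕ) < c.sizeUpTo (l + 1) := by
  constructor
  · intro h
    exact (c.lt_sizeUpTo_index_succ e).trans_le (c.monotone_sizeUpTo (Nat.succ_le_succ h))
  · intro h
    by_contra hlt
    push Not at hlt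
    have := sizeUpTo_le_of_lt c (Fin.lt_def.1 hlt)
    have := c.sizeUpTo_index_le e
    omega

lemma index_monotone {n : ℕ} (c : Composition n) : Monotone c.index := by
  intro e f hef
  rw [index_le_iff]
  have := c.lt_sizeUpTo_index_succ f
  exact (Fin.le_def.1 hef).trans_lt this

lemma mem_boundaries_iff {n : ℕ} (c : Composition n) (p : Fin (n + 1)) :
    p ∈ c.boundaries ↔ ∃ k ≤ c.length, c.sizeUpTo k = p := by
  simp only [Composition.boundaries, Finset.mem_map, Finset.mem_univ, true_and]
  constructor
  · rintro ⟨k, rfl⟩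
    exact ⟨k, Nat.lt_succ_iff.1 k.2, rfl⟩
  · rintro ⟨k, hk, h⟩
    exact ⟨⟨k, Nat.lt_succ_iff.2 hk⟩, Fin.ext h⟩

lemma ascentComposition_index {n : ℕ} (c : Composition n) (i : Fin c.length ↪o ℕ) :
    (ascentComposition (i ∘ c.index)).boundaries = c.boundaries := by
  ext p
  rw [mem_boundaries_iff]
  simp only [ascentComposition, Finset.mem_filter, Finset.mem_univ, true_and, Function.comp,
    i.lt_iff_lt]
  constructor
  · rintro (rfl | rfl | ⟨e, f, hef, hp, hlt⟩)
    · exact ⟨0, by simp, by simp⟩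
    · exact ⟨c.length, le_rfl, by simp⟩
    · refine ⟨c.index f, (c.index f).2.le, ?_⟩
      have h1 := c.sizeUpTo_index_le f
      have h2 : c.sizeUpTo (c.index f) > e := by
        have h3 : (e : ℕ) < c.sizeUpTo (c.index e + 1) := c.lt_sizeUpTo_index_succ e
        have := sizeUpTo_le_of_lt c (Fin.lt_def.1 hlt)
        omega
      omega
  · rintro ⟨k, hk, hkp⟩
    by_cases h0 : p = 0
    · exact Or.inl h0
    by_cases hl : p = Fin.last n
    · exact Or.inr (Or.inl hl)
    have hp0 : 0 < (p : ℕ) := Nat.pos_of_ne_zero fun h => h0 (Fin.ext h)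
    have hpn : (p : ℕ) < n := lt_of_le_of_ne (Nat.lt_succ_iff.1 p.2) fun h => hl (Fin.ext h)
    have hk0 : k ≠ 0 := by rintro rfl; simp at hkp; omega
    refine Or.inr (Or.inr ⟨⟨p - 1, by omega⟩, ⟨p, hpn⟩, by simp; omega, rfl, ?_⟩)
    have hle : c.index ⟨p - 1, by omega⟩ ≤ ⟨k - 1, by omega⟩ := by
      rw [index_le_iff]
      simp only
      rw [Nat.sub_add_cancel (Nat.pos_of_ne_zero hk0), hkp]
      omega
    refine hle.trans_lt ?_
    rw [← not_le, index_le_iff]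
    simp only
    rw [Nat.sub_add_cancel (Nat.pos_of_ne_zero hk0), hkp]
    omega

lemma eq_of_no_ascent {n : ℕ} {v : Fin n → ℕ} (hv : Monotone v) {a b : ℕ} (hab : a ≤ b)
    (hb : b < n) (h : ∀ p : Fin (n + 1), a < (p : ℕ) → (p : ℕ) ≤ b →
      p ∉ (ascentComposition v).boundaries) : v ⟨b, hb⟩ = v ⟨a, by omega⟩ := by
  induction b, hab using Nat.le_induction with
  | base => rfl
  | succ b hab ih =>
    rw [← ih (by omega) fun p hp hp' => h p hp (by omega)]
    have := h ⟨b + 1, by omega⟩ (by simp; omega) le_rfl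
    simp only [ascentComposition, Finset.mem_filter, Finset.mem_univ, true_and, not_or,
      not_exists, not_and, not_lt] at this
    exact le_antisymm (this.2.2 ⟨b, by omega⟩ ⟨b + 1, hb⟩ rfl rfl)
      (hv (Fin.le_def.2 (by simp)))

/-- No boundary lies strictly inside a block, so `v` is constant there; it jumps at the start of
every later block. The embedding reads `v` at the block starts. -/
lemma exists_eq_comp_index {n : ℕ} {v : Fin n → ℕ} (hv : Monotone v) (c : Composition n)
    (h : (ascentComposition v).boundaries = c.boundaries) :
    ∃ i : Fin c.length ↪o ℕ, v = i ∘ c.index := by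
  have hlt : ∀ l : Fin c.length, c.sizeUpTo l < n := fun l =>
    (c.sizeUpTo_strict_mono l.2).trans_le (c.sizeUpTo_le _)
  have hcomp : ∀ e, v e = v ⟨c.sizeUpTo (c.index e), hlt _⟩ := by
    intro e
    refine eq_of_no_ascent hv (c.sizeUpTo_index_le e) e.2 fun p hp hp' => ?_
    rw [h, mem_boundaries_iff]
    rintro ⟨k, hk, hkp⟩
    have h1 : (e : ℕ) < c.sizeUpTo (c.index e + 1) := c.lt_sizeUpTo_index_succ e
    rcases le_or_gt k (c.index e : ℕ) with hk' | hk'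
    · have := c.monotone_sizeUpTo hk'
      omega
    · have := sizeUpTo_le_of_lt c hk'
      omega
  have hmono : StrictMono fun l : Fin c.length => v ⟨c.sizeUpTo l, hlt l⟩ := by
    intro l l' hll
    refine lt_of_le_of_ne (hv (Fin.le_def.2 (c.monotone_sizeUpTo hll.le))) fun heq => ?_
    have hl'0 : 0 < c.sizeUpTo l' := by
      have := c.sizeUpTo_strict_mono l.2
      have := sizeUpTo_le_of_lt c (Fin.lt_def.1 hll)
      omega
    have hmem : (⟨c.sizeUpTo l', by have := hlt l'; omega⟩ : Fin (n + 1)) ∈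
        (ascentComposition v).boundaries := by
      rw [h, mem_boundaries_iff]
      exact ⟨l', l'.2.le, rfl⟩
    simp only [ascentComposition, Finset.mem_filter, Finset.mem_univ, true_and, Fin.ext_iff]
      at hmem
    rcases hmem with h0 | h0 | ⟨e, f, hef, hf, hvlt⟩
    · simp at h0; omega
    · simp at h0; have := hlt l'; omega
    · have hf' : f = ⟨c.sizeUpTo l', hlt l'⟩ := Fin.ext hf
      have : v ⟨c.sizeUpTo l, hlt l⟩ ≤ v e := by
        apply hv
        rw [Fin.le_def]
        have h1 := c.sizeUpTo_strict_mono l.2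
        have h2 := sizeUpTo_le_of_lt c (Fin.lt_def.1 hll)
        show c.sizeUpTo l ≤ e
        omega
      have heq' : v ⟨c.sizeUpTo l, hlt l⟩ = v f := by rw [hf']; exact heq
      omega
  exact ⟨OrderEmbedding.ofStrictMono _ hmono, funext hcomp⟩

lemma coeff_monomialQSym {n : ℕ} (β : CompositionAsSet n) (d : ℕ →₀ ℕ) :
    MvPowerSeries.coeff d (monomialQSym β.toComposition : MvPowerSeries ℕ ℚ) =
      if ∃ v : Fin n → ℕ, Monotone v ∧ content v = d ∧ ascentComposition v = β then 1 else 0 := by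
  change (if _ then (1 : ℚ) else 0) = _
  refine if_congr ⟨?_, ?_⟩ rfl rfl
  · rintro ⟨i, rfl⟩
    refine ⟨i ∘ β.toComposition.index, i.monotone.comp (index_monotone _),
      content_comp_index _ _, CompositionAsSet.ext ?_⟩
    rw [ascentComposition_index, CompositionAsSet.toComposition_boundaries]
  · rintro ⟨v, hv, rfl, rfl⟩
    obtain ⟨i, hi⟩ := exists_eq_comp_index hv (ascentComposition v).toComposition
      (by rw [CompositionAsSet.toComposition_boundaries])
    refine ⟨i, ?_⟩
    rw [← content_comp_index, ← hi]

lemma coeff_fundamentalQSym {n : ℕ} (α : CompositionAsSet n) (d : ℕ →₀ ℕ) :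
    MvPowerSeries.coeff d (fundamentalQSym α : MvPowerSeries ℕ ℚ) =
      if ∃ v : Fin n → ℕ, Monotone v ∧ content v = d ∧
        α.boundaries ⊆ (ascentComposition v).boundaries then 1 else 0 := by
  rw [fundamentalQSym, AddSubmonoidClass.coe_finsetSum, map_sum]
  simp only [coeff_monomialQSym]
  by_cases hd : ∃ v : Fin n → ℕ, Monotone v ∧ content v = d
  · obtain ⟨v, hv, rfl⟩ := hd
    have h1 : ∀ β : CompositionAsSet n, (∃ v' : Fin n → ℕ, Monotone v' ∧ content v' = content v ∧
        ascentComposition v' = β) ↔ ascentComposition v = β := by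
      refine fun β => ⟨?_, fun h => ⟨v, hv, rfl, h⟩⟩
      rintro ⟨v', hv', hc, rfl⟩
      rw [eq_of_monotone_of_content_eq hv' hv hc]
    have h2 : (∃ v' : Fin n → ℕ, Monotone v' ∧ content v' = content v ∧
        α.boundaries ⊆ (ascentComposition v').boundaries) ↔
        α.boundaries ⊆ (ascentComposition v).boundaries := by
      refine ⟨?_, fun h => ⟨v, hv, rfl, h⟩⟩
      rintro ⟨v', hv', hc, h⟩
      rwa [eq_of_monotone_of_content_eq hv' hv hc] at h
    simp only [h1, h2]
    rw [Finset.sum_ite_eq]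
    simp
  · rw [if_neg (fun ⟨v, hv, hc, _⟩ => hd ⟨v, hv, hc⟩)]
    refine Finset.sum_eq_zero fun β _ => if_neg fun ⟨v, hv, hc, _⟩ => hd ⟨v, hv, hc⟩

lemma strictMono_of_adjacent {n : ℕ} {β : Type*} [Preorder β] {g : Fin n → β}
    (h : ∀ i j : Fin n, (i : ℕ) + 1 = j → g i < g j) : StrictMono g := by
  cases n with
  | zero => exact fun i => i.elim0
  | succ n => exact Fin.strictMono_iff_lt_succ.2 fun i => h _ _ (by simp)

/-- Turns the descent condition into sortedness by value with ties broken by label, so that a linear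
extension can be recovered from a map by sorting. -/
lemma strictMono_toLex_iff {n : ℕ} {v w : Fin n → ℕ} (hw : Function.Injective w) :
    StrictMono (fun p => toLex (v p, w p)) ↔
      Monotone v ∧ ∀ i j : Fin n, (i : ℕ) + 1 = j → w j < w i → v i < v j := by
  constructor
  · intro h
    refine ⟨fun i j hij => ?_, fun i j hij hw' => ?_⟩
    · rcases hij.eq_or_lt with rfl | hij
      · exact le_rfl
      · rcases Prod.Lex.toLex_lt_toLex.1 (h hij) with h' | h'
        · exact h'.le
        · exact h'.1.le
    · have hlt : i < j := Fin.lt_def.2 (by omega)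
      rcases Prod.Lex.toLex_lt_toLex.1 (h hlt) with h' | h'
      · exact h'
      · exact absurd h'.2 (by simp only; omega)
  · rintro ⟨hv, h⟩
    refine strictMono_of_adjacent fun i j hij => Prod.Lex.toLex_lt_toLex.2 ?_
    have hlt : i < j := Fin.lt_def.2 (by omega)
    rcases (hv hlt.le).lt_or_eq with h' | h'
    · exact Or.inl h'
    · refine Or.inr ⟨h', ?_⟩
      by_contra hcon
      have hne : w i ≠ w j := fun h => hlt.ne (hw h)
      have := h i j hij (by simp only at hcon; omega)
      omega

/-- The functions strictly increasing along the relation `lt` with values below `N`. -/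
def strictMaps {n : ℕ} (lt : Fin n → Fin n → Prop) (N : ℕ) : Finset (Fin n → ℕ) :=
  (Fintype.piFinset fun _ => Finset.range N).filter fun w => ∀ x y, lt x y → w x < w y

lemma content_support {n : ℕ} (w : Fin n → ℕ) (e : Fin n) : w e ∈ (content w).support := by
  rw [Finsupp.mem_support_iff, content, Finsupp.finsetSum_apply]
  intro h
  have := Finset.sum_eq_zero_iff.1 h e (Finset.mem_univ e)
  simp at this

/-- The fundamental lemma of P-partitions in its strict form: a strict map corresponds to the linear
extension that sorts the elements by value, and by label among equal values. -/
lemma coeff_posetQSym {n : ℕ} {lt : Fin n → Fin n → Prop} {γ : Fin n → ℕ}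
    (hγ : Function.Injective γ) (hlt : ∀ x y, lt x y → γ y < γ x) {N : ℕ} {d : ℕ →₀ ℕ}
    (hd : d.support ⊆ Finset.range N) :
    MvPowerSeries.coeff d (posetQSym lt γ : MvPowerSeries ℕ ℚ) =
      ((strictMaps lt N).filter fun w => content w = d).card := by
  have hsum : MvPowerSeries.coeff d (posetQSym lt γ : MvPowerSeries ℕ ℚ) =
      ((Finset.univ.filter fun π : Equiv.Perm (Fin n) =>
        (∀ p q, lt (π p) (π q) → p < q) ∧ ∃ v : Fin n → ℕ, content v = d ∧
          StrictMono fun p => toLex (v p, γ (π p))).card : ℚ) := by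
    rw [posetQSym, AddSubmonoidClass.coe_finsetSum, map_sum]
    simp only [coeff_fundamentalQSym, runComposition_subset_iff]
    rw [Finset.sum_boole, Finset.filter_filter]
    congr 3
    ext π
    refine and_congr_right fun _ => exists_congr fun v => ?_
    rw [strictMono_toLex_iff (w := fun p => γ (π p)) (hγ.comp π.injective)]
    tauto
  rw [hsum, Nat.cast_inj]
  by_cases hv : ∃ v : Fin n → ℕ, Monotone v ∧ content v = d
  swap
  · rw [Finset.card_eq_zero.2, Finset.card_eq_zero.2]
    · refine Finset.filter_eq_empty_iff.2 fun w _ hw => hv ⟨w ∘ Tuple.sort w, Tuple.monotone_sort w, ?_⟩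
      rw [content_comp_perm, hw]
    · refine Finset.filter_eq_empty_iff.2 ?_
      rintro π - ⟨_, v, hc, hm⟩
      exact hv ⟨v, ((strictMono_toLex_iff (hγ.comp π.injective)).1 hm).1, hc⟩
  obtain ⟨v, hv, hc⟩ := hv
  have huniq : ∀ π : Equiv.Perm (Fin n), (∃ v' : Fin n → ℕ, content v' = d ∧
      StrictMono fun p => toLex (v' p, γ (π p))) → StrictMono fun p => toLex (v p, γ (π p)) := by
    rintro π ⟨v', hc', hm⟩
    rwa [eq_of_monotone_of_content_eq ((strictMono_toLex_iff (hγ.comp π.injective)).1 hm).1 hv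
      (hc'.trans hc.symm)] at hm
  refine Finset.card_bij (fun π _ => v ∘ π.symm) ?_ ?_ ?_
  · intro π hπ
    obtain ⟨hext, hex⟩ := (Finset.mem_filter.1 hπ).2
    have hm := huniq π hex
    have hc' : content (v ∘ π.symm) = d := (content_comp_perm v π.symm).trans hc
    refine Finset.mem_filter.2 ⟨Finset.mem_filter.2 ⟨?_, ?_⟩, hc'⟩
    · refine Fintype.mem_piFinset.2 fun e => hd ?_
      rw [← hc']
      exact content_support _ e
    · intro x y hxy
      have hpq := hext (π.symm x) (π.symm y) (by simpa using hxy)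
      rcases Prod.Lex.toLex_lt_toLex.1 (hm hpq) with h' | h'
      · exact h'
      -- A tie in value would put the label of `x` below that of `y`, against the strictness of the
      -- labeling.
      · have := hlt x y hxy
        have h2 := h'.2
        simp only [Equiv.apply_symm_apply] at h2
        omega
  · intro π hπ π' hπ' heq
    have hm := huniq π (Finset.mem_filter.1 hπ).2.2
    have hm' := huniq π' (Finset.mem_filter.1 hπ').2.2
    set k : Fin n → Lex (ℕ × ℕ) := fun e => toLex (v (π.symm e), γ e) with hk
    have hkinj : Function.Injective k := fun a b hab =>
      hγ (Prod.ext_iff.1 (toLex.injective hab)).2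
    have h1 : (fun p => toLex (v p, γ (π p))) = k ∘ π := by
      funext p
      simp [hk]
    have h2 : (fun p => toLex (v p, γ (π' p))) = k ∘ π' := by
      funext p
      have := congrFun heq (π' p)
      simp only [Function.comp, Equiv.symm_apply_apply] at this
      simp [hk, this]
    rw [h1] at hm
    rw [h2] at hm'
    -- Both permutations sort the same injective key `k`.
    have := Tuple.unique_monotone hm.monotone hm'.monotone
    exact Equiv.ext fun p => hkinj (congrFun this p)
  · intro w hw
    obtain ⟨hw1, hwc⟩ := Finset.mem_filter.1 hw
    have hstrict := (Finset.mem_filter.1 hw1).2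
    set k : Fin n → Lex (ℕ × ℕ) := fun e => toLex (w e, γ e) with hk
    have hkinj : Function.Injective k := fun a b hab =>
      hγ (Prod.ext_iff.1 (toLex.injective hab)).2
    set π := Tuple.sort k
    have hm : StrictMono (k ∘ π) :=
      (Tuple.monotone_sort k).strictMono_of_injective (hkinj.comp π.injective)
    have hwπ : content (w ∘ π) = d := (content_comp_perm w π).trans hwc
    have hmono : Monotone (w ∘ π) :=
      ((strictMono_toLex_iff (w := γ ∘ π) (hγ.comp π.injective)).1 hm).1
    have hvw : v = w ∘ π := eq_of_monotone_of_content_eq hv hmono (hc.trans hwπ.symm)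
    refine ⟨π, Finset.mem_filter.2 ⟨Finset.mem_univ _, ?_, w ∘ π, hwπ, hm⟩, ?_⟩
    · intro p q hpq
      rw [← hm.lt_iff_lt]
      exact Prod.Lex.toLex_lt_toLex.2 (Or.inl (hstrict _ _ hpq))
    · funext e
      simp [hvw]

/-! ### Truncation to finitely many variables -/

/-- `f` and the polynomials `h N` in the variables `x_i`, `i < N`, have the same coefficients. -/
def IsLimit (f : MvPowerSeries ℕ ℚ) (h : ℕ → MvPolynomial ℕ ℚ) : Prop :=
  ∀ N (d : ℕ →₀ ℕ), d.support ⊆ Finset.range N →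
    MvPowerSeries.coeff d f = MvPolynomial.coeff d (h N)

lemma IsLimit.eq {f g : MvPowerSeries ℕ ℚ} {h : ℕ → MvPolynomial ℕ ℚ} (hf : IsLimit f h)
    (hg : IsLimit g h) : f = g := by
  ext d
  obtain ⟨N, hN⟩ := d.support.exists_nat_subset_range
  rw [hf N d hN, hg N d hN]

lemma IsLimit.add {f g : MvPowerSeries ℕ ℚ} {h k : ℕ → MvPolynomial ℕ ℚ} (hf : IsLimit f h)
    (hg : IsLimit g k) : IsLimit (f + g) (h + k) := fun N d hd => by
  rw [map_add, hf N d hd, hg N d hd, Pi.add_apply, MvPolynomial.coeff_add]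

/-- Both summands in a splitting of `d` involve only variables of `d`, so the same `N` serves for
both factors. -/
lemma IsLimit.mul {f g : MvPowerSeries ℕ ℚ} {h k : ℕ → MvPolynomial ℕ ℚ} (hf : IsLimit f h)
    (hg : IsLimit g k) : IsLimit (f * g) (h * k) := fun N d hd => by
  rw [MvPowerSeries.coeff_mul, Pi.mul_apply, MvPolynomial.coeff_mul]
  refine Finset.sum_congr rfl fun p hp => ?_
  have hp' := Finset.HasAntidiagonal.mem_antidiagonal.1 hp
  have h1 : p.1 ≤ d := hp' ▸ le_self_add
  have h2 : p.2 ≤ d := hp' ▸ le_add_self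
  rw [hf N _ ((Finsupp.support_mono h1).trans hd), hg N _ ((Finsupp.support_mono h2).trans hd)]

lemma IsLimit.one : IsLimit 1 1 := fun N d _ => by
  rw [Pi.one_apply, MvPowerSeries.coeff_one, MvPolynomial.coeff_one]
  exact if_congr eq_comm rfl rfl

lemma IsLimit.pow {f : MvPowerSeries ℕ ℚ} {h : ℕ → MvPolynomial ℕ ℚ} (hf : IsLimit f h) (k : ℕ) :
    IsLimit (f ^ k) (h ^ k) := by
  induction k with
  | zero => simpa using IsLimit.one
  | succ k ih => simpa [pow_succ] using ih.mul hf

lemma prod_X_eq_monomial {n : ℕ} (w : Fin n → ℕ) :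
    ∏ e, (MvPolynomial.X (w e) : MvPolynomial ℕ ℚ) = MvPolynomial.monomial (content w) 1 := by
  rw [content, MvPolynomial.monomial_sum_one]
  rfl

lemma isLimit_posetQSym {n : ℕ} {lt : Fin n → Fin n → Prop} {γ : Fin n → ℕ}
    (hγ : Function.Injective γ) (hlt : ∀ x y, lt x y → γ y < γ x) :
    IsLimit (posetQSym lt γ : MvPowerSeries ℕ ℚ)
      (fun N => ∑ w ∈ strictMaps lt N, ∏ e, MvPolynomial.X (w e)) := fun N d hd => by
  rw [coeff_posetQSym hγ hlt hd, MvPolynomial.coeff_sum]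
  simp only [prod_X_eq_monomial, MvPolynomial.coeff_monomial]
  rw [Finset.sum_boole]

/-! ### Coefficients of quasisymmetric functions in the first variable -/

/-- The exponent `(b, d₀, d₁, …)`. -/
def consExp (b : ℕ) (d : ℕ →₀ ℕ) : ℕ →₀ ℕ :=
  Finsupp.single 0 b + d.embDomain ⟨Nat.succ, Nat.succ_injective⟩

@[simp] lemma consExp_zero (b : ℕ) (d : ℕ →₀ ℕ) : consExp b d 0 = b := by
  rw [consExp, Finsupp.add_apply, Finsupp.embDomain_of_notMem_range]
  · simp
  · simp

@[simp] lemma consExp_succ (b : ℕ) (d : ℕ →₀ ℕ) (i : ℕ) : consExp b d (i + 1) = d i := by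
  have := Finsupp.embDomain_apply_self ⟨Nat.succ, Nat.succ_injective⟩ d i
  simp only [Function.Embedding.coeFn_mk, Nat.succ_eq_add_one] at this
  simp [consExp, this]

/-- The exponent `(d₁, d₂, …)`. -/
def tailExp (d : ℕ →₀ ℕ) : ℕ →₀ ℕ := d.comapDomain Nat.succ Nat.succ_injective.injOn

@[simp] lemma tailExp_apply (d : ℕ →₀ ℕ) (i : ℕ) : tailExp d i = d (i + 1) := rfl

lemma eq_consExp_iff (e : ℕ →₀ ℕ) (b : ℕ) (d : ℕ →₀ ℕ) :
    e = consExp b d ↔ e 0 = b ∧ tailExp e = d := by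
  constructor
  · rintro rfl
    exact ⟨by simp, by ext i; simp⟩
  · rintro ⟨rfl, rfl⟩
    ext i
    cases i <;> simp

lemma consExp_add (b c : ℕ) (d e : ℕ →₀ ℕ) :
    consExp b d + consExp c e = consExp (b + c) (d + e) := by
  ext i
  cases i <;> simp

lemma degree_consExp (b : ℕ) (d : ℕ →₀ ℕ) : (consExp b d).degree = b + d.degree := by
  rw [consExp, map_add]
  congr 1
  · simp
  · simp [Finsupp.degree_apply, Finsupp.support_embDomain, Finset.sum_map]
    exact Finset.sum_congr rfl fun i _ =>
      Finsupp.embDomain_apply_self ⟨Nat.succ, Nat.succ_injective⟩ d i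

lemma consExp_support {b N : ℕ} {d : ℕ →₀ ℕ} (hd : d.support ⊆ Finset.range N) :
    (consExp b d).support ⊆ Finset.range (N + 1) := by
  intro i hi
  rw [Finsupp.mem_support_iff] at hi
  cases i with
  | zero => simp
  | succ i =>
    rw [consExp_succ] at hi
    have := Finset.mem_range.1 (hd (Finsupp.mem_support_iff.2 hi))
    simpa using this

lemma consExp_embDomain {k : ℕ} (b : ℕ) (i : Fin k ↪o ℕ) (a : Fin k →₀ ℕ) :
    ∃ i' : Fin (k + 1) ↪o ℕ, consExp b (a.embDomain i.toEmbedding) =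
      (Finsupp.cons b a).embDomain i'.toEmbedding := by
  have hmono : StrictMono (Fin.cons 0 (fun l => i l + 1) : Fin (k + 1) → ℕ) := by
    intro x y hxy
    induction x using Fin.cases with
    | zero =>
      induction y using Fin.cases with
      | zero => exact absurd hxy (lt_irrefl _)
      | succ y => simp
    | succ x =>
      induction y using Fin.cases with
      | zero => exact absurd hxy (by simp)
      | succ y => simpa using hxy
  set i' := OrderEmbedding.ofStrictMono _ hmono with hi'
  refine ⟨i', Eq.symm ((eq_consExp_iff _ _ _).2 ⟨?_, ?_⟩)⟩
  · have h0 : (0 : ℕ) = i'.toEmbedding 0 := rfl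
    conv_lhs => rw [h0, Finsupp.embDomain_apply_self]
    simp
  · ext m
    rw [tailExp_apply]
    by_cases hm : ∃ l, i l = m
    · obtain ⟨l, rfl⟩ := hm
      have h1 : i l + 1 = i'.toEmbedding l.succ := rfl
      have h2 : i l = i.toEmbedding l := rfl
      rw [h1, Finsupp.embDomain_apply_self, h2, Finsupp.embDomain_apply_self, Finsupp.cons_succ]
    · rw [Finsupp.embDomain_of_notMem_range, Finsupp.embDomain_of_notMem_range]
      · rintro ⟨l, hl⟩
        exact hm ⟨l, hl⟩
      · rintro ⟨l, hl⟩
        induction l using Fin.cases with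
        | zero => simp [hi'] at hl
        | succ l => exact hm ⟨l, by simpa [hi'] using hl⟩

/-- The coefficient of `x₀ ^ b`, as a series in the remaining variables (renumbered). -/
def firstCoeffSeries (b : ℕ) (f : MvPowerSeries ℕ ℚ) : MvPowerSeries ℕ ℚ :=
  fun d => MvPowerSeries.coeff (consExp b d) f

lemma coeff_firstCoeffSeries (b : ℕ) (f : MvPowerSeries ℕ ℚ) (d : ℕ →₀ ℕ) :
    MvPowerSeries.coeff d (firstCoeffSeries b f) = MvPowerSeries.coeff (consExp b d) f := rfl

lemma firstCoeffSeries_mem (b : ℕ) {f : MvPowerSeries ℕ ℚ} (hf : f ∈ QSym) :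
    firstCoeffSeries b f ∈ QSym := by
  obtain ⟨⟨N, hN⟩, hq⟩ := hf
  refine ⟨⟨N, fun d hd => ?_⟩, fun k i j a => ?_⟩
  · have := hN _ hd
    rw [degree_consExp] at this
    omega
  · obtain ⟨i', hi'⟩ := consExp_embDomain b i a
    obtain ⟨j', hj'⟩ := consExp_embDomain b j a
    rw [coeff_firstCoeffSeries, coeff_firstCoeffSeries, hi', hj', hq]

/-- An exponent is its first entry together with its tail, so its splittings form a product. In Hopf
terms, the coproduct is multiplicative. -/
lemma firstCoeffSeries_mul (b : ℕ) (f g : MvPowerSeries ℕ ℚ) :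
    firstCoeffSeries b (f * g) =
      ∑ p ∈ Finset.HasAntidiagonal.antidiagonal b, firstCoeffSeries p.1 f * firstCoeffSeries p.2 g := by
  ext d
  rw [coeff_firstCoeffSeries, map_sum, MvPowerSeries.coeff_mul]
  simp only [MvPowerSeries.coeff_mul, coeff_firstCoeffSeries]
  rw [← Finset.sum_product']
  refine Finset.sum_nbij' (fun p => ((p.1 0, p.2 0), (tailExp p.1, tailExp p.2)))
    (fun q => (consExp q.1.1 q.2.1, consExp q.1.2 q.2.2)) ?_ ?_ ?_ ?_ ?_
  · intro p hp
    have hp' := Finset.HasAntidiagonal.mem_antidiagonal.1 hp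
    rw [Finset.mem_product]
    refine ⟨Finset.HasAntidiagonal.mem_antidiagonal.2 ?_,
      Finset.HasAntidiagonal.mem_antidiagonal.2 ?_⟩
    · rw [← Finsupp.add_apply, hp', consExp_zero]
    · ext i
      rw [Finsupp.add_apply, tailExp_apply, tailExp_apply, ← Finsupp.add_apply, hp', consExp_succ]
  · intro q hq
    rw [Finset.mem_product] at hq
    rw [Finset.HasAntidiagonal.mem_antidiagonal, consExp_add,
      Finset.HasAntidiagonal.mem_antidiagonal.1 hq.1,
      Finset.HasAntidiagonal.mem_antidiagonal.1 hq.2]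
  · intro p _
    exact Prod.ext ((eq_consExp_iff _ _ _).2 ⟨rfl, rfl⟩).symm
      ((eq_consExp_iff _ _ _).2 ⟨rfl, rfl⟩).symm
  · intro q _
    have h1 := (eq_consExp_iff _ _ _).1 (rfl : consExp q.1.1 q.2.1 = _)
    have h2 := (eq_consExp_iff _ _ _).1 (rfl : consExp q.1.2 q.2.2 = _)
    simp only [h1.1, h1.2, h2.1, h2.2]
  · intro p _
    rw [← (eq_consExp_iff p.1 _ _).2 ⟨rfl, rfl⟩, ← (eq_consExp_iff p.2 _ _).2 ⟨rfl, rfl⟩]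

/-- Setting `x₀ = 0` and renumbering shifts all indices by one, which quasisymmetry does not see. -/
lemma firstCoeffSeries_zero {f : MvPowerSeries ℕ ℚ} (hf : f ∈ QSym) :
    firstCoeffSeries 0 f = f := by
  ext d
  obtain ⟨N, hN⟩ := d.support.exists_nat_subset_range
  set j : Fin N ↪o ℕ := (Fin.valOrderEmb N)
  have hsucc : StrictMono fun l : Fin N => (l : ℕ) + 1 := fun a b h => by simpa using h
  set a : Fin N →₀ ℕ := d.comapDomain j j.injective.injOn with ha
  have h1 : d = a.embDomain j.toEmbedding := by
    ext m
    by_cases hm : m < N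
    · have : m = j.toEmbedding ⟨m, hm⟩ := rfl
      conv_rhs => rw [this, Finsupp.embDomain_apply_self]
      rfl
    · rw [Finsupp.embDomain_of_notMem_range]
      · by_contra hne
        exact hm (Finset.mem_range.1 (hN (Finsupp.mem_support_iff.2 hne)))
      · rintro ⟨l, hl⟩
        exact hm (hl ▸ l.2)
  have h2 : consExp 0 d = a.embDomain (OrderEmbedding.ofStrictMono _ hsucc).toEmbedding := by
    refine Eq.symm ((eq_consExp_iff _ _ _).2 ⟨?_, ?_⟩)
    · rw [Finsupp.embDomain_of_notMem_range]
      rintro ⟨l, hl⟩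
      simp at hl
    · ext m
      rw [tailExp_apply]
      by_cases hm : m < N
      · have : m + 1 = (OrderEmbedding.ofStrictMono _ hsucc).toEmbedding ⟨m, hm⟩ := rfl
        rw [this, Finsupp.embDomain_apply_self]
        rfl
      · rw [Finsupp.embDomain_of_notMem_range]
        · by_contra hne
          exact hm (Finset.mem_range.1 (hN (Finsupp.mem_support_iff.2 (Ne.symm hne))))
        · rintro ⟨l, hl⟩
          simp at hl
          exact hm (hl ▸ l.2)
  rw [coeff_firstCoeffSeries, h2]
  conv_rhs => rw [h1]
  exact hf.2 _ _ _ _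

/-- The coefficient of `x₀ ^ b` as an operator on quasisymmetric functions. -/
def firstCoeff (b : ℕ) : QSym →ₗ[ℚ] QSym where
  toFun f := ⟨firstCoeffSeries b f, firstCoeffSeries_mem b f.2⟩
  map_add' _ _ := rfl
  map_smul' _ _ := rfl

lemma coe_firstCoeff (b : ℕ) (f : QSym) :
    (firstCoeff b f : MvPowerSeries ℕ ℚ) = firstCoeffSeries b f := rfl

@[simp] lemma firstCoeff_zero (f : QSym) : firstCoeff 0 f = f :=
  Subtype.ext (firstCoeffSeries_zero f.2)

lemma firstCoeff_mul (b : ℕ) (f g : QSym) :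
    firstCoeff b (f * g) = ∑ p ∈ Finset.HasAntidiagonal.antidiagonal b, firstCoeff p.1 f * firstCoeff p.2 g := by
  apply Subtype.ext
  rw [coe_firstCoeff, AddSubmonoidClass.coe_finsetSum]
  exact firstCoeffSeries_mul b f g

/-- All monomials of `f` have degree at most `N`. -/
def DegLE (N : ℕ) (f : QSym) : Prop :=
  ∀ d, MvPowerSeries.coeff d (f : MvPowerSeries ℕ ℚ) ≠ 0 → d.degree ≤ N

lemma exists_degLE (f : QSym) : ∃ N, DegLE N f := f.2.1

lemma DegLE.firstCoeff {N : ℕ} {f : QSym} (h : DegLE N f) (b : ℕ) :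
    DegLE (N - b) (firstCoeff b f) := by
  intro d hd
  have := h _ hd
  rw [degree_consExp] at this
  omega

lemma DegLE.firstCoeff_eq_zero {N : ℕ} {f : QSym} (h : DegLE N f) {b : ℕ} (hb : N < b) :
    _root_.firstCoeff b f = 0 := by
  apply Subtype.ext
  ext d
  by_contra hd
  have := h _ hd
  rw [degree_consExp] at this
  omega

/-! ### Linear functionals on quasisymmetric functions and letters -/

/-- The polynomial `∑ τ(f_b) X^b`, where `f_b` is the coefficient of `x₀ ^ b` in `f`. -/
def letterPoly (τ : QSym →ₗ[ℚ] ℚ) : QSym →ₗ[ℚ] Polynomial ℚ :=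
  have hcoeff : ∀ (f : QSym) (b : ℕ), (∑ b ∈ Finset.range ((exists_degLE f).choose + 1),
      Polynomial.monomial b (τ (firstCoeff b f))).coeff b = τ (firstCoeff b f) := fun f b => by
    rw [Polynomial.finsetSum_coeff]
    simp only [Polynomial.coeff_monomial]
    rw [Finset.sum_ite_eq']
    split_ifs with h
    · rfl
    · rw [Finset.mem_range, not_lt] at h
      rw [(exists_degLE f).choose_spec.firstCoeff_eq_zero (by omega), map_zero]
  { toFun := fun f => ∑ b ∈ Finset.range ((exists_degLE f).choose + 1),
      Polynomial.monomial b (τ (firstCoeff b f))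
    map_add' := fun f g => by
      ext b
      rw [hcoeff, Polynomial.coeff_add, hcoeff, hcoeff, map_add, map_add]
    map_smul' := fun r f => by
      ext b
      rw [hcoeff, RingHom.id_apply, Polynomial.coeff_smul, hcoeff, map_smul, map_smul] }

lemma coeff_letterPoly (τ : QSym →ₗ[ℚ] ℚ) (f : QSym) (b : ℕ) :
    (letterPoly τ f).coeff b = τ (firstCoeff b f) := by
  change (∑ b ∈ Finset.range ((exists_degLE f).choose + 1),
      Polynomial.monomial b (τ (firstCoeff b f))).coeff b = τ (firstCoeff b f)
  rw [Polynomial.finsetSum_coeff]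
  simp only [Polynomial.coeff_monomial]
  rw [Finset.sum_ite_eq']
  split_ifs with h
  · rfl
  · rw [Finset.mem_range, not_lt] at h
    rw [(exists_degLE f).choose_spec.firstCoeff_eq_zero (by omega), map_zero]

/-- Prefixing the alphabet of `τ` by the letter `y`. -/
def addLetter (y : ℚ) (τ : QSym →ₗ[ℚ] ℚ) : QSym →ₗ[ℚ] ℚ :=
  Polynomial.leval y ∘ₗ letterPoly τ

/-- The derivative of `addLetter y τ` with respect to `y`. -/
def derivLetter (y : ℚ) (τ : QSym →ₗ[ℚ] ℚ) : QSym →ₗ[ℚ] ℚ :=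
  Polynomial.leval y ∘ₗ Polynomial.derivative ∘ₗ letterPoly τ

lemma addLetter_apply (y : ℚ) (τ : QSym →ₗ[ℚ] ℚ) (f : QSym) :
    addLetter y τ f = (letterPoly τ f).eval y := rfl

lemma derivLetter_apply (y : ℚ) (τ : QSym →ₗ[ℚ] ℚ) (f : QSym) :
    derivLetter y τ f = (Polynomial.derivative (letterPoly τ f)).eval y := rfl

lemma coeff_letterPoly_mul (τ : QSym →ₗ[ℚ] ℚ) (f g : QSym) (b : ℕ) :
    (letterPoly τ (f * g)).coeff b =
      ∑ p ∈ Finset.HasAntidiagonal.antidiagonal b, τ (firstCoeff p.1 f * firstCoeff p.2 g) := by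
  rw [coeff_letterPoly, firstCoeff_mul, map_sum]

/-- The two-term right-hand side covers characters, infinitesimal characters and twisted derivations
at once. The shape of the rule survives convolution with a letter that is kept as the variable `X`.
-/
lemma letterPoly_mul {α β₁ γ₁ β₂ γ₂ : QSym →ₗ[ℚ] ℚ}
    (h : ∀ f g, α (f * g) = β₁ f * γ₁ g + β₂ f * γ₂ g) (f g : QSym) :
    letterPoly α (f * g) =
      letterPoly β₁ f * letterPoly γ₁ g + letterPoly β₂ f * letterPoly γ₂ g := by
  ext b
  rw [coeff_letterPoly_mul, Polynomial.coeff_add, Polynomial.coeff_mul, Polynomial.coeff_mul,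
    ← Finset.sum_add_distrib]
  refine Finset.sum_congr rfl fun p _ => ?_
  rw [h, coeff_letterPoly, coeff_letterPoly, coeff_letterPoly, coeff_letterPoly]

/-- A letter can be cancelled from a product rule. By induction on degree, the defect polynomial has
no coefficients in positive degree, because these involve pieces of lower degree. It is thus the
constant defect of `α`, and its value at `y` vanishes by hypothesis. -/
lemma mul_of_addLetter_mul {y : ℚ} {α β₁ γ₁ β₂ γ₂ : QSym →ₗ[ℚ] ℚ}
    (h : ∀ f g, addLetter y α (f * g) =
      addLetter y β₁ f * addLetter y γ₁ g + addLetter y β₂ f * addLetter y γ₂ g) (f g : QSym) :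
    α (f * g) = β₁ f * γ₁ g + β₂ f * γ₂ g := by
  suffices ∀ (N : ℕ) (f g : QSym) (n m : ℕ), DegLE n f → DegLE m g → n + m ≤ N →
      α (f * g) - (β₁ f * γ₁ g + β₂ f * γ₂ g) = 0 by
    obtain ⟨n, hn⟩ := exists_degLE f
    obtain ⟨m, hm⟩ := exists_degLE g
    exact sub_eq_zero.1 (this (n + m) f g n m hn hm le_rfl)
  intro N
  induction N using Nat.strong_induction_on with
  | _ N ih =>
    intro f g n m hf hg hN
    have hpoly : letterPoly α (f * g) - (letterPoly β₁ f * letterPoly γ₁ g +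
        letterPoly β₂ f * letterPoly γ₂ g) =
        Polynomial.C (α (f * g) - (β₁ f * γ₁ g + β₂ f * γ₂ g)) := by
      ext b
      rw [Polynomial.coeff_sub, Polynomial.coeff_add, coeff_letterPoly_mul, Polynomial.coeff_mul,
        Polynomial.coeff_mul, ← Finset.sum_add_distrib, ← Finset.sum_sub_distrib,
        Polynomial.coeff_C]
      simp only [coeff_letterPoly]
      split_ifs with hb
      · subst hb
        simp
      · refine Finset.sum_eq_zero fun p hp => ?_
        have hp' := Finset.HasAntidiagonal.mem_antidiagonal.1 hp
        by_cases h1 : n < p.1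
        · rw [hf.firstCoeff_eq_zero h1]
          simp
        by_cases h2 : m < p.2
        · rw [hg.firstCoeff_eq_zero h2]
          simp
        -- Here `p.1 + p.2 = b > 0` with `p.1 ≤ n` and `p.2 ≤ m`, so the degree bound does drop.
        exact ih ((n - p.1) + (m - p.2)) (by omega) _ _ _ _ (hf.firstCoeff p.1)
          (hg.firstCoeff p.2) le_rfl
    have heval := congrArg (Polynomial.eval y) hpoly
    rw [Polynomial.eval_C, Polynomial.eval_sub, Polynomial.eval_add, Polynomial.eval_mul,
      Polynomial.eval_mul] at heval
    rw [← heval]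
    exact sub_eq_zero.2 (h f g)

/-- The restriction of `subLetter y τ` to degree at most `N`. -/
def subLetterAux (y : ℚ) (τ : QSym →ₗ[ℚ] ℚ) (N : ℕ) : QSym →ₗ[ℚ] ℚ :=
  τ - ∑ b : Fin N, y ^ ((b : ℕ) + 1) •
    (subLetterAux y τ (N - ((b : ℕ) + 1)) ∘ₗ firstCoeff ((b : ℕ) + 1))
termination_by N
decreasing_by have := b.2; omega

lemma subLetterAux_apply (y : ℚ) (τ : QSym →ₗ[ℚ] ℚ) (N : ℕ) (f : QSym) :
    subLetterAux y τ N f = τ f - ∑ b ∈ Finset.range N, y ^ (b + 1) *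
      subLetterAux y τ (N - (b + 1)) (firstCoeff (b + 1) f) := by
  rw [subLetterAux, LinearMap.sub_apply, LinearMap.sum_apply, Finset.sum_range]
  rfl

/-- The recursion bound is immaterial once it dominates the degree; this makes `subLetter`, which
uses a chosen bound, linear. -/
lemma subLetterAux_eq (y : ℚ) (τ : QSym →ₗ[ℚ] ℚ) (N M : ℕ) (h : N ≤ M) {f : QSym}
    (hf : DegLE N f) : subLetterAux y τ M f = subLetterAux y τ N f := by
  induction N using Nat.strong_induction_on generalizing M f with
  | _ N ih =>
    rw [subLetterAux_apply, subLetterAux_apply]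
    congr 1
    rw [← Finset.sum_subset (Finset.range_subset_range.2 h)]
    · refine Finset.sum_congr rfl fun b hb => ?_
      rw [Finset.mem_range] at hb
      rw [ih (N - (b + 1)) (by omega) (M - (b + 1)) (by omega) (hf.firstCoeff _)]
    · intro b _ hb
      rw [Finset.mem_range, not_lt] at hb
      rw [hf.firstCoeff_eq_zero (by omega), map_zero, mul_zero]

/-- The functional `σ` with `addLetter y σ = τ`. -/
def subLetter (y : ℚ) (τ : QSym →ₗ[ℚ] ℚ) : QSym →ₗ[ℚ] ℚ where
  toFun f := subLetterAux y τ (exists_degLE f).choose f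
  map_add' f g := by
    obtain ⟨n, hn⟩ : ∃ n, n = max (exists_degLE (f + g)).choose
      (max (exists_degLE f).choose (exists_degLE g).choose) := ⟨_, rfl⟩
    rw [← subLetterAux_eq y τ _ n (by omega) (exists_degLE f).choose_spec,
      ← subLetterAux_eq y τ _ n (by omega) (exists_degLE g).choose_spec,
      ← subLetterAux_eq y τ _ n (by omega) (exists_degLE (f + g)).choose_spec, map_add]
  map_smul' r f := by
    obtain ⟨n, hn⟩ : ∃ n, n = max (exists_degLE (r • f)).choose (exists_degLE f).choose := ⟨_, rfl⟩
    rw [← subLetterAux_eq y τ _ n (by omega) (exists_degLE f).choose_spec,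
      ← subLetterAux_eq y τ _ n (by omega) (exists_degLE (r • f)).choose_spec, map_smul]
    rfl

lemma subLetter_eq (y : ℚ) (τ : QSym →ₗ[ℚ] ℚ) {N : ℕ} {f : QSym} (hf : DegLE N f) :
    subLetter y τ f = subLetterAux y τ N f := by
  change subLetterAux y τ _ f = _
  rw [← subLetterAux_eq y τ _ (max (exists_degLE f).choose N) (le_max_left _ _)
    (exists_degLE f).choose_spec, ← subLetterAux_eq y τ N _ (le_max_right _ _) hf]

lemma addLetter_eq_sum (y : ℚ) (τ : QSym →ₗ[ℚ] ℚ) {N : ℕ} {f : QSym} (hf : DegLE N f) :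
    addLetter y τ f = ∑ b ∈ Finset.range (N + 1), y ^ b * τ (firstCoeff b f) := by
  have hdeg : (letterPoly τ f).natDegree < N + 1 := by
    refine Nat.lt_succ_of_le (Polynomial.natDegree_le_iff_coeff_eq_zero.2 fun b hb => ?_)
    rw [coeff_letterPoly, hf.firstCoeff_eq_zero hb, map_zero]
  rw [addLetter_apply, Polynomial.eval_eq_sum_range' hdeg]
  refine Finset.sum_congr rfl fun b _ => ?_
  rw [coeff_letterPoly, mul_comm]

@[simp] lemma addLetter_subLetter (y : ℚ) (τ : QSym →ₗ[ℚ] ℚ) :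
    addLetter y (subLetter y τ) = τ := by
  ext f
  obtain ⟨N, hN⟩ := exists_degLE f
  rw [addLetter_eq_sum y _ hN, Finset.sum_range_succ']
  have : ∀ b, subLetter y τ (firstCoeff (b + 1) f) =
      subLetterAux y τ (N - (b + 1)) (firstCoeff (b + 1) f) := fun b =>
    subLetter_eq y τ (hN.firstCoeff _)
  simp only [this, firstCoeff_zero, pow_zero, one_mul]
  rw [subLetter_eq y τ hN, subLetterAux_apply y τ N]
  ring

/-- The constant coefficient as a functional. -/
def counit : QSym →ₗ[ℚ] ℚ where
  toFun f := MvPowerSeries.constantCoeff (f : MvPowerSeries ℕ ℚ)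
  map_add' _ _ := rfl
  map_smul' _ _ := rfl

lemma counit_mul (f g : QSym) : counit (f * g) = counit f * counit g :=
  map_mul MvPowerSeries.constantCoeff (f : MvPowerSeries ℕ ℚ) (g : MvPowerSeries ℕ ℚ)

lemma mem_maxIdeal_iff (f : QSym) : f ∈ QSym.maxIdeal ↔ counit f = 0 := Iff.rfl

/-- The inverse in the convolution group of the evaluation at the single letter `y`. -/
def invLetter (y : ℚ) : QSym →ₗ[ℚ] ℚ := subLetter y counit

@[simp] lemma addLetter_invLetter (y : ℚ) : addLetter y (invLetter y) = counit :=
  addLetter_subLetter y counit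

lemma addLetter_zero (y : ℚ) : addLetter y 0 = 0 := by
  ext f
  rw [addLetter_apply]
  have : letterPoly 0 f = 0 := by
    ext b
    rw [coeff_letterPoly]
    simp
  rw [this]
  simp

/-- Restoring the letter turns the claim into multiplicativity of the counit; the second term of the
general rule is zero. -/
lemma invLetter_mul (y : ℚ) (f g : QSym) :
    invLetter y (f * g) = invLetter y f * invLetter y g := by
  have := mul_of_addLetter_mul (y := y) (α := invLetter y) (β₁ := invLetter y)
    (γ₁ := invLetter y) (β₂ := 0) (γ₂ := 0) (fun f g => by
      rw [addLetter_invLetter, addLetter_zero, counit_mul]; simp) f g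
  simpa using this

/-- An infinitesimal character of `QSym`. -/
def infChar (y : ℚ) : QSym →ₗ[ℚ] ℚ := derivLetter y (invLetter y)

/-- Differentiating the product rule of `letterPoly (invLetter y)` at `y` leaves one
undifferentiated factor in each term, and `ζ_y * ζ_y⁻¹` is the counit. -/
lemma infChar_mul (y : ℚ) (f g : QSym) :
    infChar y (f * g) = infChar y f * counit g + counit f * infChar y g := by
  have h := letterPoly_mul (α := invLetter y) (β₁ := invLetter y) (γ₁ := invLetter y) (β₂ := 0)
    (γ₂ := 0) (fun f g => by rw [invLetter_mul]; simp) f g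
  have h0 : letterPoly 0 f = 0 := by
    ext b
    rw [coeff_letterPoly]
    simp
  rw [h0, zero_mul, add_zero] at h
  rw [infChar, derivLetter_apply, derivLetter_apply, derivLetter_apply, h,
    Polynomial.derivative_mul, Polynomial.eval_add, Polynomial.eval_mul, Polynomial.eval_mul,
    ← addLetter_apply, ← addLetter_apply, addLetter_invLetter]

/-- The convolution product of the infinitesimal characters `infChar s` and `infChar t`. -/
def doubleChar (s t : ℚ) : QSym →ₗ[ℚ] ℚ := derivLetter s (subLetter s (infChar t))

/-- The functional is `ζ_s⁻¹ * infChar t`, a derivation twisted by the character `ζ_s⁻¹`. -/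
lemma subLetter_infChar_mul (s t : ℚ) (f g : QSym) :
    subLetter s (infChar t) (f * g) = subLetter s (infChar t) f * invLetter s g +
      invLetter s f * subLetter s (infChar t) g :=
  mul_of_addLetter_mul (y := s) (fun f g => by
    rw [addLetter_subLetter, addLetter_invLetter, infChar_mul]) f g

/-- The two cross terms are exchanged by swapping `s` and `t`, so on `𝔪²` they cancel in the
commutator. -/
lemma doubleChar_mul (s t : ℚ) (f g : QSym) :
    doubleChar s t (f * g) = doubleChar s t f * counit g + infChar t f * infChar s g +
      infChar s f * infChar t g + counit f * doubleChar s t g := by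
  have h := letterPoly_mul (subLetter_infChar_mul s t) f g
  rw [doubleChar, derivLetter_apply, h]
  simp only [Polynomial.derivative_mul, Polynomial.derivative_add, Polynomial.eval_add,
    Polynomial.eval_mul, ← addLetter_apply, ← derivLetter_apply, addLetter_invLetter,
    addLetter_subLetter, infChar]
  ring

/-- The commutator of the infinitesimal characters `infChar s` and `infChar t`. -/
def commutatorChar (s t : ℚ) : QSym →ₗ[ℚ] ℚ := doubleChar s t - doubleChar t s

lemma commutatorChar_eq_zero (s t : ℚ) {f : QSym} (hf : f ∈ QSym.maxIdeal ^ 2) :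
    commutatorChar s t f = 0 := by
  rw [pow_two] at hf
  refine Submodule.mul_induction_on hf (fun f hf g hg => ?_) fun f g hf hg => ?_
  · rw [mem_maxIdeal_iff] at hf hg
    rw [commutatorChar, LinearMap.sub_apply, doubleChar_mul, doubleChar_mul, hf, hg]
    ring
  · rw [map_add, hf, hg, add_zero]

/-! ### Values of the commutator functional on posets with at most two minimal elements -/

section Sums

variable {A : Type*} [CommRing A]

/-- The sum `∑ y_i (∑_{l > i} y_l)^m` in `N` letters. -/
def coneSum (m N : ℕ) (y : ℕ → A) : A :=
  ∑ i ∈ Finset.range N, y i * (∑ l ∈ Finset.Ioo i N, y l) ^ m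

/-- The sum `∑ y_i y_j (∑_{l > i} y_l)^p (∑_{l > j} y_l)^q (∑_{l > max i j} y_l)^r` in `N`
letters. -/
def doubleConeSum (p q r N : ℕ) (y : ℕ → A) : A :=
  ∑ i ∈ Finset.range N, ∑ j ∈ Finset.range N,
    y i * y j * (∑ l ∈ Finset.Ioo i N, y l) ^ p * (∑ l ∈ Finset.Ioo j N, y l) ^ q *
      (∑ l ∈ Finset.Ioo (max i j) N, y l) ^ r

lemma sum_Ioo_succ (y : ℕ → A) (i N : ℕ) :
    ∑ l ∈ Finset.Ioo (i + 1) (N + 1), y l = ∑ l ∈ Finset.Ioo i N, y (l + 1) := by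
  refine Eq.trans ?_ (Finset.sum_map (Finset.Ioo i N) ⟨Nat.succ, Nat.succ_injective⟩ y)
  congr 1
  ext l
  simp only [Finset.mem_Ioo, Finset.mem_map, Function.Embedding.coeFn_mk]
  constructor
  · intro h
    exact ⟨l - 1, by omega, by omega⟩
  · rintro ⟨k, hk, rfl⟩
    simp only [Nat.succ_eq_add_one]
    omega

lemma sum_Ioo_zero (y : ℕ → A) (N : ℕ) :
    ∑ l ∈ Finset.Ioo 0 (N + 1), y l = ∑ l ∈ Finset.range N, y (l + 1) := by
  refine Eq.trans ?_ (Finset.sum_map (Finset.range N) ⟨Nat.succ, Nat.succ_injective⟩ y)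
  congr 1
  ext l
  simp only [Finset.mem_Ioo, Finset.mem_range, Finset.mem_map, Function.Embedding.coeFn_mk]
  constructor
  · intro h
    exact ⟨l - 1, by omega, by omega⟩
  · rintro ⟨k, hk, rfl⟩
    simp only [Nat.succ_eq_add_one]
    omega

lemma coneSum_zero (N : ℕ) (y : ℕ → A) : coneSum 0 N y = ∑ i ∈ Finset.range N, y i := by
  simp [coneSum]

/-- Either the bottom element avoids the smallest letter, or it takes it and the `m` others are free
in the remaining letters. -/
lemma coneSum_succ (m N : ℕ) (y : ℕ → A) :
    coneSum m (N + 1) y = coneSum m N (y ∘ Nat.succ) + y 0 * coneSum 0 N (y ∘ Nat.succ) ^ m := by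
  rw [coneSum, Finset.sum_range_succ', sum_Ioo_zero, coneSum_zero, coneSum]
  simp only [sum_Ioo_succ]
  rfl

/-- Only the two minimal elements can take the smallest letter. If exactly one does, the elements
above it alone become free and what remains is a cone over the other; if both do, everything else is
free. -/
lemma doubleConeSum_succ (p q r N : ℕ) (y : ℕ → A) :
    doubleConeSum p q r (N + 1) y = doubleConeSum p q r N (y ∘ Nat.succ) +
      y 0 * (coneSum 0 N (y ∘ Nat.succ) ^ p * coneSum (q + r) N (y ∘ Nat.succ) +
        coneSum 0 N (y ∘ Nat.succ) ^ q * coneSum (p + r) N (y ∘ Nat.succ)) +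
      y 0 ^ 2 * coneSum 0 N (y ∘ Nat.succ) ^ (p + q + r) := by
  rw [doubleConeSum, Finset.sum_range_succ']
  simp only [Finset.sum_range_succ', sum_Ioo_succ, sum_Ioo_zero, max_add_add_right,
    Finset.sum_add_distrib, Nat.zero_max, Nat.max_zero]
  rw [coneSum_zero, doubleConeSum, coneSum, coneSum, mul_add, Finset.mul_sum, Finset.mul_sum,
    Finset.mul_sum, Finset.mul_sum]
  simp only [Function.comp, Nat.succ_eq_add_one]
  -- Regroups the four cases: both indices positive, the first zero, the second zero, both zero.
  have h1 : ∀ a b c d a' b' c' d' : A, a = a' → b + c = b' + c' → d = d' →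
      a + c + (b + d) = a' + (b' + c') + d' := fun a b c d a' b' c' d' ha hb hd => by
    rw [ha, ← hb, hd]
    ring
  refine h1 _ _ _ _ _ _ _ _ rfl ?_ ?_
  · congr 1
    · refine Finset.sum_congr rfl fun i _ => ?_
      ring
    · refine Finset.sum_congr rfl fun i _ => ?_
      ring
  · ring

lemma map_coneSum {B F : Type*} [CommRing B] [FunLike F A B] [RingHomClass F A B] (φ : F)
    (m N : ℕ) (y : ℕ → A) : φ (coneSum m N y) = coneSum m N (φ ∘ y) := by
  simp [coneSum, map_sum]

lemma map_doubleConeSum {B F : Type*} [CommRing B] [FunLike F A B] [RingHomClass F A B] (φ : F)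
    (p q r N : ℕ) (y : ℕ → A) : φ (doubleConeSum p q r N y) = doubleConeSum p q r N (φ ∘ y) := by
  simp [doubleConeSum, map_sum]

end Sums

lemma coeff_X_pow_mul_rename (c b : ℕ) (p : MvPolynomial ℕ ℚ) (d : ℕ →₀ ℕ) :
    MvPolynomial.coeff (consExp b d) (MvPolynomial.X 0 ^ c * MvPolynomial.rename Nat.succ p) =
      if b = c then MvPolynomial.coeff d p else 0 := by
  induction p using MvPolynomial.induction_on' with
  | monomial u a =>
    have : Finsupp.single 0 c + Finsupp.mapDomain Nat.succ u = consExp c u := by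
      rw [consExp, Finsupp.embDomain_eq_mapDomain]
      rfl
    rw [MvPolynomial.rename_monomial, MvPolynomial.X_pow_eq_monomial, MvPolynomial.monomial_mul,
      this, MvPolynomial.coeff_monomial, MvPolynomial.coeff_monomial, one_mul]
    have hiff : consExp c u = consExp b d ↔ b = c ∧ u = d := by
      constructor
      · intro h
        have h1 := (eq_consExp_iff _ _ _).1 h
        have h2 := (eq_consExp_iff _ _ _).1 (rfl : consExp c u = _)
        exact ⟨h1.1.symm.trans h2.1, h2.2.symm.trans h1.2⟩
      · rintro ⟨rfl, rfl⟩
        rfl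
    rw [if_congr hiff rfl rfl, ite_and]
  | add p q hp hq =>
    rw [map_add, mul_add, MvPolynomial.coeff_add, hp, hq, MvPolynomial.coeff_add]
    split_ifs <;> simp

lemma rename_succ_comp_X : (MvPolynomial.rename Nat.succ : MvPolynomial ℕ ℚ →ₐ[ℚ] _) ∘
    MvPolynomial.X = MvPolynomial.X ∘ Nat.succ := by
  funext i
  simp

/-- An expansion of degree two in `x₀` is enough for posets with at most two minimal elements. -/
lemma IsLimit.firstCoeffSeries {f : MvPowerSeries ℕ ℚ} {h : ℕ → MvPolynomial ℕ ℚ}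
    (hf : IsLimit f h) {k₀ k₁ k₂ : ℕ → MvPolynomial ℕ ℚ}
    (hk : ∀ N, h (N + 1) = MvPolynomial.rename Nat.succ (k₀ N) +
      MvPolynomial.X 0 * MvPolynomial.rename Nat.succ (k₁ N) +
      MvPolynomial.X 0 ^ 2 * MvPolynomial.rename Nat.succ (k₂ N)) (b : ℕ) :
    IsLimit (_root_.firstCoeffSeries (b + 1) f) 
      (fun N => if b = 0 then k₁ N else if b = 1 then k₂ N else 0) := fun N d hd => by
  have h0 := coeff_X_pow_mul_rename 0 (b + 1) (k₀ N) d
  have h1 := coeff_X_pow_mul_rename 1 (b + 1) (k₁ N) d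
  have h2 := coeff_X_pow_mul_rename 2 (b + 1) (k₂ N) d
  rw [pow_zero, one_mul] at h0
  rw [pow_one] at h1
  rw [coeff_firstCoeffSeries, hf (N + 1) _ (consExp_support hd), hk, MvPolynomial.coeff_add,
    MvPolynomial.coeff_add, h0, h1, h2]
  rcases b with _ | _ | b <;> simp

/-- The strict order on `Fin (m + 1)` with `0` below all other elements. -/
def coneLT (m : ℕ) (x y : Fin (m + 1)) : Prop := x = 0 ∧ y ≠ 0

/-- The quasisymmetric function of a poset with one element below `m` maximal elements. -/
def coneQSym (m : ℕ) : QSym :=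
  posetQSym (n := m + 1) (coneLT m) (fun x => m + 1 - x)

lemma isLimit_coneQSym (m : ℕ) :
    IsLimit (coneQSym m : MvPowerSeries ℕ ℚ) (fun N => coneSum m N MvPolynomial.X) := by
  have h := isLimit_posetQSym (n := m + 1) (lt := coneLT m)
    (γ := fun x => m + 1 - x)
    (fun x y hxy => Fin.ext (by have := x.2; have := y.2; simp only at hxy; omega))
    (fun x y hxy => by
      have := Fin.pos_iff_ne_zero.2 hxy.2
      rw [hxy.1]
      have h1 : 0 < (y : ℕ) := this
      simp only [Fin.val_zero]
      omega)
  intro N d hd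
  refine (h N d hd).trans (congrArg _ (Eq.symm ?_))
  beta_reduce
  -- Once the value `i` of the bottom element is fixed, the others range independently over the
  -- letters above `i`.
  rw [← Finset.sum_fiberwise_of_maps_to (s := strictMaps _ N) (t := Finset.range N)
    (g := fun w => w 0) (fun w hw => Fintype.mem_piFinset.1 (Finset.mem_filter.1 hw).1 0)]
  refine Finset.sum_congr rfl fun i hi => ?_
  have : (strictMaps (coneLT m) N).filter (fun w => w 0 = i) =
      Fintype.piFinset fun e => if e = 0 then {i} else Finset.Ioo i N := by
    ext w
    simp only [strictMaps, Finset.mem_filter, Fintype.mem_piFinset, Finset.mem_range]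
    constructor
    · rintro ⟨⟨h1, h2⟩, rfl⟩ e
      split_ifs with he
      · simp [he]
      · exact Finset.mem_Ioo.2 ⟨h2 0 e ⟨rfl, he⟩, h1 e⟩
    · intro h
      have h0 : w 0 = i := by simpa using h 0
      refine ⟨⟨fun e => ?_, ?_⟩, h0⟩
      · by_cases he : e = 0
        · subst he
          rw [h0]
          exact Finset.mem_range.1 hi
        · have := h e
          rw [if_neg he, Finset.mem_Ioo] at this
          exact this.2
      · rintro x e ⟨rfl, he⟩
        have := h e
        rw [if_neg he, Finset.mem_Ioo] at this
        rw [h0]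
        exact this.1
  rw [this, ← Finset.prod_univ_sum, Fin.prod_univ_succ]
  simp

lemma IsLimit.coe_mul {f g : QSym} {h k : ℕ → MvPolynomial ℕ ℚ}
    (hf : IsLimit (f : MvPowerSeries ℕ ℚ) h) (hg : IsLimit (g : MvPowerSeries ℕ ℚ) k) :
    IsLimit ((f * g : QSym) : MvPowerSeries ℕ ℚ) (h * k) := hf.mul hg

lemma IsLimit.coe_pow {f : QSym} {h : ℕ → MvPolynomial ℕ ℚ}
    (hf : IsLimit (f : MvPowerSeries ℕ ℚ) h) (k : ℕ) :
    IsLimit ((f ^ k : QSym) : MvPowerSeries ℕ ℚ) (h ^ k) := hf.pow k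

lemma IsLimit.coe_add {f g : QSym} {h k : ℕ → MvPolynomial ℕ ℚ}
    (hf : IsLimit (f : MvPowerSeries ℕ ℚ) h) (hg : IsLimit (g : MvPowerSeries ℕ ℚ) k) :
    IsLimit ((f + g : QSym) : MvPowerSeries ℕ ℚ) (h + k) := hf.add hg

lemma IsLimit.eq_zero {f : MvPowerSeries ℕ ℚ} (hf : IsLimit f 0) : f = 0 := by
  refine hf.eq fun N d _ => ?_
  rw [map_zero, Pi.zero_apply, MvPolynomial.coeff_zero]

/-- `coneQSym 0` is the sum of all variables, so its `m`-th power is the function of an antichain of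
`m` elements. -/
lemma firstCoeff_coneQSym (m b : ℕ) :
    firstCoeff (b + 1) (coneQSym m) = if b = 0 then coneQSym 0 ^ m else 0 := by
  have h := (isLimit_coneQSym m).firstCoeffSeries (k₀ := fun N => coneSum m N MvPolynomial.X)
    (k₁ := (fun N => coneSum 0 N MvPolynomial.X) ^ m) (k₂ := 0)
    (fun N => by
      rw [Pi.pow_apply, map_pow, map_coneSum, map_coneSum, rename_succ_comp_X, Pi.zero_apply,
        map_zero, mul_zero, add_zero, coneSum_succ]) b
  apply Subtype.ext
  rw [coe_firstCoeff]
  split_ifs with hb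
  · simp only [if_pos hb] at h
    exact h.eq ((isLimit_coneQSym 0).coe_pow m)
  · simp only [if_neg hb, Pi.zero_apply, ite_self] at h
    exact h.eq_zero

lemma firstCoeff_one (b : ℕ) : firstCoeff (b + 1) 1 = 0 := by
  have h : DegLE 0 1 := fun d hd => by
    change MvPowerSeries.coeff d (1 : MvPowerSeries ℕ ℚ) ≠ 0 at hd
    rw [MvPowerSeries.coeff_one] at hd
    by_cases hd0 : d = 0
    · simp [hd0]
    · simp [hd0] at hd
  exact h.firstCoeff_eq_zero (by omega)

lemma firstCoeff_of_isLimit_doubleConeSum {p q r : ℕ} {f : QSym}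
    (hf : IsLimit (f : MvPowerSeries ℕ ℚ) fun N => doubleConeSum p q r N MvPolynomial.X) (b : ℕ) :
    firstCoeff (b + 1) f = if b = 0 then
      coneQSym 0 ^ p * coneQSym (q + r) + coneQSym 0 ^ q * coneQSym (p + r)
      else if b = 1 then coneQSym 0 ^ (p + q + r) else 0 := by
  have h := hf.firstCoeffSeries (k₀ := fun N => doubleConeSum p q r N MvPolynomial.X)
    (k₁ := (fun N => coneSum 0 N MvPolynomial.X) ^ p *
      (fun N => coneSum (q + r) N MvPolynomial.X) +
      (fun N => coneSum 0 N MvPolynomial.X) ^ q * (fun N => coneSum (p + r) N MvPolynomial.X))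
    (k₂ := (fun N => coneSum 0 N MvPolynomial.X) ^ (p + q + r))
    (fun N => by
      simp only [Pi.pow_apply, Pi.mul_apply, Pi.add_apply, map_pow, map_mul, map_add,
        map_coneSum, map_doubleConeSum, rename_succ_comp_X]
      rw [doubleConeSum_succ]) b
  apply Subtype.ext
  rw [coe_firstCoeff]
  split_ifs with hb hb'
  · simp only [if_pos hb] at h
    exact h.eq ((((isLimit_coneQSym 0).coe_pow p).coe_mul (isLimit_coneQSym (q + r))).coe_add
      (((isLimit_coneQSym 0).coe_pow q).coe_mul (isLimit_coneQSym (p + r))))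
  · simp only [if_neg hb, if_pos hb'] at h
    exact h.eq ((isLimit_coneQSym 0).coe_pow (p + q + r))
  · simp only [if_neg hb, if_neg hb'] at h
    exact h.eq_zero

lemma letterPoly_one (τ : QSym →ₗ[ℚ] ℚ) : letterPoly τ 1 = Polynomial.C (τ 1) := by
  ext b
  rw [coeff_letterPoly, Polynomial.coeff_C]
  cases b with
  | zero => simp
  | succ b => simp [firstCoeff_one]

lemma letterPoly_coneQSym (τ : QSym →ₗ[ℚ] ℚ) (m : ℕ) : letterPoly τ (coneQSym m) =
    Polynomial.C (τ (coneQSym m)) + Polynomial.C (τ (coneQSym 0 ^ m)) * Polynomial.X := by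
  ext b
  rw [coeff_letterPoly, Polynomial.coeff_add, Polynomial.coeff_C, Polynomial.coeff_C_mul_X]
  cases b with
  | zero => simp
  | succ b =>
    rw [firstCoeff_coneQSym, if_neg b.succ_ne_zero, zero_add]
    by_cases hb : b = 0
    · simp [hb]
    · simp [hb]

lemma letterPoly_of_isLimit_doubleConeSum (τ : QSym →ₗ[ℚ] ℚ) {p q r : ℕ} {f : QSym}
    (hf : IsLimit (f : MvPowerSeries ℕ ℚ) fun N => doubleConeSum p q r N MvPolynomial.X) :
    letterPoly τ f = Polynomial.C (τ f) + Polynomial.C (τ (coneQSym 0 ^ p * coneQSym (q + r)) +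
      τ (coneQSym 0 ^ q * coneQSym (p + r))) * Polynomial.X +
      Polynomial.C (τ (coneQSym 0 ^ (p + q + r))) * Polynomial.X ^ 2 := by
  ext b
  rw [coeff_letterPoly, Polynomial.coeff_add, Polynomial.coeff_add, Polynomial.coeff_C,
    Polynomial.coeff_C_mul_X, Polynomial.coeff_C_mul_X_pow]
  rcases b with _ | _ | _ | b
  · simp
  · simp [firstCoeff_of_isLimit_doubleConeSum hf]
  · simp [firstCoeff_of_isLimit_doubleConeSum hf]
  · simp [firstCoeff_of_isLimit_doubleConeSum hf]

lemma counit_one : counit 1 = 1 := map_one MvPowerSeries.constantCoeff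

lemma counit_coneQSym (m : ℕ) : counit (coneQSym m) = 0 := by
  have := isLimit_coneQSym m 0 0 (by simp)
  simp only [coneSum, Finset.range_zero, Finset.sum_empty, MvPolynomial.coeff_zero] at this
  exact this

lemma invLetter_one (y : ℚ) : invLetter y 1 = 1 := by
  have := congrArg (fun τ : QSym →ₗ[ℚ] ℚ => τ 1) (addLetter_invLetter y)
  simp only [addLetter_apply, letterPoly_one, Polynomial.eval_C, counit_one] at this
  exact this

lemma invLetter_pow (y : ℚ) (f : QSym) (k : ℕ) : invLetter y (f ^ k) = invLetter y f ^ k := by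
  induction k with
  | zero => rw [pow_zero, pow_zero, invLetter_one]
  | succ k ih => rw [pow_succ, pow_succ, invLetter_mul, ih]

/-- This value, like several below, is the solution of the linear equation obtained by expanding the
defining identity of the functional in the first letter. -/
lemma invLetter_coneQSym_zero (y : ℚ) : invLetter y (coneQSym 0) = -y := by
  have := congrArg (fun τ : QSym →ₗ[ℚ] ℚ => τ (coneQSym 0)) (addLetter_invLetter y)
  simp only [addLetter_apply, letterPoly_coneQSym, counit_coneQSym, pow_zero, invLetter_one,
    Polynomial.eval_add, Polynomial.eval_mul, Polynomial.eval_C, Polynomial.eval_X] at this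
  linarith

lemma invLetter_coneQSym (y : ℚ) (m : ℕ) : invLetter y (coneQSym m) = (-y) ^ (m + 1) := by
  have := congrArg (fun τ : QSym →ₗ[ℚ] ℚ => τ (coneQSym m)) (addLetter_invLetter y)
  simp only [addLetter_apply, letterPoly_coneQSym, counit_coneQSym, invLetter_pow,
    invLetter_coneQSym_zero,
    Polynomial.eval_add, Polynomial.eval_mul, Polynomial.eval_C, Polynomial.eval_X] at this
  rw [pow_succ]
  linarith

lemma infChar_one (y : ℚ) : infChar y 1 = 0 := by
  rw [infChar, derivLetter_apply, letterPoly_one]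
  simp

lemma infChar_coneQSym (y : ℚ) (m : ℕ) : infChar y (coneQSym m) = (-y) ^ m := by
  rw [infChar, derivLetter_apply, letterPoly_coneQSym, invLetter_pow, invLetter_coneQSym_zero,
    Polynomial.derivative_add, Polynomial.derivative_C, Polynomial.derivative_C_mul_X, zero_add,
    Polynomial.eval_C]

lemma subLetter_infChar_one (s t : ℚ) : subLetter s (infChar t) 1 = 0 := by
  have := congrArg (fun τ : QSym →ₗ[ℚ] ℚ => τ 1) (addLetter_subLetter s (infChar t))
  simp only [addLetter_apply, letterPoly_one, Polynomial.eval_C, infChar_one] at this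
  exact this

lemma subLetter_infChar_coneQSym_zero (s t : ℚ) :
    subLetter s (infChar t) (coneQSym 0) = 1 := by
  have := congrArg (fun τ : QSym →ₗ[ℚ] ℚ => τ (coneQSym 0)) (addLetter_subLetter s (infChar t))
  simp only [addLetter_apply, letterPoly_coneQSym, infChar_coneQSym, pow_zero,
    subLetter_infChar_one, Polynomial.eval_add, Polynomial.eval_mul, Polynomial.eval_C,
    Polynomial.eval_X] at this
  linarith

/-- The factor `s` avoids the exponent `k - 1` of the actual value `k (-s)^(k-1)`; only this
multiple is needed below. -/
lemma subLetter_infChar_coneQSym_zero_pow (s t : ℚ) (k : ℕ) :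
    s * subLetter s (infChar t) (coneQSym 0 ^ k) = -(k * (-s) ^ k) := by
  induction k with
  | zero => simp [subLetter_infChar_one]
  | succ k ih =>
    rw [pow_succ, subLetter_infChar_mul, invLetter_pow, invLetter_coneQSym_zero,
      subLetter_infChar_coneQSym_zero, mul_add, ← mul_assoc, ih]
    push_cast
    ring

lemma subLetter_infChar_coneQSym (s t : ℚ) (m : ℕ) :
    subLetter s (infChar t) (coneQSym m) = (-t) ^ m + m * (-s) ^ m := by
  have := congrArg (fun τ : QSym →ₗ[ℚ] ℚ => τ (coneQSym m)) (addLetter_subLetter s (infChar t))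
  simp only [addLetter_apply, letterPoly_coneQSym, infChar_coneQSym, Polynomial.eval_add,
    Polynomial.eval_mul, Polynomial.eval_C, Polynomial.eval_X] at this
  have h := subLetter_infChar_coneQSym_zero_pow s t m
  linarith

lemma doubleChar_of_isLimit_doubleConeSum (s t : ℚ) {p q r : ℕ} {f : QSym}
    (hf : IsLimit (f : MvPowerSeries ℕ ℚ) fun N => doubleConeSum p q r N MvPolynomial.X) :
    doubleChar s t f = (-s) ^ p * (-t) ^ (q + r) + (-s) ^ q * (-t) ^ (p + r) := by
  rw [doubleChar, derivLetter_apply, letterPoly_of_isLimit_doubleConeSum _ hf]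
  simp only [subLetter_infChar_mul, invLetter_pow, invLetter_coneQSym,
    subLetter_infChar_coneQSym, Polynomial.derivative_add, Polynomial.derivative_mul,
    Polynomial.derivative_C, Polynomial.derivative_X, Polynomial.derivative_X_pow,
    Polynomial.eval_add, Polynomial.eval_mul, Polynomial.eval_C, Polynomial.eval_X,
    Polynomial.eval_pow, Polynomial.eval_one, Polynomial.eval_zero]
  have h1 := subLetter_infChar_coneQSym_zero_pow s t p
  have h2 := subLetter_infChar_coneQSym_zero_pow s t q
  have h3 := subLetter_infChar_coneQSym_zero_pow s t (p + q + r)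
  simp only [pow_succ, pow_add] at *
  push_cast at *
  -- The pure powers of `-s` have total coefficient `2 (p + q + r)` in the part linear in the first
  -- letter; the quadratic part cancels them.
  linear_combination (-(-s) ^ q * (-s) ^ r) * h1 + (-(-s) ^ p * (-s) ^ r) * h2 + 2 * h3

/-! ### Rank two matroids of colorings -/

/-- The independent sets are the sets of at most two elements on which `c` is injective. -/
def colorMatroid {n : ℕ} {κ : Type*} (c : Fin n → κ) : Matroid (Fin n) :=
  (IndepMatroid.ofFinite (E := Set.univ) Set.finite_univ
    (fun I => I.ncard ≤ 2 ∧ Set.InjOn c I)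
    (by simp)
    (fun I J hJ hIJ => ⟨(Set.ncard_le_ncard hIJ (Set.toFinite J)).trans hJ.1, hJ.2.mono hIJ⟩)
    (by
      rintro I J ⟨_, hI⟩ ⟨hJ2, hJ⟩ hlt
      have hcard : (c '' I).ncard < (c '' J).ncard := by
        rwa [hI.ncard_image, hJ.ncard_image]
      obtain ⟨_, ⟨e, he, rfl⟩, hne⟩ := Set.exists_mem_notMem_of_ncard_lt_ncard hcard
        ((Set.toFinite I).image c)
      have heI : e ∉ I := fun h => hne ⟨e, h, rfl⟩
      refine ⟨e, he, heI, ?_, (Set.injOn_insert heI).2 ⟨hI, hne⟩⟩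
      rw [Set.ncard_insert_of_notMem heI]
      omega)
    (fun I _ => Set.subset_univ I)).matroid

lemma colorMatroid_indep_iff {n : ℕ} {κ : Type*} (c : Fin n → κ) (I : Set (Fin n)) :
    (colorMatroid c).Indep I ↔ I.ncard ≤ 2 ∧ Set.InjOn c I := Iff.rfl

lemma rankTwoMatroid_eq_colorMatroid {n : ℕ} (τ : n.Partition) :
    rankTwoMatroid τ = colorMatroid (blockOf τ) :=
  Matroid.ext_indep rfl fun _ _ => Iff.rfl

lemma colorMatroid_indep_pair {n : ℕ} {κ : Type*} (c : Fin n → κ) {e f : Fin n} (hef : e ≠ f) :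
    (colorMatroid c).Indep {e, f} ↔ c e ≠ c f := by
  rw [colorMatroid_indep_iff, Set.ncard_pair hef]
  simp [hef]

lemma colorMatroid_indep_singleton {n : ℕ} {κ : Type*} (c : Fin n → κ) (e : Fin n) :
    (colorMatroid c).Indep {e} := by
  rw [colorMatroid_indep_iff]
  simp

/-- The elements of the same color as `e`. -/
def colorClass {n : ℕ} {κ : Type*} (c : Fin n → κ) (e : Fin n) : Finset (Fin n) :=
  Finset.univ.filter fun f => c f = c e

lemma mem_colorClass {n : ℕ} {κ : Type*} {c : Fin n → κ} {e f : Fin n} :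
    f ∈ colorClass c e ↔ c f = c e := by
  simp [colorClass]

lemma colorClass_eq_iff {n : ℕ} {κ : Type*} {c : Fin n → κ} {e f : Fin n} :
    colorClass c e = colorClass c f ↔ c e = c f := by
  constructor
  · intro h
    have : e ∈ colorClass c f := h ▸ mem_colorClass.2 rfl
    exact mem_colorClass.1 this
  · intro h
    simp [colorClass, h]

lemma parallelClass_colorMatroid {n : ℕ} {κ : Type*} (c : Fin n → κ) :
    parallelClass (colorMatroid c) = colorClass c := by
  funext e
  ext f
  simp only [parallelClass, colorClass, Finset.mem_filter, Finset.mem_univ, true_and]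
  by_cases hef : e = f
  · simp [hef]
  · constructor
    · rintro (hf | hf)
      · exact absurd hf.symm hef
      · by_contra hne
        exact hf.not_indep ((colorMatroid_indep_pair c hef).2 fun h' => hne h'.symm)
    · intro hf
      right
      rw [Matroid.isCircuit_iff_forall_ssubset]
      refine ⟨⟨fun hi => (colorMatroid_indep_pair c hef).1 hi hf.symm, Set.subset_univ _⟩, ?_⟩
      intro I hI
      rw [Set.ssubset_iff_exists] at hI
      obtain ⟨hsub, x, hx, hxI⟩ := hI
      rcases hx with rfl | rfl
      · refine (colorMatroid_indep_singleton c f).subset fun y hy => ?_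
        rcases hsub hy with rfl | rfl
        · exact absurd hy hxI
        · rfl
      · refine (colorMatroid_indep_singleton c e).subset fun y hy => ?_
        rcases hsub hy with rfl | rfl
        · rfl
        · exact absurd hy hxI

lemma colorMatroid_loopless {n : ℕ} {κ : Type*} (c : Fin n → κ) : (colorMatroid c).Loopless := by
  rw [Matroid.loopless_iff_forall_isNonloop]
  exact fun e _ => Matroid.indep_singleton.1 (colorMatroid_indep_singleton c e)

lemma colorMatroid_eRank {n : ℕ} {κ : Type*} {c : Fin n → κ} (hc : ∃ e f, c e ≠ c f) :
    (colorMatroid c).eRank = 2 := by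
  obtain ⟨e, f, hne⟩ := hc
  have hef : e ≠ f := fun h' => hne (congrArg _ h')
  apply le_antisymm
  · rw [Matroid.eRank]
    refine iSup_le fun B => ?_
    have := ((colorMatroid_indep_iff c B.1).1 B.2.indep).1
    rw [← (Set.toFinite B.1).cast_ncard_eq]
    exact_mod_cast this
  · have := ((colorMatroid_indep_pair c hef).2 hne).encard_le_eRank
    rwa [Set.encard_pair hef] at this

lemma colorMatroid_isBase_iff {n : ℕ} {κ : Type*} {c : Fin n → κ} (hc : ∃ e f, c e ≠ c f)
    (B : Set (Fin n)) :
    (colorMatroid c).IsBase B ↔ ∃ e f, c e ≠ c f ∧ B = {e, f} := by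
  constructor
  · intro hB
    have hcard : B.encard = 2 := hB.encard_eq_eRank.trans (colorMatroid_eRank hc)
    obtain ⟨e, f, hef, rfl⟩ := Set.encard_eq_two.1 hcard
    exact ⟨e, f, (colorMatroid_indep_pair c hef).1 hB.indep, rfl⟩
  · rintro ⟨e, f, hne, rfl⟩
    have hef : e ≠ f := fun h' => hne (congrArg _ h')
    rw [Matroid.isBase_iff_maximal_indep]
    refine ⟨(colorMatroid_indep_pair c hef).2 hne, fun I hI hsub => ?_⟩
    have h2 : I.ncard ≤ 2 := ((colorMatroid_indep_iff c I).1 hI).1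
    rw [← Set.ncard_pair hef] at h2
    exact (Set.eq_of_subset_of_ncard_le hsub h2 (Set.toFinite I)).ge

/-- The multiset of the sizes of the color classes. -/
def colorType {n : ℕ} {κ : Type*} (c : Fin n → κ) : Multiset ℕ :=
  (Finset.univ.image (colorClass c)).val.map Finset.card

lemma sum_card_colorClass {n : ℕ} {κ : Type*} (c : Fin n → κ) (h : ℕ → ℚ) :
    ∑ e, h (colorClass c e).card = ((colorType c).map fun a => a * h a).sum := by
  rw [colorType, Multiset.map_map, ← Finset.sum_fiberwise_of_maps_to
    (t := Finset.univ.image (colorClass c)) (g := colorClass c)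
    (fun e _ => Finset.mem_image_of_mem _ (Finset.mem_univ e))]
  refine Finset.sum_congr rfl fun A hA => ?_
  obtain ⟨e, -, rfl⟩ := Finset.mem_image.1 hA
  have hfib : Finset.univ.filter (fun f => colorClass c f = colorClass c e) = colorClass c e := by
    ext f
    simp [colorClass_eq_iff, mem_colorClass]
  rw [Finset.sum_congr rfl (g := fun _ => h (colorClass c e).card) fun f hf => by
    rw [(Finset.mem_filter.1 hf).2], Finset.sum_const, hfib, nsmul_eq_mul]
  rfl

lemma isRankTwoOfType_colorMatroid {n : ℕ} {κ : Type*} {c : Fin n → κ} (hc : ∃ e f, c e ≠ c f)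
    {τ : n.Partition} (h : colorType c = τ.parts) : IsRankTwoOfType τ (colorMatroid c) :=
  ⟨rfl, colorMatroid_loopless c, colorMatroid_eRank hc, by
    rw [parallelClass_colorMatroid, ← h, colorType]⟩

lemma colorType_blockOf {n : ℕ} {τ : n.Partition} (h : 2 ≤ τ.parts.card) :
    colorType (blockOf τ) = τ.parts := by
  rw [← (rankTwoMatroid_isRankTwoOfType τ h).parts, rankTwoMatroid_eq_colorMatroid,
    parallelClass_colorMatroid, colorType]

lemma exists_color_ne {n : ℕ} {κ : Type*} {c : Fin n → κ} (h : 2 ≤ (colorType c).card) :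
    ∃ e f, c e ≠ c f := by
  rw [colorType, Multiset.card_map, Finset.card_val] at h
  obtain ⟨A, hA, A', hA', hne⟩ := Finset.one_lt_card.1 h
  obtain ⟨e, -, rfl⟩ := Finset.mem_image.1 hA
  obtain ⟨f, -, rfl⟩ := Finset.mem_image.1 hA'
  exact ⟨e, f, fun h => hne (colorClass_eq_iff.2 h)⟩

/-! ### The quasisymmetric function of a rank two matroid -/

section Base

variable {n : ℕ} {κ : Type*} {c : Fin n → κ} {b b' : Fin n}

/-- The admissible values at `e` of a strict map with values `i` at `b` and `j` at `b'`. -/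
def valueRange (c : Fin n → κ) (b b' : Fin n) (N i j : ℕ) (e : Fin n) : Finset ℕ :=
  if e = b then {i} else if e = b' then {j} else if c e = c b then Finset.Ioo i N
  else if c e = c b' then Finset.Ioo j N else Finset.Ioo (max i j) N

/-- Every relation starts at `b` or `b'`, so fixing these two values decouples the conditions on the
other elements. -/
lemma strictMaps_filter_eq (hbb : c b ≠ c b') {lt : Fin n → Fin n → Prop}
    (hlt : ∀ x y, lt x y ↔ (x = b ∧ y ≠ b ∧ c y ≠ c b') ∨ (x = b' ∧ y ≠ b' ∧ c y ≠ c b))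
    {N i j : ℕ} (hi : i < N) (hj : j < N) :
    ((strictMaps lt N).filter fun w => (w b, w b') = (i, j)) =
      Fintype.piFinset (valueRange c b b' N i j) := by
  have hne : b ≠ b' := fun h => hbb (congrArg c h)
  ext w
  simp only [strictMaps, Finset.mem_filter, Fintype.mem_piFinset, Finset.mem_range, Prod.mk.injEq]
  constructor
  · rintro ⟨⟨h1, h2⟩, rfl, rfl⟩ e
    unfold valueRange
    have hb : e ≠ b → c e ≠ c b' → w b < w e := fun h h' => h2 b e ((hlt b e).2 (Or.inl ⟨rfl, h, h'⟩))
    have hb' : e ≠ b' → c e ≠ c b → w b' < w e :=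
      fun h h' => h2 b' e ((hlt b' e).2 (Or.inr ⟨rfl, h, h'⟩))
    split_ifs with g1 g2 g3 g4
    · simp [g1]
    · simp [g2]
    · exact Finset.mem_Ioo.2 ⟨hb g1 (g3 ▸ hbb), h1 e⟩
    · exact Finset.mem_Ioo.2 ⟨hb' g2 g3, h1 e⟩
    · exact Finset.mem_Ioo.2 ⟨max_lt (hb g1 g4) (hb' g2 g3), h1 e⟩
  · intro h
    have hwb : w b = i := by simpa [valueRange] using h b
    have hwb' : w b' = j := by simpa [valueRange, hne.symm] using h b'
    refine ⟨⟨fun e => ?_, ?_⟩, hwb, hwb'⟩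
    · have := h e
      unfold valueRange at this
      split_ifs at this with g1 g2 g3 g4
      · rw [g1, hwb]; exact hi
      · rw [g2, hwb']; exact hj
      · exact (Finset.mem_Ioo.1 this).2
      · exact (Finset.mem_Ioo.1 this).2
      · exact (Finset.mem_Ioo.1 this).2
    · intro x e hxe
      have := h e
      unfold valueRange at this
      rcases (hlt x e).1 hxe with ⟨rfl, g1, g4⟩ | ⟨rfl, g2, g3⟩
      · have g2 : e ≠ b' := fun h => g4 (congrArg c h)
        rw [if_neg g1, if_neg g2, if_neg g4] at this
        rw [hwb]
        split_ifs at this with g3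
        · exact (Finset.mem_Ioo.1 this).1
        · exact (le_max_left _ _).trans_lt (Finset.mem_Ioo.1 this).1
      · have g1 : e ≠ b := fun h => g3 (congrArg c h)
        rw [if_neg g1, if_neg g2, if_neg g3] at this
        rw [hwb']
        split_ifs at this with g4
        · exact (Finset.mem_Ioo.1 this).1
        · exact (le_max_right _ _).trans_lt (Finset.mem_Ioo.1 this).1

lemma prod_sum_valueRange {A : Type*} [CommRing A] (hbb : c b ≠ c b') (N i j : ℕ) (y : ℕ → A) :
    ∏ e, ∑ l ∈ valueRange c b b' N i j e, y l =
      y i * y j * (∑ l ∈ Finset.Ioo i N, y l) ^ ((colorClass c b).erase b).card *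
        (∑ l ∈ Finset.Ioo j N, y l) ^ ((colorClass c b').erase b').card *
        (∑ l ∈ Finset.Ioo (max i j) N, y l) ^
          (Finset.univ \ (colorClass c b ∪ colorClass c b')).card := by
  have hne : b ≠ b' := fun h => hbb (congrArg c h)
  have h : ∀ e, ∑ l ∈ valueRange c b b' N i j e, y l =
      (if e = b then y i else 1) * (if e = b' then y j else 1) *
        (if e ∈ (colorClass c b).erase b then ∑ l ∈ Finset.Ioo i N, y l else 1) *
        (if e ∈ (colorClass c b').erase b' then ∑ l ∈ Finset.Ioo j N, y l else 1) *
        (if e ∈ Finset.univ \ (colorClass c b ∪ colorClass c b') then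
          ∑ l ∈ Finset.Ioo (max i j) N, y l else 1) := by
    intro e
    unfold valueRange
    simp only [Finset.mem_erase, mem_colorClass, Finset.mem_sdiff, Finset.mem_univ, true_and,
      Finset.mem_union]
    by_cases g1 : e = b
    · subst g1
      simp [hne, hbb]
    by_cases g2 : e = b'
    · subst g2
      simp [hne.symm, hbb.symm]
    by_cases g3 : c e = c b
    · have : c e ≠ c b' := g3 ▸ hbb
      simp [g1, g2, g3, hbb]
    by_cases g4 : c e = c b'
    · simp [g1, g2, g4, hbb.symm]
    · simp [g1, g2, g3, g4]
  simp only [h, Finset.prod_mul_distrib, Finset.prod_ite_eq', Finset.prod_ite_mem,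
    Finset.mem_univ, if_true, Finset.univ_inter, Finset.prod_const]

lemma isLimit_posetQSym_of_pair (hbb : c b ≠ c b') {lt : Fin n → Fin n → Prop}
    (hlt : ∀ x y, lt x y ↔ (x = b ∧ y ≠ b ∧ c y ≠ c b') ∨ (x = b' ∧ y ≠ b' ∧ c y ≠ c b))
    {γ : Fin n → ℕ} (hγ : Function.Injective γ) (hγlt : ∀ x y, lt x y → γ y < γ x) :
    IsLimit (posetQSym lt γ : MvPowerSeries ℕ ℚ) fun N =>
      doubleConeSum ((colorClass c b).erase b).card ((colorClass c b').erase b').card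
        (Finset.univ \ (colorClass c b ∪ colorClass c b')).card N MvPolynomial.X := by
  intro N d hd
  refine (isLimit_posetQSym hγ hγlt N d hd).trans (congrArg _ ?_)
  beta_reduce
  rw [← Finset.sum_fiberwise_of_maps_to (s := strictMaps lt N)
    (t := Finset.range N ×ˢ Finset.range N) (g := fun w => (w b, w b')) (fun w hw => by
      have := Fintype.mem_piFinset.1 (Finset.mem_filter.1 hw).1
      exact Finset.mem_product.2 ⟨this b, this b'⟩), Finset.sum_product, doubleConeSum]
  refine Finset.sum_congr rfl fun i hi => Finset.sum_congr rfl fun j hj => ?_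
  rw [strictMaps_filter_eq hbb hlt (Finset.mem_range.1 hi) (Finset.mem_range.1 hj),
    ← Finset.prod_univ_sum, prod_sum_valueRange hbb]

/-- Replacing `b` by `y` gives `{y, b'}`, a base unless `y` is parallel to `b'`. Hence the other
elements parallel to `b` lie above `b` only, and those outside both classes lie above both. -/
lemma baseLT_pair_iff (hbb : c b ≠ c b') (x y : Fin n) :
    baseLT (colorMatroid c) {b, b'} x y ↔
      (x = b ∧ y ≠ b ∧ c y ≠ c b') ∨ (x = b' ∧ y ≠ b' ∧ c y ≠ c b) := by
  have hne : b ≠ b' := fun h => hbb (congrArg c h)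
  have hbase : ∀ e f : Fin n, e ≠ f → ((colorMatroid c).IsBase {e, f} ↔ c e ≠ c f) := by
    intro e f hef
    rw [← colorMatroid_indep_pair c hef]
    refine ⟨fun h => h.indep, fun h => ?_⟩
    rw [colorMatroid_isBase_iff ⟨b, b', hbb⟩]
    exact ⟨e, f, (colorMatroid_indep_pair c hef).1 h, rfl⟩
  have h1 : ({b, b'} : Set (Fin n)) \ {b} = {b'} := by
    ext z
    simp only [Set.mem_sdiff, Set.mem_insert_iff, Set.mem_singleton_iff]
    constructor
    · tauto
    · rintro rfl
      exact ⟨Or.inr rfl, hne.symm⟩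
  have h2 : ({b, b'} : Set (Fin n)) \ {b'} = {b} := by
    ext z
    simp only [Set.mem_sdiff, Set.mem_insert_iff, Set.mem_singleton_iff]
    constructor
    · tauto
    · rintro rfl
      exact ⟨Or.inl rfl, hne⟩
  unfold baseLT
  simp only [Finset.mem_insert, Finset.mem_singleton, Finset.coe_insert, Finset.coe_singleton,
    not_or]
  constructor
  · rintro ⟨rfl | rfl, ⟨hy1, hy2⟩, hB⟩
    · rw [h1, hbase y b' hy2] at hB
      exact Or.inl ⟨rfl, hy1, hB⟩
    · rw [h2, hbase y b hy1] at hB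
      exact Or.inr ⟨rfl, hy2, hB⟩
  · rintro (⟨rfl, hy, hc⟩ | ⟨rfl, hy, hc⟩)
    · have hy2 : y ≠ b' := fun h => hc (congrArg c h)
      refine ⟨Or.inl rfl, ⟨hy, hy2⟩, ?_⟩
      rwa [h1, hbase y b' hy2]
    · have hy2 : y ≠ b := fun h => hc (congrArg c h)
      refine ⟨Or.inr rfl, ⟨hy2, hy⟩, ?_⟩
      rwa [h2, hbase y b hy2]

/-- With class sizes `p + 1` and `q + 1` and `r` elements elsewhere, `q + r` is `n - (p + 1) - 1`;
each summand thus depends on one class only. -/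
lemma doubleChar_posetQSym_base (hbb : c b ≠ c b') (s t : ℚ) :
    doubleChar s t (posetQSym (baseLT (colorMatroid c) {b, b'}) (baseLabel {b, b'})) =
      (-s) ^ ((colorClass c b).card - 1) * (-t) ^ (n - (colorClass c b).card - 1) +
      (-s) ^ ((colorClass c b').card - 1) * (-t) ^ (n - (colorClass c b').card - 1) := by
  rw [doubleChar_of_isLimit_doubleConeSum s t (isLimit_posetQSym_of_pair hbb (baseLT_pair_iff hbb)
    (baseLabel_injective _) (baseLabel_strict _ _))]
  have hb : b ∈ colorClass c b := mem_colorClass.2 rfl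
  have hb' : b' ∈ colorClass c b' := mem_colorClass.2 rfl
  have hdisj : Disjoint (colorClass c b) (colorClass c b') :=
    Finset.disjoint_left.2 fun e he he' => hbb ((mem_colorClass.1 he).symm.trans
      (mem_colorClass.1 he'))
  have hcard : (Finset.univ \ (colorClass c b ∪ colorClass c b')).card =
      n - ((colorClass c b).card + (colorClass c b').card) := by
    rw [Finset.card_univ_sdiff, Fintype.card_fin, Finset.card_union_of_disjoint hdisj]
  have hle : (colorClass c b).card + (colorClass c b').card ≤ n := by
    rw [← Finset.card_union_of_disjoint hdisj]
    exact (Finset.card_le_univ _).trans_eq (Fintype.card_fin n)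
  have h1 := Finset.card_pos.2 ⟨b, hb⟩
  have h2 := Finset.card_pos.2 ⟨b', hb'⟩
  rw [Finset.card_erase_of_mem hb, Finset.card_erase_of_mem hb', hcard]
  congr 3 <;> omega

end Base

/-- Double counting: an element of a class of size `a` lies in `n - a` bases, one for each element
outside its class, and contributes the same term to each. -/
lemma doubleChar_matroidQSym {n : ℕ} {κ : Type*} {c : Fin n → κ} (hc : ∃ e f, c e ≠ c f)
    (s t : ℚ) : doubleChar s t (matroidQSym (colorMatroid c)) =
      ((colorType c).map fun a : ℕ =>
        (a : ℚ) * ((n - a : ℕ) * ((-s) ^ (a - 1) * (-t) ^ (n - a - 1)))).sum := by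
  rw [← sum_card_colorClass c fun a => (n - a : ℕ) * ((-s) ^ (a - 1) * (-t) ^ (n - a - 1)),
    matroidQSym, map_sum]
  set θ : Fin n → ℚ := fun e =>
    (-s) ^ ((colorClass c e).card - 1) * (-t) ^ (n - (colorClass c e).card - 1) with hθ
  set 𝓑 := Finset.univ.filter (fun B : Finset (Fin n) => (colorMatroid c).IsBase (B : Set (Fin n)))
    with h𝓑
  have hmem : ∀ B, B ∈ 𝓑 ↔ ∃ e f, c e ≠ c f ∧ B = {e, f} := by
    intro B
    rw [h𝓑, Finset.mem_filter, colorMatroid_isBase_iff hc]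
    simp only [Finset.mem_univ, true_and, ← Finset.coe_pair, Finset.coe_inj]
  have hB : ∀ B ∈ 𝓑, doubleChar s t (posetQSym (baseLT (colorMatroid c) B) (baseLabel B)) =
      ∑ e, if e ∈ B then θ e else 0 := by
    intro B hB
    obtain ⟨e, f, hef, rfl⟩ := (hmem B).1 hB
    rw [doubleChar_posetQSym_base hef, ← Finset.sum_filter, Finset.filter_univ_mem,
      Finset.sum_pair fun h => hef (congrArg c h)]
  rw [Finset.sum_congr rfl hB, Finset.sum_comm]
  refine Finset.sum_congr rfl fun e _ => ?_
  rw [← Finset.sum_filter, Finset.sum_const, nsmul_eq_mul]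
  congr 2
  have hcompl : n - (colorClass c e).card = ((colorClass c e)ᶜ).card := by
    rw [Finset.card_compl, Fintype.card_fin]
  rw [hcompl]
  symm
  refine Finset.card_bij (fun f _ => {e, f}) ?_ ?_ ?_
  · intro f hf
    rw [Finset.mem_compl, mem_colorClass] at hf
    exact Finset.mem_filter.2 ⟨(hmem _).2 ⟨e, f, fun h => hf h.symm, rfl⟩, by simp⟩
  · intro f hf g hg hfg
    rw [Finset.mem_compl, mem_colorClass] at hf
    have : f ∈ ({e, g} : Finset (Fin n)) := hfg ▸ by simp
    rcases Finset.mem_insert.1 this with h | h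
    · exact absurd (congrArg c h) hf
    · exact Finset.mem_singleton.1 h
  · intro B hB
    obtain ⟨hB1, heB⟩ := Finset.mem_filter.1 hB
    obtain ⟨a, f, haf, rfl⟩ := (hmem B).1 hB1
    rcases Finset.mem_insert.1 heB with h | h
    · subst h
      exact ⟨f, by rw [Finset.mem_compl, mem_colorClass]; exact fun h => haf h.symm, rfl⟩
    · rw [Finset.mem_singleton] at h
      subst h
      exact ⟨a, by rw [Finset.mem_compl, mem_colorClass]; exact haf, Finset.pair_comm _ _⟩

/-! ### The excess of a type -/

/-- The number of parts `a` minus the number of parts `n - a`. -/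
def excess (n : ℕ) (m : Multiset ℕ) (a : ℕ) : ℤ := (m.count a : ℤ) - m.count (n - a)

/-- The polynomial `∑ a (n - a) (X^(a - 1) - X^(n - a - 1))`. -/
def excessPoly (n : ℕ) (m : Multiset ℕ) : Polynomial ℚ :=
  (m.map fun a : ℕ => Polynomial.C ((a : ℚ) * (n - a : ℕ)) *
    (Polynomial.X ^ (a - 1) - Polynomial.X ^ (n - a - 1))).sum

/-- The bounds `0 < a < n` make the truncated exponents faithful: `k - 1` equals `n - a - 1` exactly
when `a = n - k`. -/
lemma coeff_excessPoly {n : ℕ} (m : Multiset ℕ) (hm : ∀ a ∈ m, 0 < a ∧ a < n) {k : ℕ}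
    (hk : 0 < k) (hkn : k < n) :
    (excessPoly n m).coeff (k - 1) = (k : ℚ) * (n - k : ℕ) * excess n m k := by
  induction m using Multiset.induction_on with
  | empty => simp [excessPoly, excess]
  | cons a m ih =>
    have ha := hm a (Multiset.mem_cons_self a m)
    have ih' := ih fun b hb => hm b (Multiset.mem_cons_of_mem hb)
    rw [excessPoly, Multiset.map_cons, Multiset.sum_cons, Polynomial.coeff_add, ← excessPoly, ih',
      Polynomial.coeff_C_mul, Polynomial.coeff_sub, Polynomial.coeff_X_pow, Polynomial.coeff_X_pow,
      excess, excess, Multiset.count_cons, Multiset.count_cons]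
    have e1 : k - 1 = a - 1 ↔ k = a := by omega
    have e2 : k - 1 = n - a - 1 ↔ n - k = a := by omega
    simp only [e1, e2]
    by_cases h1 : k = a
    · by_cases h2 : n - k = a
      · simp [h1]
        rw [if_pos (by omega)]
        simp
      · simp [h1]
        rw [if_neg (by omega)]
        ring
    · by_cases h2 : n - k = a
      · have h3 : n - a = k := by omega
        simp only [h1, h2, h3, if_true, if_false]
        push_cast
        ring
      · simp [h1, h2]

/-- The choice `s = -x`, `t = -1` removes the signs and dehomogenizes. -/
lemma eval_excessPoly {n : ℕ} {κ : Type*} {c : Fin n → κ} (hc : ∃ e f, c e ≠ c f) (x : ℚ) :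
    (excessPoly n (colorType c)).eval x =
      commutatorChar (-x) (-1) (matroidQSym (colorMatroid c)) := by
  rw [commutatorChar, LinearMap.sub_apply, doubleChar_matroidQSym hc, doubleChar_matroidQSym hc,
    excessPoly, ← Polynomial.coe_evalRingHom, map_multiset_sum, Multiset.map_map,
    ← Multiset.sum_map_sub]
  congr 2
  funext a
  simp
  ring

/-- The commutators give an equality of polynomials at every rational `x`; in the coefficients the
nonzero factor `a (n - a)` cancels. -/
lemma excess_eq_of_rankTwoBar_eq {n : ℕ} {lam : n.Partition} (hlam : 3 ≤ lam.parts.card)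
    {J : Multiset n.Partition} (hJ : ∀ μ ∈ J, 3 ≤ μ.parts.card)
    (hF : rankTwoBar lam = (J.map rankTwoBar).sum) {a : ℕ} (ha : 0 < a) (han : a < n) :
    excess n lam.parts a = (J.map fun μ => excess n μ.parts a).sum := by
  have hlt : ∀ μ : n.Partition, 3 ≤ μ.parts.card → ∀ a ∈ μ.parts, 0 < a ∧ a < n := by
    intro μ hμ a ha
    refine ⟨μ.parts_pos ha, ?_⟩
    obtain ⟨m, hm⟩ := Multiset.exists_cons_of_mem ha
    have hsum := μ.parts_sum
    have hcard := hμ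
    rw [hm, Multiset.sum_cons] at hsum
    rw [hm, Multiset.card_cons] at hcard
    have hpos : 0 < m.sum := by
      obtain ⟨b, hb⟩ := Multiset.card_pos_iff_exists_mem.1 (show 0 < m.card by omega)
      have := μ.parts_pos (i := b) (by rw [hm]; exact Multiset.mem_cons_of_mem hb)
      exact this.trans_le (Multiset.single_le_sum (fun _ _ => Nat.zero_le _) b hb)
    omega
  have heval : ∀ μ : n.Partition, 3 ≤ μ.parts.card → ∀ x : ℚ, (excessPoly n μ.parts).eval x =
      commutatorChar (-x) (-1) (matroidQSym (rankTwoMatroid μ)) := by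
    intro μ hμ x
    have h2 : 2 ≤ μ.parts.card := by omega
    rw [rankTwoMatroid_eq_colorMatroid, ← eval_excessPoly (exists_color_ne
      (by rw [colorType_blockOf h2]; exact h2)), colorType_blockOf h2]
  have hmem : matroidQSym (rankTwoMatroid lam) - (J.map fun μ =>
      matroidQSym (rankTwoMatroid μ)).sum ∈ QSym.maxIdeal ^ 2 := by
    rw [← Ideal.Quotient.eq, map_multiset_sum, Multiset.map_map]
    exact hF
  have hpoly : excessPoly n lam.parts = (J.map fun μ => excessPoly n μ.parts).sum := by
    refine Polynomial.funext fun x => ?_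
    have h0 := commutatorChar_eq_zero (-x) (-1) hmem
    rw [map_sub, sub_eq_zero, map_multiset_sum, Multiset.map_map] at h0
    rw [heval lam hlam, h0, ← Polynomial.coe_evalRingHom, map_multiset_sum, Multiset.map_map]
    congr 1
    refine Multiset.map_congr rfl fun μ hμ => ?_
    exact (heval μ (hJ μ hμ) x).symm
  have hcoeff := congrArg (fun p => Polynomial.coeff p (a - 1)) hpoly
  simp only [coeff_excessPoly _ (hlt lam hlam) ha han] at hcoeff
  have hsum : (J.map fun μ => excessPoly n μ.parts).sum.coeff (a - 1) =
      (a : ℚ) * (n - a : ℕ) * ((J.map fun μ => excess n μ.parts a).sum : ℤ) := by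
    rw [← Polynomial.lcoeff_apply, map_multiset_sum, Multiset.map_map, Int.cast_multiset_sum,
      Multiset.map_map, ← Multiset.sum_map_mul_left]
    congr 1
    refine Multiset.map_congr rfl fun μ hμ => ?_
    exact coeff_excessPoly _ (hlt μ (hJ μ hμ)) ha han
  rw [hsum] at hcoeff
  have hne : (a : ℚ) * (n - a : ℕ) ≠ 0 := by
    refine mul_ne_zero (Nat.cast_ne_zero.2 (by omega)) (Nat.cast_ne_zero.2 (by omega))
  exact_mod_cast mul_left_cancel₀ hne hcoeff

/-! ### Gluing of partitions -/

section Excess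

variable {n : ℕ}

lemma excess_add (m m' : Multiset ℕ) (a : ℕ) :
    excess n (m + m') a = excess n m a + excess n m' a := by
  simp only [excess, Multiset.count_add]
  push_cast
  ring

lemma excess_sum (J : Multiset (Multiset ℕ)) (a : ℕ) :
    excess n J.sum a = (J.map fun μ => excess n μ a).sum := by
  induction J using Multiset.induction_on with
  | empty => simp [excess]
  | cons μ J ih => rw [Multiset.sum_cons, excess_add, Multiset.map_cons, Multiset.sum_cons, ih]

/-- Removing a part `n - a` from one side therefore balances adding a part `a` to the other; this
drives the induction in `exists_gluing`. -/
lemma excess_singleton {a b : ℕ} (ha : 0 < a) (han : a < n) (hbn : b < n) :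
    excess n {n - a} b = -excess n {a} b := by
  have e1 : b = n - a ↔ n - b = a := by omega
  have e2 : n - b = n - a ↔ b = a := by omega
  simp only [excess, Multiset.count_singleton, e1, e2]
  ring

lemma mem_multiset_sum {α : Type*} {J : Multiset (Multiset α)} {a : α} :
    a ∈ J.sum ↔ ∃ μ ∈ J, a ∈ μ :=
  Multiset.mem_join

lemma lt_of_mem_of_three_le_card {μ : Multiset ℕ} (hsum : μ.sum = n) (hpos : ∀ a ∈ μ, 0 < a)
    (hcard : 3 ≤ μ.card) {a : ℕ} (ha : a ∈ μ) : a < n := by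
  obtain ⟨m, rfl⟩ := Multiset.exists_cons_of_mem ha
  rw [Multiset.sum_cons] at hsum
  rw [Multiset.card_cons] at hcard
  obtain ⟨b, hb⟩ := Multiset.card_pos_iff_exists_mem.1 (show 0 < m.card by omega)
  have := hpos b (Multiset.mem_cons_of_mem hb)
  have := Multiset.single_le_sum (fun _ _ => Nat.zero_le _) b hb
  omega

/-- A multiset of positive integers with sum `n` and at least three elements. -/
structure IsLongPartition (n : ℕ) (μ : Multiset ℕ) : Prop where
  sum_eq : μ.sum = n
  pos : ∀ a ∈ μ, 0 < a
  three_le : 3 ≤ μ.card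

/-- The required `a` is the least number that occurs more often in the union of `J` than in `l`. -/
lemma exists_cons_mem_of_excess_eq {l : Multiset ℕ} {J : Multiset (Multiset ℕ)}
    (hJ : ∀ μ ∈ J, IsLongPartition n μ)
    (h : ∀ a, 0 < a → a < n → excess n l a = excess n J.sum a)
    (hlt : ∃ a, l.count a < J.sum.count a) :
    ∃ a ν, 0 < a ∧ a < n ∧ (n - a) ::ₘ ν ∈ J ∧ ν ≤ l ∧ ν.sum = a ∧ 2 ≤ ν.card := by
  obtain ⟨a, hlta, hmin⟩ : ∃ a, l.count a < J.sum.count a ∧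
      ∀ b < a, J.sum.count b ≤ l.count b :=
    ⟨Nat.find hlt, Nat.find_spec hlt, fun b hb => not_lt.1 (Nat.find_min hlt hb)⟩
  have hmem : ∀ b, 0 < J.sum.count b → ∃ μ ∈ J, b ∈ μ := fun b hb =>
    mem_multiset_sum.1 (Multiset.count_pos.1 hb)
  obtain ⟨μ₀, hμ₀, haμ₀⟩ := hmem a (by omega)
  have ha : 0 < a := (hJ μ₀ hμ₀).pos a haμ₀
  have han : a < n := lt_of_mem_of_three_le_card (hJ μ₀ hμ₀).sum_eq (hJ μ₀ hμ₀).pos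
    (hJ μ₀ hμ₀).three_le haμ₀
  have hex := h a ha han
  unfold excess at hex
  -- Equality of the excesses carries the surplus at `a` over to `n - a`.
  obtain ⟨μ, hμ, hna⟩ := hmem (n - a) (by omega)
  obtain ⟨ν, rfl⟩ := Multiset.exists_cons_of_mem hna
  have hsum := (hJ _ hμ).sum_eq
  rw [Multiset.sum_cons] at hsum
  have hcard := (hJ _ hμ).three_le
  rw [Multiset.card_cons] at hcard
  have hνsum : ν.sum = a := by omega
  have hνpos : ∀ b ∈ ν, 0 < b := fun b hb => (hJ _ hμ).pos b (Multiset.mem_cons_of_mem hb)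
  refine ⟨a, ν, ha, han, hμ, Multiset.le_iff_count.2 fun b => ?_, hνsum, by omega⟩
  by_cases hb : b ∈ ν
  · have hba : b < a := by
      obtain ⟨m, rfl⟩ := Multiset.exists_cons_of_mem hb
      rw [Multiset.sum_cons] at hνsum
      rw [Multiset.card_cons] at hcard
      obtain ⟨b', hb'⟩ := Multiset.card_pos_iff_exists_mem.1 (show 0 < m.card by omega)
      have := hνpos b' (Multiset.mem_cons_of_mem hb')
      have := Multiset.single_le_sum (fun _ _ => Nat.zero_le _) b' hb'
      omega
    refine le_trans ?_ (hmin b hba)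
    obtain ⟨J', rfl⟩ := Multiset.exists_cons_of_mem hμ
    rw [Multiset.sum_cons, Multiset.count_add]
    exact (Multiset.count_le_count_cons b _ ν).trans (Nat.le_add_right _ _)
  · rw [Multiset.count_eq_zero_of_notMem hb]
    exact Nat.zero_le _

/-- Compared with the empty multiset, a nonempty `J` would yield a submultiset of it with two
elements. -/
lemma eq_zero_of_excess_eq_zero {J : Multiset (Multiset ℕ)}
    (hJ : ∀ μ ∈ J, IsLongPartition n μ)
    (h : ∀ a, 0 < a → a < n → excess n J.sum a = 0) : J = 0 := by
  by_contra hne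
  obtain ⟨μ, hμ⟩ := Multiset.exists_mem_of_ne_zero hne
  obtain ⟨a, ha⟩ := Multiset.card_pos_iff_exists_mem.1
    (show 0 < μ.card by have := (hJ μ hμ).three_le; omega)
  obtain ⟨_, ν, -, -, -, hν, -, hcard⟩ := exists_cons_mem_of_excess_eq (l := 0) hJ
    (fun a ha han => by rw [h a ha han]; simp [excess])
    ⟨a, by
      rw [Multiset.count_zero, Multiset.count_pos]
      exact mem_multiset_sum.2 ⟨μ, hμ, ha⟩⟩
  rw [Multiset.le_zero.1 hν] at hcard
  simp at hcard

end Excess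

lemma exists_le_of_le_map {α β : Type*} {f : α → β} {t : Multiset β} {s : Multiset α}
    (h : t ≤ s.map f) : ∃ u ≤ s, u.map f = t := by
  induction s using Quotient.inductionOn with
  | _ l =>
    induction t using Quotient.inductionOn with
    | _ k =>
      obtain ⟨k', hk', hsub⟩ := Multiset.coe_le.1 h
      obtain ⟨l', hl', rfl⟩ := List.sublist_map_iff.1 hsub
      exact ⟨l', Multiset.coe_le.2 hl'.subperm, Multiset.coe_eq_coe.2 hk'⟩

/-! ### Set partitions and their gluing -/

section Finpartition

variable {n : ℕ}

/-- The multiset of the sizes of the parts. -/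
def partSizes (P : Finpartition (Finset.univ : Finset (Fin n))) : Multiset ℕ :=
  P.parts.val.map Finset.card

lemma sum_partSizes (P : Finpartition (Finset.univ : Finset (Fin n))) : (partSizes P).sum = n := by
  have := P.sum_card_parts
  rwa [Finset.card_univ, Fintype.card_fin] at this

lemma pos_of_mem_partSizes (P : Finpartition (Finset.univ : Finset (Fin n))) {a : ℕ}
    (ha : a ∈ partSizes P) : 0 < a := by
  obtain ⟨A, hA, rfl⟩ := Multiset.mem_map.1 ha
  exact Finset.card_pos.2 (P.nonempty_of_mem_parts hA)

lemma colorType_part (P : Finpartition (Finset.univ : Finset (Fin n))) :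
    colorType P.part = partSizes P := by
  have hclass : ∀ e, colorClass P.part e = P.part e := by
    intro e
    ext f
    rw [mem_colorClass, P.mem_part_iff_part_eq_part (Finset.mem_univ f) (Finset.mem_univ e)]
  have himg : Finset.univ.image (colorClass P.part) = P.parts := by
    ext A
    simp only [Finset.mem_image, Finset.mem_univ, true_and, hclass]
    constructor
    · rintro ⟨e, rfl⟩
      exact P.part_mem.2 (Finset.mem_univ e)
    · intro hA
      obtain ⟨e, he⟩ := P.nonempty_of_mem_parts hA
      exact ⟨e, P.part_eq_of_mem hA he⟩
  rw [colorType, himg, partSizes]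

lemma eq_of_mem_of_mem {P : Finpartition (Finset.univ : Finset (Fin n))} {A B : Finset (Fin n)}
    (hA : A ∈ P.parts) (hB : B ∈ P.parts) {e : Fin n} (heA : e ∈ A) (heB : e ∈ B) : A = B :=
  (P.part_eq_of_mem hA heA).symm.trans (P.part_eq_of_mem hB heB)

/-- A set of parts and the complement of their union form a partition. -/
def restrictParts (P : Finpartition (Finset.univ : Finset (Fin n))) (𝒮 : Finset (Finset (Fin n)))
    (h𝒮 : 𝒮 ⊆ P.parts) (hne : 𝒮 ≠ P.parts) : Finpartition (Finset.univ : Finset (Fin n)) :=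
  Finpartition.ofExistsUnique (insert (Finset.univ \ 𝒮.biUnion id) 𝒮)
    (fun _ _ => Finset.subset_univ _)
    (fun e _ => by
      by_cases he : e ∈ 𝒮.biUnion id
      · obtain ⟨A, hA, heA⟩ := Finset.mem_biUnion.1 he
        refine ⟨A, ⟨Finset.mem_insert_of_mem hA, heA⟩, ?_⟩
        rintro B ⟨hB, heB⟩
        rcases Finset.mem_insert.1 hB with rfl | hB
        · exact absurd he (Finset.mem_sdiff.1 heB).2
        · exact eq_of_mem_of_mem (h𝒮 hB) (h𝒮 hA) heB heA
      · refine ⟨_, ⟨Finset.mem_insert_self _ _, Finset.mem_sdiff.2 ⟨Finset.mem_univ e, he⟩⟩, ?_⟩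
        rintro B ⟨hB, heB⟩
        rcases Finset.mem_insert.1 hB with rfl | hB
        · rfl
        · exact absurd (Finset.mem_biUnion.2 ⟨B, hB, heB⟩) he)
    (fun h => by
      rcases Finset.mem_insert.1 h with h | h
      · obtain ⟨A, hA, hA𝒮⟩ := Finset.exists_of_ssubset (h𝒮.ssubset_of_ne hne)
        obtain ⟨e, he⟩ := P.nonempty_of_mem_parts hA
        have : e ∈ 𝒮.biUnion id := by
          by_contra hcon
          have : e ∈ Finset.univ \ 𝒮.biUnion id := Finset.mem_sdiff.2 ⟨Finset.mem_univ e, hcon⟩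
          rw [← h] at this
          simp at this
        obtain ⟨B, hB, heB⟩ := Finset.mem_biUnion.1 this
        exact hA𝒮 (eq_of_mem_of_mem (h𝒮 hB) hA heB he ▸ hB)
      · exact P.bot_notMem (h𝒮 h))

lemma parts_restrictParts (P : Finpartition (Finset.univ : Finset (Fin n)))
    (𝒮 : Finset (Finset (Fin n))) (h𝒮 : 𝒮 ⊆ P.parts) (hne : 𝒮 ≠ P.parts) :
    (restrictParts P 𝒮 h𝒮 hne).parts = insert (Finset.univ \ 𝒮.biUnion id) 𝒮 := rfl

lemma biUnion_sdiff_parts (P : Finpartition (Finset.univ : Finset (Fin n)))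
    {𝒮 : Finset (Finset (Fin n))} (h𝒮 : 𝒮 ⊆ P.parts) :
    Finset.univ \ (P.parts \ 𝒮).biUnion id = 𝒮.biUnion id := by
  ext e
  rw [Finset.mem_sdiff]
  constructor
  · rintro ⟨-, he⟩
    by_contra hcon
    refine he (Finset.mem_biUnion.2 ⟨P.part e, Finset.mem_sdiff.2
      ⟨P.part_mem.2 (Finset.mem_univ e), fun h => hcon ?_⟩, P.mem_part (Finset.mem_univ e)⟩)
    exact Finset.mem_biUnion.2 ⟨P.part e, h, P.mem_part (Finset.mem_univ e)⟩
  · intro he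
    refine ⟨Finset.mem_univ e, fun hcon => ?_⟩
    obtain ⟨A, hA, heA⟩ := Finset.mem_biUnion.1 he
    obtain ⟨B, hB, heB⟩ := Finset.mem_biUnion.1 hcon
    obtain ⟨hB, hB𝒮⟩ := Finset.mem_sdiff.1 hB
    exact hB𝒮 (eq_of_mem_of_mem hB (h𝒮 hA) heB heA ▸ hA)

lemma partSizes_restrictParts (P : Finpartition (Finset.univ : Finset (Fin n)))
    (𝒮 : Finset (Finset (Fin n))) (h𝒮 : 𝒮 ⊆ P.parts) (hne : 𝒮 ≠ P.parts) :
    partSizes (restrictParts P 𝒮 h𝒮 hne) =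
      (n - (𝒮.val.map Finset.card).sum) ::ₘ 𝒮.val.map Finset.card := by
  have hU : (𝒮.biUnion id).card = (𝒮.val.map Finset.card).sum :=
    Finset.card_biUnion fun A hA B hB hAB =>
      P.disjoint (h𝒮 hA) (h𝒮 hB) hAB
  have hnot : Finset.univ \ 𝒮.biUnion id ∉ 𝒮 := by
    intro h
    obtain ⟨e, he⟩ := P.nonempty_of_mem_parts (h𝒮 h)
    exact (Finset.mem_sdiff.1 he).2 (Finset.mem_biUnion.2 ⟨_, h, he⟩)
  rw [partSizes, parts_restrictParts, Finset.insert_val_of_notMem hnot, Multiset.map_cons,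
    Finset.card_univ_sdiff, Fintype.card_fin, hU]

lemma le_restrictParts (P : Finpartition (Finset.univ : Finset (Fin n)))
    (𝒮 : Finset (Finset (Fin n))) (h𝒮 : 𝒮 ⊆ P.parts) (hne : 𝒮 ≠ P.parts) :
    P ≤ restrictParts P 𝒮 h𝒮 hne := by
  intro A hA
  by_cases hA𝒮 : A ∈ 𝒮
  · exact ⟨A, Finset.mem_insert_of_mem hA𝒮, le_rfl⟩
  · refine ⟨_, Finset.mem_insert_self _ _, fun e he => Finset.mem_sdiff.2
      ⟨Finset.mem_univ e, fun h => hA𝒮 ?_⟩⟩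
    obtain ⟨B, hB, heB⟩ := Finset.mem_biUnion.1 h
    exact eq_of_mem_of_mem hA (h𝒮 hB) he heB ▸ hB

/-- Two partitions are adjacent along a path if two of their parts cover the ground set. -/
def HasCoveringParts (Q Q' : Finpartition (Finset.univ : Finset (Fin n))) : Prop :=
  ∃ S ∈ Q.parts, ∃ T ∈ Q'.parts, S ∪ T = Finset.univ

lemma HasCoveringParts.symm {Q Q' : Finpartition (Finset.univ : Finset (Fin n))}
    (h : HasCoveringParts Q Q') : HasCoveringParts Q' Q := by
  obtain ⟨S, hS, T, hT, hST⟩ := h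
  exact ⟨T, hT, S, hS, by rw [Finset.union_comm, hST]⟩

/-- Two parts that cover everything are all the parts. This makes a split-off piece differ from the
later ones even when types repeat. -/
lemma not_hasCoveringParts_self {Q : Finpartition (Finset.univ : Finset (Fin n))}
    (hQ : 3 ≤ (partSizes Q).card) : ¬ HasCoveringParts Q Q := by
  rintro ⟨S, hS, T, hT, hST⟩
  rw [partSizes, Multiset.card_map, Finset.card_val] at hQ
  have hsub : Q.parts ⊆ {S, T} := by
    intro A hA
    obtain ⟨e, he⟩ := Q.nonempty_of_mem_parts hA
    have : e ∈ S ∪ T := hST ▸ Finset.mem_univ e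
    rcases Finset.mem_union.1 this with h | h
    · simp [eq_of_mem_of_mem hA hS he h]
    · simp [eq_of_mem_of_mem hA hT he h]
  have := (Finset.card_le_card hsub).trans Finset.card_le_two
  omega

/-- `x` satisfies the inequalities of the rank two matroid polytope of `P`. -/
def SatisfiesParts (P : Finpartition (Finset.univ : Finset (Fin n))) (x : Fin n → ℝ) : Prop :=
  (∀ e, 0 ≤ x e) ∧ ∑ e, x e = 2 ∧ ∀ A ∈ P.parts, ∑ e ∈ A, x e ≤ 1

/-- Let `U` be the union of parts of `P` of sizes `ν`. The side `x(U) ≥ 1` of the cut is the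
partition `R` with these parts and the complement of `U`; the side `x(U) ≤ 1` is `P'`, where `U` is
a single part. Induction on the size of `J` treats `P'`. -/
lemma exists_gluing (J : Multiset (Multiset ℕ)) (hJ : ∀ μ ∈ J, IsLongPartition n μ)
    (P : Finpartition (Finset.univ : Finset (Fin n))) (hP : 3 ≤ (partSizes P).card)
    (h : ∀ a, 0 < a → a < n → excess n (partSizes P) a = excess n J.sum a) :
    ∃ 𝓝 : Finset (Finpartition (Finset.univ : Finset (Fin n))), 𝓝.val.map partSizes = J ∧
      (∀ Q ∈ 𝓝, P ≤ Q) ∧ (∀ Q ∈ 𝓝, ∀ Q' ∈ 𝓝, Q ≠ Q' → HasCoveringParts Q Q') ∧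
      ∀ x, SatisfiesParts P x → ∃ Q ∈ 𝓝, SatisfiesParts Q x := by
  induction hk : J.card using Nat.strong_induction_on generalizing J P with
  | _ k ih =>
  have hPlong : IsLongPartition n (partSizes P) :=
    ⟨sum_partSizes P, fun a ha => pos_of_mem_partSizes P ha, hP⟩
  have hJ0 : J ≠ 0 := by
    rintro rfl
    -- If `J` were empty, the type of `P` would by itself have excess zero.
    have := eq_zero_of_excess_eq_zero (J := {partSizes P})
      (fun μ hμ => (Multiset.mem_singleton.1 hμ) ▸ hPlong) (fun a ha han => by
        rw [Multiset.sum_singleton, h a ha han]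
        simp [excess])
    exact Multiset.singleton_ne_zero _ this
  have hsingle : ∀ μ, J = {μ} → partSizes P = μ →
      ∃ 𝓝 : Finset (Finpartition (Finset.univ : Finset (Fin n))), 𝓝.val.map partSizes = J ∧
      (∀ Q ∈ 𝓝, P ≤ Q) ∧ (∀ Q ∈ 𝓝, ∀ Q' ∈ 𝓝, Q ≠ Q' → HasCoveringParts Q Q') ∧
      ∀ x, SatisfiesParts P x → ∃ Q ∈ 𝓝, SatisfiesParts Q x := by
    rintro μ rfl rfl
    refine ⟨{P}, by simp, by simp, ?_, fun x hx => ⟨P, by simp, hx⟩⟩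
    intro Q hQ Q' hQ' hne
    rw [Finset.mem_singleton] at hQ hQ'
    exact absurd (hQ.trans hQ'.symm) hne
  by_cases hlt : ∃ a, (partSizes P).count a < J.sum.count a
  · obtain ⟨a, ν, ha, han, hμ, hν, hνsum, hνcard⟩ := exists_cons_mem_of_excess_eq hJ h hlt
    obtain ⟨J', rfl⟩ := Multiset.exists_cons_of_mem hμ
    have hJ' : ∀ μ ∈ J', IsLongPartition n μ := fun μ hμ => hJ μ (Multiset.mem_cons_of_mem hμ)
    obtain ⟨u, hu, humap⟩ := exists_le_of_le_map hν
    obtain ⟨𝒮, rfl⟩ : ∃ 𝒮 : Finset (Finset (Fin n)), 𝒮.val = u :=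
      ⟨⟨u, Multiset.nodup_of_le hu P.parts.nodup⟩, rfl⟩
    have h𝒮 : 𝒮 ⊆ P.parts := Finset.val_le_iff.1 hu
    set 𝒯 := P.parts \ 𝒮 with h𝒯
    have hsplit : partSizes P = ν + 𝒯.val.map Finset.card := by
      rw [← humap, ← Multiset.map_add, h𝒯, Finset.sdiff_val, add_tsub_cancel_of_le hu]
      rfl
    have hκsum : (𝒯.val.map Finset.card).sum = n - a := by
      have := sum_partSizes P
      rw [hsplit, Multiset.sum_add, hνsum] at this
      omega
    have hbal : ∀ b, 0 < b → b < n →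
        excess n (a ::ₘ 𝒯.val.map Finset.card) b = excess n J'.sum b := by
      intro b hb hbn
      have h1 := h b hb hbn
      have h2 := excess_singleton ha han hbn
      rw [hsplit, Multiset.sum_cons, excess_add, excess_add, ← Multiset.singleton_add,
        excess_add] at h1
      rw [← Multiset.singleton_add, excess_add]
      linarith
    have h𝒮ne : 𝒮 ≠ P.parts := by
      intro h'
      rw [h𝒯, h', sdiff_self] at hκsum
      simp at hκsum
      omega
    have h𝒯ne : 𝒯 ≠ P.parts := by
      intro h'
      have := sum_partSizes P
      rw [partSizes, ← h', hκsum] at this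
      omega
    have h𝒯sub : 𝒯 ⊆ P.parts := Finset.sdiff_subset
    by_cases hκ : 2 ≤ (𝒯.val.map Finset.card).card
    · set R := restrictParts P 𝒮 h𝒮 h𝒮ne with hR
      set P' := restrictParts P 𝒯 h𝒯sub h𝒯ne with hP'
      have hRsizes : partSizes R = (n - a) ::ₘ ν := by
        rw [hR, partSizes_restrictParts, humap, hνsum]
      have hP'sizes : partSizes P' = a ::ₘ 𝒯.val.map Finset.card := by
        rw [hP', partSizes_restrictParts, hκsum]
        congr 1
        omega
      have hP'parts : P'.parts = insert (𝒮.biUnion id) 𝒯 := by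
        rw [hP', parts_restrictParts, h𝒯, biUnion_sdiff_parts P h𝒮]
      obtain ⟨𝓝, h1, h2, h3, h4⟩ := ih J'.card (by rw [← hk, Multiset.card_cons]; omega) J' hJ' P'
        (by rw [hP'sizes, Multiset.card_cons]; omega) (by rw [hP'sizes]; exact hbal) rfl
      -- Every such `Q` coarsens `P'`, so it has a part containing `U`, whereas `R` has the
      -- complement of `U` as a part.
      have hcov : ∀ Q ∈ 𝓝, HasCoveringParts R Q := by
        intro Q hQ
        obtain ⟨T, hT, hsub⟩ := h2 Q hQ (b := 𝒮.biUnion id) (by rw [hP'parts]; simp)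
        refine ⟨Finset.univ \ 𝒮.biUnion id, Finset.mem_insert_self _ _, T, hT, ?_⟩
        refine Finset.eq_univ_of_forall fun e => Finset.mem_union.2 ?_
        by_cases he : e ∈ 𝒮.biUnion id
        · exact Or.inr (hsub he)
        · exact Or.inl (Finset.mem_sdiff.2 ⟨Finset.mem_univ e, he⟩)
      have hRcard : 3 ≤ (partSizes R).card := by
        rw [hRsizes, Multiset.card_cons]
        omega
      have hR𝓝 : R ∉ 𝓝 := fun hmem => not_hasCoveringParts_self hRcard (hcov R hmem)
      refine ⟨insert R 𝓝, ?_, ?_, ?_, ?_⟩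
      · rw [Finset.insert_val_of_notMem hR𝓝, Multiset.map_cons, hRsizes, h1]
      · intro Q hQ
        rcases Finset.mem_insert.1 hQ with rfl | hQ
        · exact le_restrictParts P 𝒮 h𝒮 h𝒮ne
        · exact (le_restrictParts P 𝒯 h𝒯sub h𝒯ne).trans (h2 Q hQ)
      · intro Q hQ Q' hQ' hne
        rcases Finset.mem_insert.1 hQ with rfl | hQ <;> rcases Finset.mem_insert.1 hQ' with rfl | hQ'
        · exact absurd rfl hne
        · exact hcov Q' hQ'
        · exact (hcov Q hQ).symm
        · exact h3 Q hQ Q' hQ' hne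
      · intro x hx
        have htot : ∑ e ∈ Finset.univ \ 𝒮.biUnion id, x e + ∑ e ∈ 𝒮.biUnion id, x e = 2 := by
          rw [Finset.sum_sdiff (Finset.subset_univ _), hx.2.1]
        by_cases hU : ∑ e ∈ 𝒮.biUnion id, x e ≤ 1
        · obtain ⟨Q, hQ, hQx⟩ := h4 x ⟨hx.1, hx.2.1, fun A hA => by
            rw [hP'parts] at hA
            rcases Finset.mem_insert.1 hA with rfl | hA
            · exact hU
            · exact hx.2.2 A (h𝒯sub hA)⟩
          exact ⟨Q, Finset.mem_insert_of_mem hQ, hQx⟩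
        -- Since `x(U) > 1`, the complement of `U` has sum below `1`.
        · refine ⟨R, Finset.mem_insert_self _ _, hx.1, hx.2.1, fun A hA => ?_⟩
          rcases Finset.mem_insert.1 hA with rfl | hA
          · linarith
          · exact hx.2.2 A (h𝒮 hA)
    -- Only one part lies outside `U`, of size `n - a`, so `P` already has type `μ`. The parts `a`
    -- and `n - a` have cancelling excess, so nothing else is left in `J`.
    · have hone : ∃ k, 𝒯.val.map Finset.card = {k} := by
        rw [← Multiset.card_eq_one]
        rcases Nat.eq_zero_or_pos (𝒯.val.map Finset.card).card with h0 | h0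
        · rw [Multiset.card_eq_zero.1 h0] at hκsum
          simp at hκsum
          omega
        · omega
      obtain ⟨k', hk'⟩ := hone
      rw [hk', Multiset.sum_singleton] at hκsum
      subst hκsum
      have hJ'0 : J' = 0 := eq_zero_of_excess_eq_zero hJ' fun b hb hbn => by
        rw [← hbal b hb hbn, hk', ← Multiset.singleton_add, excess_add,
          excess_singleton ha han hbn]
        ring
      subst hJ'0
      refine hsingle _ rfl ?_
      rw [hsplit, hk', add_comm, Multiset.singleton_add]
  -- Without a surplus the union of `J` is contained in the type of `P`, and comparing sums leaves
  -- room for one member only.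
  · push Not at hlt
    have hle : J.sum ≤ partSizes P := Multiset.le_iff_count.2 hlt
    obtain ⟨μ, hμ⟩ := Multiset.exists_mem_of_ne_zero hJ0
    obtain ⟨J', rfl⟩ := Multiset.exists_cons_of_mem hμ
    obtain ⟨m, hm⟩ := Multiset.le_iff_exists_add.1 hle
    rw [Multiset.sum_cons] at hm
    have hsum := sum_partSizes P
    rw [hm, Multiset.sum_add, Multiset.sum_add, (hJ μ hμ).sum_eq] at hsum
    have hzero : ∀ l : Multiset ℕ, (∀ a ∈ l, a ∈ partSizes P) → l.sum = 0 → l = 0 := by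
      intro l hl hl0
      by_contra hne
      obtain ⟨a, ha⟩ := Multiset.exists_mem_of_ne_zero hne
      have := pos_of_mem_partSizes P (hl a ha)
      have := Multiset.single_le_sum (fun _ _ => Nat.zero_le _) a ha
      omega
    have hm0 : m = 0 := hzero m (fun a ha => by rw [hm]; simp [ha]) (by omega)
    have hJ'sum : J'.sum = 0 :=
      hzero J'.sum (fun a ha => by rw [hm]; exact Multiset.mem_add.2 (Or.inl
        (Multiset.mem_add.2 (Or.inr ha)))) (by omega)
    have hJ'0 : J' = 0 := by
      by_contra hne
      obtain ⟨μ', hμ'⟩ := Multiset.exists_mem_of_ne_zero hne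
      have hcard := (hJ μ' (Multiset.mem_cons_of_mem hμ')).three_le
      obtain ⟨a, ha⟩ := Multiset.card_pos_iff_exists_mem.1 (show 0 < μ'.card by omega)
      have : a ∈ J'.sum := mem_multiset_sum.2 ⟨μ', hμ', ha⟩
      rw [hJ'sum] at this
      simp at this
    subst hJ'0
    refine hsingle μ rfl ?_
    rw [hm, hm0]
    simp

end Finpartition

/-! ### Base polytopes of rank two matroids -/

/-- In a convex combination where `l` reaches its bound `1`, every point of nonzero weight reaches
it. -/
lemma setOf_mem_convexHull_eq {E : Type*} [AddCommGroup E] [Module ℝ E] {V : Set E}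
    (l : E →ₗ[ℝ] ℝ) (hl : ∀ v ∈ V, l v ≤ 1) :
    {x ∈ convexHull ℝ V | l x = 1} = convexHull ℝ {v ∈ V | l v = 1} := by
  apply Set.Subset.antisymm
  · rintro x ⟨hx, hlx⟩
    obtain ⟨ι, _, w, z, hw0, hw1, hz, rfl⟩ := mem_convexHull_iff_exists_fintype.1 hx
    have hsum : ∑ i, w i * (1 - l (z i)) = 0 := by
      rw [map_sum] at hlx
      simp only [map_smul, smul_eq_mul] at hlx
      simp only [mul_sub, mul_one, Finset.sum_sub_distrib, hw1, hlx, sub_self]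
    have hzero := (Finset.sum_eq_zero_iff_of_nonneg fun i _ =>
      mul_nonneg (hw0 i) (sub_nonneg.2 (hl _ (hz i)))).1 hsum
    have hfilter : ∑ i with w i ≠ 0, w i = 1 := by rw [Finset.sum_filter_ne_zero, hw1]
    have hx' : ∑ i, w i • z i = ∑ i with w i ≠ 0, w i • z i := by
      rw [Finset.sum_filter]
      refine Finset.sum_congr rfl fun i _ => ?_
      split_ifs with h
      · rfl
      · rw [not_not.1 h, zero_smul]
    rw [hx']
    refine (convex_convexHull ℝ _).sum_mem (fun i _ => hw0 i) hfilter fun i hi => ?_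
    refine subset_convexHull ℝ _ ⟨hz i, ?_⟩
    have := hzero i (Finset.mem_univ i)
    rcases mul_eq_zero.1 this with h | h
    · exact absurd h (Finset.mem_filter.1 hi).2
    · linarith
  · refine convexHull_min ?_ ?_
    · rintro v ⟨hv, hlv⟩
      exact ⟨subset_convexHull ℝ _ hv, hlv⟩
    · exact (convex_convexHull ℝ V).inter (convex_hyperplane l.isLinear 1)

section Polytope

variable {n : ℕ}

lemma sum_indicator_eq_card (A : Finset (Fin n)) (B : Finset (Fin n)) :
    ∑ e ∈ A, (B : Set (Fin n)).indicator (1 : Fin n → ℝ) e = (A ∩ B).card := by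
  simp only [Set.indicator_apply, Finset.mem_coe, Pi.one_apply]
  rw [Finset.sum_boole, Finset.filter_mem_eq_inter]

lemma isBase_part_iff {P : Finpartition (Finset.univ : Finset (Fin n))}
    (hP : 2 ≤ (partSizes P).card) (B : Set (Fin n)) :
    (colorMatroid P.part).IsBase B ↔ ∃ e f, P.part e ≠ P.part f ∧ B = {e, f} :=
  colorMatroid_isBase_iff (exists_color_ne (by rwa [colorType_part])) B

lemma convex_setOf_satisfiesParts (P : Finpartition (Finset.univ : Finset (Fin n))) :
    Convex ℝ {x | SatisfiesParts P x} := by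
  intro x hx y hy a b ha hb hab
  have hsum : ∀ A : Finset (Fin n), ∑ e ∈ A, (a • x + b • y) e =
      a * ∑ e ∈ A, x e + b * ∑ e ∈ A, y e := fun A => by
    simp [Finset.sum_add_distrib, Finset.mul_sum]
  refine ⟨fun e => ?_, ?_, fun A hA => ?_⟩
  · exact add_nonneg (mul_nonneg ha (hx.1 e)) (mul_nonneg hb (hy.1 e))
  · rw [hsum, hx.2.1, hy.2.1, ← add_mul, hab, one_mul]
  · rw [hsum]
    have h1 := mul_le_mul_of_nonneg_left (hx.2.2 A hA) ha
    have h2 := mul_le_mul_of_nonneg_left (hy.2.2 A hA) hb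
    linarith

lemma satisfiesParts_indicator {P : Finpartition (Finset.univ : Finset (Fin n))} {e f : Fin n}
    (h : P.part e ≠ P.part f) :
    SatisfiesParts P (({e, f} : Set (Fin n)).indicator 1) := by
  have hef : e ≠ f := fun h' => h (congrArg _ h')
  rw [← Finset.coe_pair]
  refine ⟨fun a => Set.indicator_nonneg (fun _ _ => zero_le_one) a, ?_, fun A hA => ?_⟩
  · rw [sum_indicator_eq_card, Finset.univ_inter, Finset.card_pair hef]
    norm_num
  · rw [sum_indicator_eq_card]
    norm_cast
    rw [Finset.card_le_one]
    intro a ha b hb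
    rw [Finset.mem_inter, Finset.mem_insert, Finset.mem_singleton] at ha hb
    have hpa := P.part_eq_of_mem hA ha.1
    have hpb := P.part_eq_of_mem hA hb.1
    rcases ha.2 with rfl | rfl <;> rcases hb.2 with rfl | rfl
    · rfl
    · exact absurd (hpa.trans hpb.symm) h
    · exact absurd (hpb.trans hpa.symm) h
    · rfl

/-- The greedy base: `e` maximizes `l`, and `f` maximizes `l` outside the part of `e`. That part
carries at most `1` of the total mass `2`, and `l f ≤ l e`. -/
lemma sum_mul_le_of_satisfiesParts {P : Finpartition (Finset.univ : Finset (Fin n))}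
    (hP : ∃ e f, P.part e ≠ P.part f) {x : Fin n → ℝ} (hx : SatisfiesParts P x) (l : Fin n → ℝ) :
    ∃ e f, P.part e ≠ P.part f ∧ ∑ a, l a * x a ≤ l e + l f := by
  obtain ⟨e₁, f₁, hne⟩ := hP
  obtain ⟨e, -, he⟩ := Finset.exists_max_image Finset.univ l ⟨e₁, Finset.mem_univ _⟩
  obtain ⟨f, hf, hfmax⟩ := Finset.exists_max_image (Finset.univ \ P.part e) l (by
    by_contra hcon
    rw [Finset.not_nonempty_iff_eq_empty, Finset.sdiff_eq_empty_iff_subset] at hcon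
    have h1 := P.part_eq_of_mem (P.part_mem.2 (Finset.mem_univ e)) (hcon (Finset.mem_univ e₁))
    have h2 := P.part_eq_of_mem (P.part_mem.2 (Finset.mem_univ e)) (hcon (Finset.mem_univ f₁))
    exact hne (h1.trans h2.symm))
  have hfe : f ∉ P.part e := (Finset.mem_sdiff.1 hf).2
  refine ⟨e, f, fun h => hfe (h ▸ P.mem_part (Finset.mem_univ f)), ?_⟩
  have htot := hx.2.1
  rw [← Finset.sum_sdiff (Finset.subset_univ (P.part e))] at htot ⊢
  have h1 : ∑ a ∈ Finset.univ \ P.part e, l a * x a ≤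
      l f * ∑ a ∈ Finset.univ \ P.part e, x a := by
    rw [Finset.mul_sum]
    exact Finset.sum_le_sum fun a ha => mul_le_mul_of_nonneg_right (hfmax a ha) (hx.1 a)
  have h2 : ∑ a ∈ P.part e, l a * x a ≤ l e * ∑ a ∈ P.part e, x a := by
    rw [Finset.mul_sum]
    exact Finset.sum_le_sum fun a _ =>
      mul_le_mul_of_nonneg_right (he a (Finset.mem_univ a)) (hx.1 a)
  have h3 := hx.2.2 _ (P.part_mem.2 (Finset.mem_univ e))
  have h4 := mul_nonneg (sub_nonneg.2 (he f (Finset.mem_univ f))) (sub_nonneg.2 h3)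
  rw [eq_sub_of_add_eq htot] at h1
  linarith

/-- A point satisfying the inequalities but outside the hull would be strictly separated from it,
against the greedy base for the separating functional. -/
lemma basePolytope_part {P : Finpartition (Finset.univ : Finset (Fin n))}
    (hP : 2 ≤ (partSizes P).card) :
    basePolytope (colorMatroid P.part) = {x | SatisfiesParts P x} := by
  apply Set.Subset.antisymm
  · refine convexHull_min ?_ (convex_setOf_satisfiesParts P)
    rintro x ⟨B, hB, rfl⟩
    obtain ⟨e, f, hef, rfl⟩ := (isBase_part_iff hP B).1 hB
    exact satisfiesParts_indicator hef
  · intro x hx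
    by_contra hcon
    have hfin : {x : Fin n → ℝ | ∃ B : Set (Fin n), (colorMatroid P.part).IsBase B ∧
        x = B.indicator 1}.Finite := by
      refine (Set.finite_range fun B : Set (Fin n) => B.indicator (1 : Fin n → ℝ)).subset ?_
      rintro _ ⟨B, -, rfl⟩
      exact ⟨B, rfl⟩
    obtain ⟨l, u, hlt, hu⟩ := geometric_hahn_banach_closed_point (convex_convexHull ℝ _)
      (hfin.isClosed_convexHull ℝ) hcon
    have hl : ∀ y : Fin n → ℝ, l y = ∑ a, l (Pi.single a 1) * y a := by
      intro y
      conv_lhs => rw [← Finset.univ_sum_single y]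
      rw [map_sum]
      refine Finset.sum_congr rfl fun a _ => ?_
      rw [mul_comm, ← smul_eq_mul, ← map_smul, ← Pi.single_smul, smul_eq_mul, mul_one]
    obtain ⟨e, f, hef, hle⟩ := sum_mul_le_of_satisfiesParts
      (exists_color_ne (by rwa [colorType_part])) hx fun a => l (Pi.single a 1)
    have hne : e ≠ f := fun h => hef (congrArg _ h)
    have hbase := hlt _ (subset_convexHull ℝ _ ⟨{e, f}, (isBase_part_iff hP _).2
      ⟨e, f, hef, rfl⟩, rfl⟩)
    rw [hl] at hbase hu
    have hsum : ∑ a, l (Pi.single a 1) * ({e, f} : Set (Fin n)).indicator 1 a =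
        l (Pi.single e 1) + l (Pi.single f 1) := by
      rw [← Finset.sum_pair hne (f := fun a => l (Pi.single a 1)),
        ← Finset.sum_filter_add_sum_filter_not Finset.univ (· ∈ ({e, f} : Finset (Fin n)))]
      rw [Finset.filter_univ_mem, Finset.sum_eq_zero (s := Finset.univ.filter _), add_zero]
      · refine Finset.sum_congr rfl fun a ha => ?_
        rw [Set.indicator_of_mem (by simpa using ha), Pi.one_apply, mul_one]
      · intro a ha
        rw [Set.indicator_of_notMem (by simpa using ha), mul_zero]
    linarith

lemma basePolytope_part_mono {P Q : Finpartition (Finset.univ : Finset (Fin n))}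
    (hP : 2 ≤ (partSizes P).card) (hQ : 2 ≤ (partSizes Q).card) (hPQ : P ≤ Q) :
    basePolytope (colorMatroid Q.part) ⊆ basePolytope (colorMatroid P.part) := by
  refine convexHull_mono ?_
  rintro x ⟨B, hB, rfl⟩
  obtain ⟨e, f, hef, rfl⟩ := (isBase_part_iff hQ B).1 hB
  refine ⟨_, (isBase_part_iff hP _).2 ⟨e, f, fun h => hef ?_, rfl⟩, rfl⟩
  obtain ⟨A, hA, hsub⟩ := hPQ (P.part_mem.2 (Finset.mem_univ e))
  rw [Q.part_eq_of_mem hA (hsub (P.mem_part (Finset.mem_univ e))),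
    Q.part_eq_of_mem hA (hsub (h ▸ P.mem_part (Finset.mem_univ f)))]

/-! ### Common faces of two pieces -/

/-- The matroid whose bases consist of an element of `X` and an element of `Y`. -/
def pairMatroid (X Y : Finset (Fin n)) : Matroid (Fin n) :=
  ((colorMatroid fun e => e ∈ X).restrict ((X ∪ Y : Finset (Fin n)) : Set (Fin n))).restrict
    Set.univ

/-- Restricting to `X ∪ Y` and then back to everything turns the remaining elements into loops, so
the ground set stays full. -/
lemma pairMatroid_isBase_iff {X Y : Finset (Fin n)} (hXY : Disjoint X Y) (hX : X.Nonempty)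
    (hY : Y.Nonempty) (B : Set (Fin n)) :
    (pairMatroid X Y).IsBase B ↔ ∃ e ∈ X, ∃ f ∈ Y, B = {e, f} := by
  have hindep : ∀ I : Set (Fin n), (pairMatroid X Y).Indep I ↔
      (colorMatroid fun e => e ∈ X).Indep I ∧ I ⊆ ((X ∪ Y : Finset (Fin n)) : Set (Fin n)) := by
    intro I
    rw [pairMatroid, Matroid.restrict_indep_iff, Matroid.restrict_indep_iff]
    simp
  have hback : ∀ e ∈ X, ∀ f ∈ Y, (pairMatroid X Y).IsBase {e, f} := by
    intro e he f hf
    have hfX : f ∉ X := fun h => Finset.disjoint_left.1 hXY h hf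
    have hef : e ≠ f := fun h => hfX (h ▸ he)
    rw [Matroid.isBase_iff_maximal_indep]
    refine ⟨(hindep _).2 ⟨(colorMatroid_indep_pair _ hef).2 fun h => hfX (h ▸ he), ?_⟩,
      fun I hI hsub => ?_⟩
    · rw [← Finset.coe_pair, Finset.coe_subset]
      intro a ha
      rcases Finset.mem_insert.1 ha with rfl | ha
      · exact Finset.mem_union_left _ he
      · rw [Finset.mem_singleton.1 ha]
        exact Finset.mem_union_right _ hf
    · have h2 : I.ncard ≤ 2 := ((colorMatroid_indep_iff _ I).1 ((hindep I).1 hI).1).1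
      rw [← Set.ncard_pair hef] at h2
      exact (Set.eq_of_subset_of_ncard_le hsub h2 (Set.toFinite I)).ge
  constructor
  · intro hB
    obtain ⟨e₀, he₀⟩ := hX
    obtain ⟨f₀, hf₀⟩ := hY
    have hne : e₀ ≠ f₀ := fun h => Finset.disjoint_left.1 hXY he₀ (h ▸ hf₀)
    have hcard := hB.encard_eq_encard_of_isBase (hback e₀ he₀ f₀ hf₀)
    rw [Set.encard_pair hne] at hcard
    obtain ⟨a, b, hab, rfl⟩ := Set.encard_eq_two.1 hcard
    obtain ⟨h1, h2⟩ := (hindep _).1 hB.indep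
    have hcol := (colorMatroid_indep_pair _ hab).1 h1
    have ha : a ∈ X ∪ Y := h2 (by simp)
    have hb : b ∈ X ∪ Y := h2 (by simp)
    rw [Finset.mem_union] at ha hb
    by_cases haX : a ∈ X
    · have hbX : b ∉ X := fun h => hcol (by simp [haX, h])
      exact ⟨a, haX, b, hb.resolve_left hbX, rfl⟩
    · have hbX : b ∈ X := by
        by_contra h
        exact hcol (by simp [haX, h])
      exact ⟨b, hbX, a, ha.resolve_left haX, Set.pair_comm a b⟩
  · rintro ⟨e, he, f, hf, rfl⟩
    exact hback e he f hf

/-- The sum of the coordinates in `X`. -/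
def coordSum (X : Finset (Fin n)) : (Fin n → ℝ) →L[ℝ] ℝ :=
  ∑ e ∈ X, ContinuousLinearMap.proj e

lemma coordSum_apply (X : Finset (Fin n)) (x : Fin n → ℝ) : coordSum X x = ∑ e ∈ X, x e := by
  simp [coordSum]

/-- A base with one element in `S \ T` has its other element outside the part `S`, hence in `T \ S`
because `S` and `T` cover. -/
lemma basePolytope_eq_face {Q : Finpartition (Finset.univ : Finset (Fin n))}
    (hQ : 2 ≤ (partSizes Q).card) {S T : Finset (Fin n)} (hS : S ∈ Q.parts)
    (hST : S ∪ T = Finset.univ) {K : Matroid (Fin n)}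
    (hK : ∀ B, K.IsBase B ↔ ∃ e ∈ S \ T, ∃ f ∈ T \ S, B = {e, f}) :
    basePolytope K = {x ∈ basePolytope (colorMatroid Q.part) | coordSum (S \ T) x = 1} := by
  have hval : ∀ e f, Q.part e ≠ Q.part f →
      coordSum (S \ T) (({e, f} : Set (Fin n)).indicator 1) ≤ 1 := by
    intro e f hef
    rw [coordSum_apply]
    have h := satisfiesParts_indicator hef
    exact (Finset.sum_le_sum_of_subset_of_nonneg Finset.sdiff_subset
      fun a _ _ => h.1 a).trans (h.2.2 S hS)
  have hface := setOf_mem_convexHull_eq (V := {x : Fin n → ℝ | ∃ B : Set (Fin n),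
    (colorMatroid Q.part).IsBase B ∧ x = B.indicator 1}) (coordSum (S \ T)).toLinearMap (by
      rintro x ⟨B, hB, rfl⟩
      obtain ⟨e, f, hef, rfl⟩ := (isBase_part_iff hQ B).1 hB
      exact hval e f hef)
  refine Eq.trans ?_ hface.symm
  rw [basePolytope]
  congr 1
  ext x
  constructor
  · rintro ⟨B, hB, rfl⟩
    obtain ⟨e, he, f, hf, rfl⟩ := (hK B).1 hB
    rw [Finset.mem_sdiff] at he hf
    refine ⟨⟨_, (isBase_part_iff hQ _).2 ⟨e, f, fun h => hf.2 ?_, rfl⟩, rfl⟩, ?_⟩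
    · rw [← Q.part_eq_of_mem hS he.1, h]
      exact Q.mem_part (Finset.mem_univ f)
    · change coordSum (S \ T) _ = 1
      rw [coordSum_apply, ← Finset.coe_pair, sum_indicator_eq_card]
      have : (S \ T) ∩ {e, f} = {e} := by
        ext a
        simp only [Finset.mem_inter, Finset.mem_sdiff, Finset.mem_insert, Finset.mem_singleton]
        constructor
        · rintro ⟨ha, rfl | rfl⟩
          · rfl
          · exact absurd ha.1 hf.2
        · rintro rfl
          exact ⟨he, Or.inl rfl⟩
      rw [this]
      simp
  · rintro ⟨⟨B, hB, rfl⟩, hx⟩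
    obtain ⟨e, f, hef, rfl⟩ := (isBase_part_iff hQ B).1 hB
    refine ⟨_, (hK _).2 ?_, rfl⟩
    change coordSum (S \ T) _ = 1 at hx
    rw [coordSum_apply, ← Finset.coe_pair, sum_indicator_eq_card] at hx
    have hcard : ((S \ T) ∩ {e, f}).card = 1 := by exact_mod_cast hx
    obtain ⟨a, ha⟩ := Finset.card_pos.1 (show 0 < ((S \ T) ∩ {e, f}).card by omega)
    have key : ∀ a b, a ∈ S \ T → Q.part a ≠ Q.part b → b ∈ T \ S := by
      intro a b ha hab
      have hbS : b ∉ S := fun hb => hab ((Q.part_eq_of_mem hS (Finset.mem_sdiff.1 ha).1).trans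
        (Q.part_eq_of_mem hS hb).symm)
      have : b ∈ S ∪ T := hST ▸ Finset.mem_univ b
      exact Finset.mem_sdiff.2 ⟨(Finset.mem_union.1 this).resolve_left hbS, hbS⟩
    rw [Finset.mem_inter, Finset.mem_insert, Finset.mem_singleton] at ha
    rcases ha.2 with h | h
    · have ha1 := ha.1
      rw [h] at ha1
      exact ⟨e, ha1, f, key e f ha1 hef, rfl⟩
    · have ha1 := ha.1
      rw [h] at ha1
      exact ⟨f, ha1, e, key f e ha1 hef.symm, Set.pair_comm e f⟩

lemma isExposed_face {A B : Set (Fin n → ℝ)} (l : (Fin n → ℝ) →L[ℝ] ℝ) (hl : ∀ x ∈ A, l x ≤ 1)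
    (hB : B = {x ∈ A | l x = 1}) : IsExposed ℝ A B := by
  rintro ⟨b, hb⟩
  refine ⟨l, ?_⟩
  rw [hB] at hb ⊢
  ext x
  constructor
  · rintro ⟨hx, hlx⟩
    exact ⟨hx, fun y hy => hlx ▸ hl y hy⟩
  · rintro ⟨hx, hmax⟩
    exact ⟨hx, le_antisymm (hl x hx) (hb.2 ▸ hmax b hb.1)⟩

lemma coordSum_sdiff_le {Q : Finpartition (Finset.univ : Finset (Fin n))}
    (hQ : 2 ≤ (partSizes Q).card) {S : Finset (Fin n)} (hS : S ∈ Q.parts) (T : Finset (Fin n))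
    {x : Fin n → ℝ} (hx : x ∈ basePolytope (colorMatroid Q.part)) : coordSum (S \ T) x ≤ 1 := by
  rw [basePolytope_part hQ] at hx
  rw [coordSum_apply]
  exact (Finset.sum_le_sum_of_subset_of_nonneg Finset.sdiff_subset
    fun a _ _ => hx.1 a).trans (hx.2.2 S hS)

lemma ne_univ_of_mem_parts {Q : Finpartition (Finset.univ : Finset (Fin n))}
    (hQ : 2 ≤ (partSizes Q).card) {S : Finset (Fin n)} (hS : S ∈ Q.parts) :
    S ≠ Finset.univ := by
  rintro rfl
  obtain ⟨e, f, hef⟩ := exists_color_ne (c := Q.part) (by rwa [colorType_part])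
  exact hef ((Q.part_eq_of_mem hS (Finset.mem_univ e)).trans
    (Q.part_eq_of_mem hS (Finset.mem_univ f)).symm)

/-- From `x(S) ≤ 1`, `x(T) ≤ 1` and `x(S) + x(T) - x(S ∩ T) = 2` follow `x(S) = x(T) = 1` and `x(S ∩
T) = 0`. The common points thus satisfy `x(S \ T) = 1`, which defines the face. -/
lemma exists_inter_matroid {Q Q' : Finpartition (Finset.univ : Finset (Fin n))}
    (hQ : 2 ≤ (partSizes Q).card) (hQ' : 2 ≤ (partSizes Q').card) (h : HasCoveringParts Q Q') :
    ∃ K : Matroid (Fin n), K.E = Set.univ ∧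
      (∀ B, K.IsBase B ↔ (colorMatroid Q.part).IsBase B ∧ (colorMatroid Q'.part).IsBase B) ∧
      basePolytope (colorMatroid Q.part) ∩ basePolytope (colorMatroid Q'.part) =
        basePolytope K ∧
      IsExposed ℝ (basePolytope (colorMatroid Q.part)) (basePolytope K) ∧
      IsExposed ℝ (basePolytope (colorMatroid Q'.part)) (basePolytope K) := by
  obtain ⟨S, hS, T, hT, hST⟩ := h
  have hTS : T ∪ S = Finset.univ := by rw [Finset.union_comm, hST]
  have hcompl : ∀ e, e ∉ S → e ∈ T := fun e he =>
    (Finset.mem_union.1 (hST ▸ Finset.mem_univ e : e ∈ S ∪ T)).resolve_left he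
  have hne : ∀ A B : Finset (Fin n), A ∪ B = Finset.univ → B ≠ Finset.univ → (A \ B).Nonempty := by
    intro A B hAB hB
    by_contra hcon
    rw [Finset.not_nonempty_iff_eq_empty, Finset.sdiff_eq_empty_iff_subset] at hcon
    exact hB (by rw [← hAB, Finset.union_eq_right.2 hcon])
  set K := pairMatroid (S \ T) (T \ S) with hK
  have hbase : ∀ B, K.IsBase B ↔ ∃ e ∈ S \ T, ∃ f ∈ T \ S, B = {e, f} :=
    pairMatroid_isBase_iff (Finset.disjoint_left.2 fun e he he' =>
      (Finset.mem_sdiff.1 he).2 (Finset.mem_sdiff.1 he').1)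
      (hne S T hST (ne_univ_of_mem_parts hQ' hT)) (hne T S hTS (ne_univ_of_mem_parts hQ hS))
  have hbase' : ∀ B, K.IsBase B ↔ ∃ e ∈ T \ S, ∃ f ∈ S \ T, B = {e, f} := by
    intro B
    rw [hbase]
    constructor
    · rintro ⟨e, he, f, hf, rfl⟩
      exact ⟨f, hf, e, he, Set.pair_comm e f⟩
    · rintro ⟨e, he, f, hf, rfl⟩
      exact ⟨f, hf, e, he, Set.pair_comm e f⟩
  have hface := basePolytope_eq_face hQ hS hST hbase
  have hface' := basePolytope_eq_face hQ' hT hTS hbase'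
  have hpart : ∀ {R : Finpartition (Finset.univ : Finset (Fin n))} {A : Finset (Fin n)} {e f},
      A ∈ R.parts → e ∈ A → f ∉ A → R.part e ≠ R.part f := by
    intro R A e f hA he hf h
    rw [R.part_eq_of_mem hA he] at h
    exact hf (h ▸ R.mem_part (Finset.mem_univ f))
  refine ⟨K, rfl, fun B => ⟨fun hB => ?_, ?_⟩, ?_, ?_, ?_⟩
  · obtain ⟨e, he, f, hf, rfl⟩ := (hbase B).1 hB
    rw [Finset.mem_sdiff] at he hf
    exact ⟨(isBase_part_iff hQ _).2 ⟨e, f, hpart hS he.1 hf.2, rfl⟩,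
      (isBase_part_iff hQ' _).2 ⟨e, f, (hpart hT hf.1 he.2).symm, rfl⟩⟩
  · rintro ⟨hB, hB'⟩
    obtain ⟨e, f, hef, rfl⟩ := (isBase_part_iff hQ B).1 hB
    have hne' : e ≠ f := fun h => hef (congrArg _ h)
    have hef' := (colorMatroid_indep_pair _ hne').1 hB'.indep
    -- Each of `S` and `T` contains at most one of `e`, `f`; since they cover, each contains exactly
    -- one, and not the same one.
    have hSef : ¬ (e ∈ S ∧ f ∈ S) := fun h =>
      hef ((Q.part_eq_of_mem hS h.1).trans (Q.part_eq_of_mem hS h.2).symm)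
    have hTef : ¬ (e ∈ T ∧ f ∈ T) := fun h =>
      hef' ((Q'.part_eq_of_mem hT h.1).trans (Q'.part_eq_of_mem hT h.2).symm)
    rw [hbase]
    simp only [Finset.mem_sdiff]
    have he := hcompl e
    have hf := hcompl f
    by_cases heS : e ∈ S
    · exact ⟨e, by tauto, f, by tauto, rfl⟩
    · exact ⟨f, by tauto, e, by tauto, Set.pair_comm e f⟩
  · apply Set.Subset.antisymm
    · rintro x ⟨hx, hx'⟩
      rw [hface]
      refine ⟨hx, ?_⟩
      rw [basePolytope_part hQ] at hx
      rw [basePolytope_part hQ'] at hx'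
      have h1 := hx.2.2 S hS
      have h2 := hx'.2.2 T hT
      have h3 := hx.2.1
      have h4 := Finset.sum_union_inter (s₁ := S) (s₂ := T) (f := x)
      rw [hST, h3] at h4
      have h5 : 0 ≤ ∑ e ∈ S ∩ T, x e := Finset.sum_nonneg fun e _ => hx.1 e
      have h6 := Finset.sum_inter_add_sum_sdiff S T x
      rw [coordSum_apply]
      linarith
    · intro x hx
      constructor
      · rw [hface] at hx
        exact hx.1
      · rw [hface'] at hx
        exact hx.1
  · exact isExposed_face _ (fun x hx => coordSum_sdiff_le hQ hS T hx) hface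
  · exact isExposed_face _ (fun x hx => coordSum_sdiff_le hQ' hT S hx) hface'

lemma part_eq_colorClass (P : Finpartition (Finset.univ : Finset (Fin n))) :
    P.part = colorClass P.part := by
  funext e
  ext f
  rw [mem_colorClass, P.mem_part_iff_part_eq_part (Finset.mem_univ f) (Finset.mem_univ e)]

/-- The partition is recovered from the matroid as its parallelism classes. -/
lemma colorMatroid_part_injective {P Q : Finpartition (Finset.univ : Finset (Fin n))}
    (h : colorMatroid P.part = colorMatroid Q.part) : P = Q := by
  have hpart : P.part = Q.part := by
    rw [part_eq_colorClass P, part_eq_colorClass Q, ← parallelClass_colorMatroid,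
      ← parallelClass_colorMatroid, h]
  have hparts : ∀ R : Finpartition (Finset.univ : Finset (Fin n)),
      R.parts = Finset.univ.image R.part := by
    intro R
    ext A
    simp only [Finset.mem_image, Finset.mem_univ, true_and]
    constructor
    · intro hA
      obtain ⟨e, he⟩ := R.nonempty_of_mem_parts hA
      exact ⟨e, R.part_eq_of_mem hA he⟩
    · rintro ⟨e, rfl⟩
      exact R.part_mem.2 (Finset.mem_univ e)
  exact Finpartition.ext (by rw [hparts P, hparts Q, hpart])

lemma exists_partSizes_eq {τ : n.Partition} (h : 2 ≤ τ.parts.card) :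
    ∃ P : Finpartition (Finset.univ : Finset (Fin n)), partSizes P = τ.parts := by
  refine ⟨Finpartition.ofSetoid (Setoid.ker (blockOf τ)), ?_⟩
  rw [← colorType_part, ← colorType_blockOf h, colorType, colorType, ← part_eq_colorClass]
  have hpart : (Finpartition.ofSetoid (Setoid.ker (blockOf τ))).part =
      colorClass (blockOf τ) := by
    funext e
    ext f
    rw [Finpartition.mem_part_ofSetoid_iff_rel, mem_colorClass]
    exact eq_comm
  rw [hpart]

/-- The sizes of the parts as a partition of `n`. -/
def partSizesPartition (P : Finpartition (Finset.univ : Finset (Fin n))) : n.Partition where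
  parts := partSizes P
  parts_pos ha := pos_of_mem_partSizes P ha
  parts_sum := sum_partSizes P

lemma toType_val_injective {α : Type*} [DecidableEq α] {s : Multiset α} (hs : s.Nodup) :
    Function.Injective fun v : s.ToType => v.1 := by
  rintro ⟨a, i⟩ ⟨b, j⟩ h
  obtain rfl : a = b := h
  have := Multiset.nodup_iff_count_le_one.1 hs a
  have hij : i = j := Fin.ext (by have := i.2; have := j.2; omega)
  rw [hij]

end Polytope

end

theorem theorem6p2 {n : ℕ} (lam : n.Partition) (hlam : 3 ≤ lam.parts.card)
    (J : Multiset n.Partition) (hJ : ∀ μ ∈ J, 3 ≤ μ.parts.card)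
    (hF : rankTwoBar lam = (J.map rankTwoBar).sum) :
    ∃ (L : Matroid (Fin n)) (N : J.ToType → Matroid (Fin n)),
      IsRankTwoOfType lam L ∧
      (∀ j : J.ToType, IsRankTwoOfType j.1 (N j)) ∧
      IsBasePolytopeDecomposition L N := by
  classical
  obtain ⟨P, hP⟩ := exists_partSizes_eq (τ := lam) (by omega)
  have hP3 : 3 ≤ (partSizes P).card := by rwa [hP]
  obtain ⟨𝓝, hmap, hle, hcov, hunion⟩ := exists_gluing (J.map Nat.Partition.parts) (by
    intro μ hμ
    obtain ⟨ν, hν, rfl⟩ := Multiset.mem_map.1 hμ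
    exact ⟨ν.parts_sum, fun a ha => ν.parts_pos ha, hJ ν hν⟩) P hP3 (by
    intro a ha han
    rw [hP, excess_eq_of_rankTwoBar_eq hlam hJ hF ha han, excess_sum, Multiset.map_map]
    rfl)
  have hJeq : 𝓝.val.map partSizesPartition = J := by
    refine Multiset.map_injective (fun _ _ h => Nat.Partition.ext h) ?_ (f := Nat.Partition.parts)
    rw [Multiset.map_map, ← hmap]
    rfl
  subst hJeq
  have hN3 : ∀ Q ∈ 𝓝, 3 ≤ (partSizes Q).card := fun Q hQ =>
    hJ (partSizesPartition Q) (Multiset.mem_map_of_mem _ hQ)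
  have hN2 : ∀ Q ∈ 𝓝, 2 ≤ (partSizes Q).card := fun Q hQ => (hN3 Q hQ).trans' (by omega)
  have hP2 : 2 ≤ (partSizes P).card := by omega
  -- Matches the occurrences in `J` with the pieces, so that repeated types receive different
  -- pieces.
  set φ := 𝓝.val.mapEquiv partSizesPartition with hφ
  set q : (𝓝.val.map partSizesPartition).ToType → Finpartition (Finset.univ : Finset (Fin n)) :=
    fun j => (φ.symm j).1 with hq
  have hqmem : ∀ j, q j ∈ 𝓝 := fun j => Multiset.coe_mem
  have hqtype : ∀ j, j.1 = partSizesPartition (q j) := by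
    intro j
    have := Multiset.mapEquiv_apply 𝓝.val partSizesPartition (φ.symm j)
    rw [← hφ, Equiv.apply_symm_apply] at this
    exact this
  have hqinj : Function.Injective q := (toType_val_injective 𝓝.nodup).comp φ.symm.injective
  refine ⟨colorMatroid P.part, fun j => colorMatroid (q j).part, ?_, fun j => ?_, ?_⟩
  · exact isRankTwoOfType_colorMatroid (exists_color_ne (by rw [colorType_part]; omega))
      (by rw [colorType_part, hP])
  · have h2 := hN2 _ (hqmem j)
    exact isRankTwoOfType_colorMatroid (exists_color_ne (by rwa [colorType_part]))
      (by rw [colorType_part, hqtype]; rfl)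
  · refine ⟨⟨rfl, fun _ => rfl⟩, ?_, fun i j h => hqinj (colorMatroid_part_injective h), ?_⟩
    · apply Set.Subset.antisymm
      · intro x hx
        rw [basePolytope_part hP2] at hx
        obtain ⟨Q, hQ, hQx⟩ := hunion x hx
        have : Q ∈ 𝓝.val := hQ
        obtain ⟨v, hv⟩ : ∃ v : 𝓝.val.ToType, v.1 = Q :=
          ⟨𝓝.val.mkToType Q ⟨0, Multiset.count_pos.2 this⟩, rfl⟩
        refine Set.mem_iUnion.2 ⟨φ v, ?_⟩
        rw [basePolytope_part (hN2 _ (hqmem _))]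
        simpa [hq, hv] using hQx
      · exact Set.iUnion_subset fun j => basePolytope_part_mono hP2 (hN2 _ (hqmem j))
          (hle _ (hqmem j))
    · intro i j hij
      exact exists_inter_matroid (hN2 _ (hqmem i)) (hN2 _ (hqmem j))
        (hcov _ (hqmem i) _ (hqmem j) (hqinj.ne hij))
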